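/- Let $A=\bigoplus_{i\in\mathbb Z}A_i$ be a finite-dimensional $\mathbb Z$-graded algebra over a field $K$, with a triangular decomposition $(A^-,T,A^+)$: graded subalgebras such that (a) multiplication $A^-\otimes_K T\otimes_K A^+\to A$ is an isomorphism of vector spaces; (b) $T$ is concentrated in degree $0$, $A^+$ in degrees $\ge 0$ and $A^-$ in degrees $\le 0$; (c) $A^-_0=K=A^+_0$; (d) $A^\pm T=TA^\pm$; (e) $\operatorname{End}_T(S)=K$ for every simple $T$-module $S$. Put $B^\pm=A^\pm T$, and let $\mathcal G(A)$, $\mathcal G(T)$ be the categories of finitely generated graded left modules with degree-preserving morphisms. For $M\in\mathcal G(T)$ let $\overline\Delta(M)=A\otimes_{B^+}M$, where $B^+$ acts on $M$ through the projection $B^+\to T$ onto degree $0$, and let $\overline\nabla(M)=\bigl(A^{\mathrm{op}}\otimes_{(B^-)^{\mathrm{op}}}M^*\bigr)^*$, where $(-)^*$ is the graded $K$-linear dual and $(B^-)^{\mathrm{op}}$ acts through $T^{\mathrm{op}}$. Let $\Lambda=\operatorname{Irr}\mathcal G(T)$ be the set of isomorphism classes of simple objects of $\mathcal G(T)$, and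 let $\deg\lambda\in\mathbb Z$ be the degree in which $\lambda\in\Lambda$ is concentrated. Let $P_T(\lambda)$ and $I_T(\lambda)$ be the projective cover and the injective hull of $\lambda$ in $\mathcal G(T)$, let $L(\lambda)$ be the head of $\overline\Delta(\lambda)$, and put $\Delta(\lambda)=\overline\Delta(P_T(\lambda))$ and $\nabla(\lambda)=\overline\nabla(I_T(\lambda))$. Then $\mathcal G(A)$ is a standardly stratified category in the sense of Losev--Webster with respect to $\deg:\Lambda\to\mathbb Z$, with standard objects $\Delta(\lambda)$ and costandard objects $\nabla(\lambda)$. Explicitly: 1. $\mathcal G(A)$ is a $K$-linear abelian category of finite length with enough projectives; the $L(\lambda)$ are simple, every simple object is isomorphic to $L(\lambda)$ for exactly one $\lambda\in\Lambda$, and $\operatorname{End}(L(\lambda))=K$; intervals in $\mathbb Z$ and the fibres of $\deg$ are finite. 2. For $d\in\mathbb Z$ let $\mathcal G_{\le d}(A)$, resp. $\mathcal G_{<d}(A)$, be the Serre subcategory of $\mathcal G(A)$ spanned by the $L(\lambda)$ with $\deg\lambda\le d$, resp. $\deg\lambda<d$, and let $\pi_d:\mathcal G_{\le d}(A)\to\mathcal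 G_{\le d}(A)/\mathcal G_{<d}(A)$ be the quotient functor. Then $\pi_d$ has an exact left adjoint $\Delta_d$, and for every $\lambda$ with $\deg\lambda=d$ the object $\pi_d(L(\lambda))$ has a projective cover $P_d(\lambda)$, and $\Delta(\lambda)\simeq\Delta_d(P_d(\lambda))$. 3. For every $\lambda$ there is an epimorphism from the projective cover of $L(\lambda)$ onto $\Delta(\lambda)$ whose kernel has a finite filtration with subquotients of the form $\Delta(\mu)$ with $\deg\mu>\deg\lambda$. 4. Dually, $\pi_d$ has an exact right adjoint $\nabla_d$, for $\deg\lambda=d$ the object $\pi_d(L(\lambda))$ has an injective hull $I_d(\lambda)$, and $\nabla(\lambda)\simeq\nabla_d(I_d(\lambda))$; and for every $\lambda$ there is a monomorphism from $\nabla(\lambda)$ into the injective hull of $L(\lambda)$ whose cokernel has a finite filtration with subquotients of the form $\nabla(\mu)$ with $\deg\mu>\deg\lambda$. -/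

import Mathlib

set_option linter.unusedSectionVars false
open CategoryTheory CategoryTheory.Limits TensorProduct

universe u v w

namespace StdStrat

section
variable {C : Type u} [Category.{v} C]

/-- The epimorphism `p` is essential: `g ≫ p` epi implies `g` epi. -/
def IsEssentialEpi {P X : C} (p : P ⟶ X) : Prop :=
  Epi p ∧ ∀ ⦃Y : C⦄ (g : Y ⟶ P), Epi (g ≫ p) → Epi g

/-- The monomorphism `i` is essential: `i ≫ g` mono implies `g` mono. -/
def IsEssentialMono {X I : C} (i : X ⟶ I) : Prop :=
  Mono i ∧ ∀ ⦃Y : C⦄ (g : I ⟶ Y), Mono (i ≫ g) → Mono g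

/-- `p : P ⟶ X` is a projective cover of `X`. -/
def IsProjectiveCover {P X : C} (p : P ⟶ X) : Prop := Projective P ∧ IsEssentialEpi p

/-- `i : X ⟶ I` is an injective hull of `X`. -/
def IsInjectiveHull {X I : C} (i : X ⟶ I) : Prop := Injective I ∧ IsEssentialMono i

/-- The isomorphism classes of simple objects of `C`. -/
def Irr (C : Type u) [Category.{v} C] [HasZeroMorphisms C] : Type u :=
  Quotient ((isIsomorphicSetoid C).comap (Subtype.val : {S : C // Simple S} → C))

/-- A simple object representing an isomorphism class of simple objects. -/
noncomputable def Irr.rep {C : Type u} [Category.{v} C] [HasZeroMorphisms C] (l : Irr C) : C :=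
  (Quotient.out l).1

instance {C : Type u} [Category.{v} C] [HasZeroMorphisms C] (l : Irr C) : Simple l.rep :=
  (Quotient.out l).2

end

section
variable {C : Type u} [Category.{v} C] [Abelian C]

/-- The objects admitting a finite filtration all of whose subquotients belong to `S`. -/
inductive IsFilteredBy (S : ObjectProperty C) : ObjectProperty C
  | zero (X : C) (h : IsZero X) : IsFilteredBy S X
  | ext (E : ShortComplex C) (hE : E.ShortExact) (h₁ : IsFilteredBy S E.X₁) (h₃ : S E.X₃) :
      IsFilteredBy S E.X₂

/-- The Serre subcategory of `C` spanned by a class `S` of objects: the smallest Serre subcategory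
containing `S`. -/
def serreSpan (S : ObjectProperty C) : ObjectProperty C :=
  fun X => ∀ Q : ObjectProperty C, Q.IsSerreClass → S ≤ Q → Q X

theorem le_serreSpan (S : ObjectProperty C) : S ≤ serreSpan S := fun X hX _ _ hS => hS X hX

instance (S : ObjectProperty C) : (serreSpan S).IsSerreClass where
  exists_zero := by
    obtain ⟨Z, hZ⟩ := HasZeroObject.zero (C := C)
    exact ⟨Z, hZ, fun Q _ _ => Q.prop_of_isZero hZ⟩
  prop_of_mono f _ h := fun Q hQ hS => Q.prop_of_mono f (h Q hQ hS)
  prop_of_epi f _ h := fun Q hQ hS => Q.prop_of_epi f (h Q hQ hS)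
  prop_X₂_of_shortExact hS h₁ h₃ := fun Q hQ hSQ =>
    Q.prop_X₂_of_shortExact hS (h₁ Q hQ hSQ) (h₃ Q hQ hSQ)

theorem isClosedUnderFiniteProducts (P : ObjectProperty C) [P.IsSerreClass] :
    P.IsClosedUnderFiniteProducts := by
  have : P.IsClosedUnderBinaryProducts := by
    refine ⟨?_⟩
    rintro X ⟨p⟩
    have e : X ≅ (p.diag.obj ⟨.left⟩) ⊞ (p.diag.obj ⟨.right⟩) :=
      (IsLimit.conePointUniqueUpToIso p.isLimit
        ((IsLimit.postcomposeHomEquiv (diagramIsoPair p.diag).symm _).symm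
          (BinaryBiproduct.isLimit _ _)))
    refine P.prop_of_iso e.symm ?_
    exact P.prop_X₂_of_shortExact
      (S := ShortComplex.mk (biprod.inl : p.diag.obj ⟨.left⟩ ⟶ _)
        (biprod.snd : _ ⟶ p.diag.obj ⟨.right⟩) (by simp))
      (ShortComplex.Splitting.ofHasBinaryBiproduct _ _).shortExact
      (p.prop_diag_obj _) (p.prop_diag_obj _)
  exact ObjectProperty.IsClosedUnderFiniteProducts.mk'

attribute [instance] isClosedUnderFiniteProducts

theorem inverseImage_isSerreClass (P Q : ObjectProperty C) [P.IsSerreClass] [Q.IsSerreClass] :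
    (P.inverseImage Q.ι).IsSerreClass := by
  have := Q.preservesMonomorphisms_ι_of_isNormalEpiCategory
  have := Q.preservesEpimorphisms_ι_of_isNormalMonoCategory
  have hk := Q.preservesKernels_ι
  have hc := Q.preservesCokernels_ι
  have : PreservesFiniteLimits Q.ι := Functor.preservesFiniteLimits_of_preservesKernels _
  have : PreservesFiniteColimits Q.ι := Functor.preservesFiniteColimits_of_preservesCokernels _
  infer_instance

attribute [instance] inverseImage_isSerreClass

variable {Λ : Type w} {Ξ : Type*} [PartialOrder Ξ] (L : Λ → C) (d : Λ → Ξ) (ξ : Ξ)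

/-- The Serre subcategory `C_{≤ ξ}` spanned by the `L(λ)` with `d(λ) ≤ ξ`. -/
def below : ObjectProperty C := serreSpan fun X => ∃ l, d l ≤ ξ ∧ Nonempty (X ≅ L l)

/-- The Serre subcategory `C_{< ξ}` spanned by the `L(λ)` with `d(λ) < ξ`. -/
def strictlyBelow : ObjectProperty C := serreSpan fun X => ∃ l, d l < ξ ∧ Nonempty (X ≅ L l)

instance : (below L d ξ).IsSerreClass := inferInstanceAs (serreSpan _).IsSerreClass

instance : (strictlyBelow L d ξ).IsSerreClass := inferInstanceAs (serreSpan _).IsSerreClass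

/-- The morphisms of `C_{≤ ξ}` with kernel and cokernel in `C_{< ξ}`. -/
def layerW : MorphismProperty (below L d ξ).FullSubcategory :=
  ((strictlyBelow L d ξ).inverseImage (below L d ξ).ι).isoModSerre

/-- The layer `C_ξ = C_{≤ ξ} / C_{< ξ}`, the Serre quotient category. -/
abbrev Layer := (layerW L d ξ).Localization

/-- The quotient functor `π_ξ : C_{≤ ξ} ⥤ C_ξ`. -/
abbrev layerπ : (below L d ξ).FullSubcategory ⥤ Layer L d ξ := (layerW L d ξ).Q

variable {L d ξ} in
/-- The object `L(λ)` of `C_{≤ ξ}`, for `d(λ) = ξ`. -/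
def simpleBelow (l : Λ) (h : d l = ξ) : (below L d ξ).FullSubcategory :=
  ⟨L l, le_serreSpan _ _ ⟨l, h.le, ⟨Iso.refl _⟩⟩⟩

/-- The `K`-linear abelian category `C`, with simple objects `L(λ)` indexed by `λ ∈ Λ` and the map
`d : Λ → Ξ`, is standardly stratified, with standard objects `Δ(λ)`. -/
structure IsStandardlyStratified (K : Type*) [Field K] [Linear K C] (L : Λ → C) (d : Λ → Ξ)
    (Δ : Λ → C) : Prop where
  noetherian : ∀ X : C, IsNoetherianObject X
  artinian : ∀ X : C, IsArtinianObject X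
  enoughProjectives : EnoughProjectives C
  simple : ∀ l, Simple (L l)
  existsUnique_iso : ∀ S : C, Simple S → ∃! l, Nonempty (S ≅ L l)
  absolutelySimple : ∀ l (f : L l ⟶ L l), ∃ c : K, f = c • 𝟙 (L l)
  intervalFinite : ∀ x y : Ξ, (Set.Icc x y).Finite
  finiteFibers : ∀ ξ, (d ⁻¹' {ξ}).Finite
  /-- every quotient functor `π_ξ` has an exact left adjoint `F = Δ_ξ`, and `Δ(λ) = Δ_ξ(P_ξ(λ))` for
  `d(λ) = ξ`, where `P_ξ(λ)` is the projective cover of `L_ξ(λ) = π_ξ(L(λ))` -/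
  standardization : ∀ ξ, ∃ F : Layer L d ξ ⥤ (below L d ξ).FullSubcategory,
    Nonempty (F ⊣ layerπ L d ξ) ∧ PreservesFiniteLimits F ∧ PreservesFiniteColimits F ∧
    ∀ l (h : d l = ξ), ∃ (P : Layer L d ξ) (p : P ⟶ (layerπ L d ξ).obj (simpleBelow l h)),
      IsProjectiveCover p ∧ Nonempty (Δ l ≅ (F.obj P).obj)
  /-- `P(λ)` surjects onto `Δ(λ)`, with kernel filtered by `Δ(μ)` for `μ > λ` -/
  standardFiltration : ∀ l, ∃ (P : C) (p : P ⟶ L l) (q : P ⟶ Δ l), IsProjectiveCover p ∧ Epi q ∧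
    IsFilteredBy (fun X => ∃ m, d l < d m ∧ Nonempty (X ≅ Δ m)) (kernel q)

/-- The objects `N(λ)` are the costandard objects with respect to `L` and `d` (the notion dual to
that of standard objects). -/
structure IsCostandard (L : Λ → C) (d : Λ → Ξ) (N : Λ → C) : Prop where
  /-- every quotient functor `π_ξ` has an exact right adjoint `G = ∇_ξ`, and `N(λ) = ∇_ξ(I_ξ(λ))` for
  `d(λ) = ξ`, where `I_ξ(λ)` is the injective hull of `L_ξ(λ) = π_ξ(L(λ))` -/
  costandardization : ∀ ξ, ∃ G : Layer L d ξ ⥤ (below L d ξ).FullSubcategory,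
    Nonempty (layerπ L d ξ ⊣ G) ∧ PreservesFiniteLimits G ∧ PreservesFiniteColimits G ∧
    ∀ l (h : d l = ξ), ∃ (I : Layer L d ξ) (i : (layerπ L d ξ).obj (simpleBelow l h) ⟶ I),
      IsInjectiveHull i ∧ Nonempty (N l ≅ (G.obj I).obj)
  /-- `N(λ)` embeds into `I(λ)`, with cokernel filtered by `N(μ)` for `μ > λ` -/
  costandardFiltration : ∀ l, ∃ (I : C) (i : L l ⟶ I) (q : N l ⟶ I), IsInjectiveHull i ∧ Mono q ∧
    IsFilteredBy (fun X => ∃ m, d l < d m ∧ Nonempty (X ≅ N m)) (cokernel q)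

end
end StdStrat

namespace GradedAlg

section Internal
variable {K : Type*} [Field K] {M : Type*} [AddCommGroup M] [Module K M]

/-- The projection onto the component of degree `i` of an internally graded vector space. -/
noncomputable def proj {S : ℤ → Submodule K M} (h : DirectSum.IsInternal S) (i : ℤ) : M →ₗ[K] M :=
  letI : DirectSum.Decomposition S := h.chooseDecomposition
  (S i).subtype ∘ₗ DirectSum.component K ℤ (fun i => S i) i ∘ₗ
    (DirectSum.decomposeLinearEquiv S).toLinearMap

theorem proj_mem {S : ℤ → Submodule K M} (h : DirectSum.IsInternal S) (i : ℤ) (x : M) :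
    proj h i x ∈ S i := Submodule.coe_mem _

theorem proj_self {S : ℤ → Submodule K M} (h : DirectSum.IsInternal S) {i : ℤ} {x : M}
    (hx : x ∈ S i) : proj h i x = x := by
  let : DirectSum.Decomposition S := h.chooseDecomposition
  exact DirectSum.decompose_of_mem_same S hx

theorem proj_of_ne {S : ℤ → Submodule K M} (h : DirectSum.IsInternal S) {i j : ℤ} {x : M}
    (hij : i ≠ j) (hx : x ∈ S j) : proj h i x = 0 := by
  let : DirectSum.Decomposition S := h.chooseDecomposition
  exact DirectSum.decompose_of_mem_ne S hx hij.symm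

theorem isInternal_of_proj {S : ℤ → Submodule K M} (p : ℤ → M →ₗ[K] M)
    (hp : ∀ i, ∀ x ∈ S i, p i x = x) (h0 : ∀ i j, i ≠ j → ∀ x ∈ S j, p i x = 0)
    (htop : ∀ x, x ∈ ⨆ i, S i) : DirectSum.IsInternal S := by
  rw [DirectSum.isInternal_submodule_iff_iSupIndep_and_iSup_eq_top]
  refine ⟨fun i => ?_, (Submodule.eq_top_iff').2 htop⟩
  rw [Submodule.disjoint_def]
  intro x hx hx'
  rw [← hp i x hx]
  have : (⨆ j, ⨆ (_ : j ≠ i), S j) ≤ LinearMap.ker (p i) :=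
    iSup₂_le fun j hj y hy => h0 i j hj.symm y hy
  exact this hx'

theorem mem_iSup_of_isInternal {S : ℤ → Submodule K M} (h : DirectSum.IsInternal S) (x : M) :
    x ∈ ⨆ i, S i := by
  rw [h.submodule_iSup_eq_top]; trivial

set_option synthInstance.maxHeartbeats 100000 in
theorem finite_support [FiniteDimensional K M] {S : ℤ → Submodule K M}
    (h : DirectSum.IsInternal S) : {i | S i ≠ ⊥}.Finite :=
  WellFoundedGT.finite_ne_bot_of_iSupIndep h.submodule_iSupIndep

theorem sum_proj {S : ℤ → Submodule K M} (h : DirectSum.IsInternal S) (s : Finset ℤ)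
    (hs : ∀ i, S i ≠ ⊥ → i ∈ s) (x : M) : ∑ i ∈ s, proj h i x = x := by
  refine Submodule.iSup_induction S (motive := fun x => ∑ i ∈ s, proj h i x = x)
    (mem_iSup_of_isInternal h x) ?_ (by simp) ?_
  · intro i x hx
    by_cases h0 : x = 0
    · simp [h0]
    rw [Finset.sum_eq_single i, proj_self h hx]
    · intro j _ hj; exact proj_of_ne h hj hx
    · intro hi
      exact absurd (hs i fun hb => h0 (by simpa [hb] using hx)) hi
  · intro x y hx hy
    simp only [map_add, Finset.sum_add_distrib, hx, hy]

theorem isInternal_quotient {A : Type*} [Ring A] [Algebra K A] [Module A M] [IsScalarTower K A M]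
    {S : ℤ → Submodule K M} (h : DirectSum.IsInternal S) (N : Submodule A M)
    (hN : ∀ i, ∀ x ∈ N, proj h i x ∈ N) :
    DirectSum.IsInternal (fun i => (S i).map (N.mkQ.restrictScalars K)) := by
  have hle : ∀ i, N.restrictScalars K ≤ (N.restrictScalars K).comap (proj h i) := fun i x hx =>
    hN i x hx
  obtain ⟨p, hpm⟩ : ∃ p : ℤ → (M ⧸ N) →ₗ[K] (M ⧸ N),
      ∀ i x, p i (N.mkQ x) = N.mkQ (proj h i x) :=
    ⟨fun i => (N.restrictScalars K).mapQ (N.restrictScalars K) (proj h i) (hle i), fun i x => rfl⟩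
  refine isInternal_of_proj p ?_ ?_ ?_
  · rintro i _ ⟨x, hx, rfl⟩
    simp only [LinearMap.coe_restrictScalars, hpm, proj_self h hx]
  · rintro i j hij _ ⟨x, hx, rfl⟩
    simp only [LinearMap.coe_restrictScalars, hpm, proj_of_ne h hij hx, map_zero]
  · intro x
    obtain ⟨x, rfl⟩ := N.mkQ_surjective x
    rw [← Submodule.map_iSup]
    exact ⟨x, mem_iSup_of_isInternal h x, rfl⟩

theorem isInternal_sub {A : Type*} [Ring A] [Algebra K A] [Module A M] [IsScalarTower K A M]
    [FiniteDimensional K M]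
    {S : ℤ → Submodule K M} (h : DirectSum.IsInternal S) (N : Submodule A M)
    (hN : ∀ i, ∀ x ∈ N, proj h i x ∈ N) :
    DirectSum.IsInternal (fun i => (S i).comap (N.subtype.restrictScalars K)) := by
  let p : ℤ → N →ₗ[K] N := fun i => (proj h i).restrict (p := N.restrictScalars K)
    (q := N.restrictScalars K) (hN i)
  have hpm : ∀ i x, ((p i x : N) : M) = proj h i x := fun i x => rfl
  refine isInternal_of_proj p ?_ ?_ ?_
  · intro i x hx
    exact Subtype.ext (by rw [hpm]; exact proj_self h hx)
  · intro i j hij x hx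
    exact Subtype.ext (by rw [hpm]; exact proj_of_ne h hij hx)
  · intro x
    have : x = ∑ i ∈ (finite_support h).toFinset, p i x := by
      apply Subtype.ext
      have := sum_proj h (finite_support h).toFinset (by simp) (x : M)
      rw [AddSubmonoidClass.coe_finsetSum]
      simpa only [hpm] using this.symm
    rw [this]
    exact Submodule.sum_mem _ fun i _ => Submodule.mem_iSup_of_mem i (proj_mem h i _)

end Internal

section Op
open MulOpposite
variable {K : Type u} [Field K] {A : Type u} [Ring A] [Algebra K A]

/-- The reversed grading on the opposite algebra: `(Aᵒᵖ)_i = A_{-i}`. -/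
def opGrading (𝒜 : ℤ → Submodule K A) : ℤ → Submodule K Aᵐᵒᵖ :=
  fun i => (𝒜 (-i)).comap (opLinearEquiv K).symm.toLinearMap

/-- The family `𝒜` is a grading of the algebra `A` (as a mere proposition). -/
structure IsGrading (𝒜 : ℤ → Submodule K A) : Prop where
  isInternal : DirectSum.IsInternal 𝒜
  one_mem : (1 : A) ∈ 𝒜 0
  mul_mem : ∀ {i j : ℤ} {a b : A}, a ∈ 𝒜 i → b ∈ 𝒜 j → a * b ∈ 𝒜 (i + j)

theorem IsGrading.of (𝒜 : ℤ → Submodule K A) [GradedAlgebra 𝒜] : IsGrading 𝒜 where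
  isInternal := DirectSum.Decomposition.isInternal 𝒜
  one_mem := SetLike.GradedOne.one_mem
  mul_mem ha hb := SetLike.mul_mem_graded ha hb

theorem IsGrading.op {𝒜 : ℤ → Submodule K A} (h : IsGrading 𝒜) : IsGrading (opGrading 𝒜) where
  isInternal := by
    let e := opLinearEquiv K (M := A)
    refine isInternal_of_proj (fun i => e.toLinearMap ∘ₗ proj h.isInternal (-i) ∘ₗ
      e.symm.toLinearMap) ?_ ?_ ?_
    · intro i x hx
      have hx' : e.symm x ∈ 𝒜 (-i) := hx
      change e (proj h.isInternal (-i) (e.symm x)) = x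
      rw [proj_self h.isInternal hx', e.apply_symm_apply]
    · intro i j hij x hx
      have hx' : e.symm x ∈ 𝒜 (-j) := hx
      change e (proj h.isInternal (-i) (e.symm x)) = 0
      rw [proj_of_ne h.isInternal (neg_injective.ne hij) hx', map_zero]
    · intro x
      obtain ⟨x, rfl⟩ := op_surjective x
      refine Submodule.iSup_induction 𝒜 (motive := fun x => MulOpposite.op x ∈ ⨆ i, opGrading 𝒜 i)
        (mem_iSup_of_isInternal h.isInternal x) ?_ (by simp) ?_
      · intro i x hx
        refine Submodule.mem_iSup_of_mem (-i) ?_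
        simpa [opGrading] using hx
      · intro x y hx hy
        exact Submodule.add_mem _ hx hy
  one_mem := by simpa [opGrading] using h.one_mem
  mul_mem {i j a b} ha hb := by
    have := h.mul_mem hb ha
    simp only [opGrading, Submodule.mem_comap] at *
    rwa [← neg_add_rev] at this

end Op
section GrMod
variable {K : Type u} [Field K] {A : Type u} [Ring A] [Algebra K A]

/-- A finitely generated graded module over the `K`-algebra `A` with grading `𝒜`. -/
structure GrMod (𝒜 : ℤ → Submodule K A) where
  carrier : Type u
  [addCommGroup : AddCommGroup carrier]
  [moduleK : Module K carrier]
  [module : Module A carrier]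
  [isScalarTower : IsScalarTower K A carrier]
  [finite : Module.Finite A carrier]
  gr : ℤ → Submodule K carrier
  isInternal : DirectSum.IsInternal gr
  smul_mem : ∀ {i j : ℤ} {a : A} {m : carrier}, a ∈ 𝒜 i → m ∈ gr j → a • m ∈ gr (i + j)

namespace GrMod
attribute [instance] addCommGroup moduleK module isScalarTower finite

variable {𝒜 : ℤ → Submodule K A}

instance : CoeSort (GrMod 𝒜) (Type u) := ⟨carrier⟩

/-- Morphisms of graded modules: the `A`-linear maps preserving the grading. -/
def homs (M N : GrMod 𝒜) : Submodule K (M →ₗ[A] N) where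
  carrier := {f | ∀ i, ∀ m ∈ M.gr i, f m ∈ N.gr i}
  add_mem' hf hg i m hm := Submodule.add_mem _ (hf i m hm) (hg i m hm)
  zero_mem' _ _ _ := Submodule.zero_mem _
  smul_mem' c _ hf i m hm := Submodule.smul_mem _ c (hf i m hm)

instance : Category (GrMod 𝒜) where
  Hom M N := homs M N
  id M := ⟨LinearMap.id, fun _ _ hm => hm⟩
  comp f g := ⟨g.1 ∘ₗ f.1, fun i m hm => g.2 i _ (f.2 i m hm)⟩

/-- The linear map underlying a morphism of graded modules. -/
def toLin {M N : GrMod 𝒜} (f : M ⟶ N) : M →ₗ[A] N := Subtype.val (p := (· ∈ homs M N)) f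

/-- A linear map preserving the grading is a morphism of graded modules. -/
def ofLin {M N : GrMod 𝒜} (f : M →ₗ[A] N) (hf : ∀ i, ∀ m ∈ M.gr i, f m ∈ N.gr i) : M ⟶ N :=
  (⟨f, hf⟩ : homs M N)

theorem toLin_mem {M N : GrMod 𝒜} (f : M ⟶ N) {i : ℤ} {m : M} (hm : m ∈ M.gr i) :
    toLin f m ∈ N.gr i := Subtype.property (p := (· ∈ homs M N)) f i m hm

@[simp] theorem toLin_ofLin {M N : GrMod 𝒜} (f : M →ₗ[A] N)
    (hf : ∀ i, ∀ m ∈ M.gr i, f m ∈ N.gr i) : toLin (ofLin f hf) = f := rfl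

theorem hom_ext {M N : GrMod 𝒜} {f g : M ⟶ N} (h : ∀ m, toLin f m = toLin g m) : f = g :=
  Subtype.ext (p := (· ∈ homs M N)) (LinearMap.ext h)

@[simp] theorem toLin_id (M : GrMod 𝒜) : toLin (𝟙 M) = LinearMap.id := rfl

@[simp] theorem toLin_comp {M N P : GrMod 𝒜} (f : M ⟶ N) (g : N ⟶ P) :
    toLin (f ≫ g) = toLin g ∘ₗ toLin f := rfl

instance : Preadditive (GrMod 𝒜) where
  homGroup M N := inferInstanceAs (AddCommGroup (homs M N))
  add_comp _ _ _ _ _ g := hom_ext fun _ => map_add (toLin g) _ _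
  comp_add _ _ _ _ _ _ := rfl

@[simp] theorem toLin_zero (M N : GrMod 𝒜) : toLin (0 : M ⟶ N) = 0 := rfl

instance : Linear K (GrMod 𝒜) where
  homModule M N := inferInstanceAs (Module K (homs M N))
  smul_comp M N P c f g := hom_ext fun m => by
    change toLin g (c • toLin f m) = c • toLin g (toLin f m)
    rw [← algebraMap_smul A c, map_smul, algebraMap_smul]
  comp_smul M N P f c g := rfl

theorem toLin_proj {M N : GrMod 𝒜} (f : M ⟶ N) (i : ℤ) (m : M) :
    toLin f (proj M.isInternal i m) = proj N.isInternal i (toLin f m) := by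
  refine Submodule.iSup_induction M.gr
    (motive := fun m => toLin f (proj M.isInternal i m) = proj N.isInternal i (toLin f m))
    (mem_iSup_of_isInternal M.isInternal m) ?_ (by simp) ?_
  · intro j m hm
    by_cases h : i = j
    · subst h
      rw [proj_self _ hm, proj_self _ (toLin_mem f hm)]
    · rw [proj_of_ne _ h hm, proj_of_ne _ h (toLin_mem f hm), map_zero]
  · intro x y hx hy
    simp only [map_add, hx, hy]

theorem finiteDimensional [FiniteDimensional K A] (M : GrMod 𝒜) : FiniteDimensional K M :=
  Module.Finite.trans A M

/-- The graded quotient by a homogeneous submodule. -/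
def quot (M : GrMod 𝒜) (N : Submodule A M) (hN : ∀ i, ∀ x ∈ N, proj M.isInternal i x ∈ N) :
    GrMod 𝒜 where
  carrier := M ⧸ N
  gr i := (M.gr i).map (N.mkQ.restrictScalars K)
  isInternal := isInternal_quotient M.isInternal N hN
  smul_mem := by
    rintro i j a _ ha ⟨m, hm, rfl⟩
    exact ⟨a • m, M.smul_mem ha hm, rfl⟩

/-- A homogeneous submodule as a graded module. -/
def sub [FiniteDimensional K A] (M : GrMod 𝒜) (N : Submodule A M)
    (hN : ∀ i, ∀ x ∈ N, proj M.isInternal i x ∈ N) : GrMod 𝒜 where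
  carrier := N
  finite := by
    have := M.finiteDimensional
    have : FiniteDimensional K N :=
      inferInstanceAs (FiniteDimensional K (N.restrictScalars K))
    exact Module.Finite.of_restrictScalars_finite K A N
  gr i := (M.gr i).comap (N.subtype.restrictScalars K)
  isInternal := by
    have := M.finiteDimensional
    exact isInternal_sub M.isInternal N hN
  smul_mem ha hm := M.smul_mem ha hm

theorem proj_ker {M N : GrMod 𝒜} (f : M ⟶ N) (i : ℤ) (x : M) (hx : x ∈ (toLin f).ker) :
    proj M.isInternal i x ∈ (toLin f).ker := by
  rw [LinearMap.mem_ker] at *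
  rw [toLin_proj, hx, map_zero]

theorem proj_range {M N : GrMod 𝒜} (f : M ⟶ N) (i : ℤ) (x : N) (hx : x ∈ (toLin f).range) :
    proj N.isInternal i x ∈ (toLin f).range := by
  obtain ⟨m, rfl⟩ := hx
  exact ⟨_, toLin_proj f i m⟩

section Kernel
variable [FiniteDimensional K A] {M N : GrMod 𝒜} (f : M ⟶ N)

/-- The inclusion of a homogeneous submodule. -/
def subι (M : GrMod 𝒜) (P : Submodule A M) (hP : ∀ i, ∀ x ∈ P, proj M.isInternal i x ∈ P) :
    sub M P hP ⟶ M := ofLin P.subtype fun _ _ hm => hm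

/-- The projection onto a quotient by a homogeneous submodule. -/
def quotπ (M : GrMod 𝒜) (P : Submodule A M) (hP : ∀ i, ∀ x ∈ P, proj M.isInternal i x ∈ P) :
    M ⟶ quot M P hP := ofLin P.mkQ fun _ m hm => ⟨m, hm, rfl⟩

/-- The kernel of a morphism of graded modules. -/
def ker : GrMod 𝒜 := sub M (toLin f).ker (proj_ker f)

/-- The inclusion of the kernel. -/
def kerι : ker f ⟶ M := subι M _ (proj_ker f)

theorem kerι_comp : kerι f ≫ f = 0 := hom_ext fun m => m.2

/-- Morphisms killed by `f` factor through the kernel. -/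
def kerLift {Z : GrMod 𝒜} (g : Z ⟶ M) (h : g ≫ f = 0) : Z ⟶ ker f :=
  ofLin ((toLin g).codRestrict _ fun z => LinearMap.congr_fun (congrArg toLin h) z)
    fun _ _ hm => toLin_mem g hm

/-- `kerι f` is a kernel of `f`. -/
def kerIsLimit : IsLimit (KernelFork.ofι (kerι f) (kerι_comp f)) :=
  KernelFork.IsLimit.ofι _ _ (fun g h => kerLift f g h) (fun _ _ => rfl)
    (fun _ _ _ hm => hom_ext fun z => Subtype.ext (LinearMap.congr_fun (congrArg toLin hm) z))

/-- The cokernel of a morphism of graded modules. -/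
def coker : GrMod 𝒜 := quot N (toLin f).range (proj_range f)

/-- The projection onto the cokernel. -/
def cokerπ : N ⟶ coker f := quotπ N _ (proj_range f)

theorem comp_cokerπ : f ≫ cokerπ f = 0 :=
  hom_ext fun m => (Submodule.Quotient.mk_eq_zero _).2 ⟨m, rfl⟩

/-- Morphisms killing `f` factor through the cokernel. -/
def cokerDesc {Z : GrMod 𝒜} (g : N ⟶ Z) (h : f ≫ g = 0) : coker f ⟶ Z :=
  ofLin ((toLin f).range.liftQ (toLin g) (by
    rintro _ ⟨m, rfl⟩
    exact LinearMap.congr_fun (congrArg toLin h) m)) (by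
    rintro i _ ⟨m, hm, rfl⟩
    exact toLin_mem g hm)

/-- `cokerπ f` is a cokernel of `f`. -/
def cokerIsColimit : IsColimit (CokernelCofork.ofπ (cokerπ f) (comp_cokerπ f)) :=
  CokernelCofork.IsColimit.ofπ _ _ (fun g h => cokerDesc f g h) (fun _ _ => rfl)
    (fun g h m hm => hom_ext fun z => by
      obtain ⟨z, rfl⟩ := Submodule.mkQ_surjective _ z
      exact LinearMap.congr_fun (congrArg toLin hm) z)

theorem injective_of_mono [Mono f] : Function.Injective (toLin f) := by
  rw [← LinearMap.ker_eq_bot, LinearMap.ker_eq_bot']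
  intro m hm
  have h : kerι f = 0 := by
    rw [← cancel_mono f, kerι_comp, zero_comp]
  exact LinearMap.congr_fun (congrArg toLin h) ⟨m, hm⟩

theorem surjective_of_epi [Epi f] : Function.Surjective (toLin f) := by
  intro n
  have h : cokerπ f = 0 := by
    rw [← cancel_epi f, comp_cokerπ, comp_zero]
  exact (Submodule.Quotient.mk_eq_zero _).1 (LinearMap.congr_fun (congrArg toLin h) n)

theorem mem_gr_of_injective (hf : Function.Injective (toLin f)) {i : ℤ} {m : M}
    (h : toLin f m ∈ N.gr i) : m ∈ M.gr i := by
  have : proj M.isInternal i m = m := hf (by rw [toLin_proj, proj_self _ h])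
  rw [← this]
  exact proj_mem _ _ _

instance : HasKernels (GrMod 𝒜) := ⟨fun f => ⟨_, kerIsLimit f⟩⟩

instance : HasCokernels (GrMod 𝒜) := ⟨fun f => ⟨_, cokerIsColimit f⟩⟩

instance : IsNormalMonoCategory (GrMod 𝒜) where
  normalMonoOfMono {M N} f _ := by
    have hf := injective_of_mono f
    let e := LinearEquiv.ofInjective (toLin f) hf
    have key : ∀ {Z : GrMod 𝒜} (g : Z ⟶ N), g ≫ cokerπ f = 0 → ∀ z, toLin g z ∈ (toLin f).range :=
      fun g h z => (Submodule.Quotient.mk_eq_zero _).1 (LinearMap.congr_fun (congrArg toLin h) z)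
    have he : ∀ x, toLin f (e.symm x) = x := fun x =>
      congrArg Subtype.val (e.apply_symm_apply x)
    exact ⟨{
      Z := coker f
      g := cokerπ f
      w := comp_cokerπ f
      isLimit := KernelFork.IsLimit.ofι _ _
        (fun g h => ofLin (e.symm.toLinearMap ∘ₗ (toLin g).codRestrict _ (key g h))
          (fun i m hm => mem_gr_of_injective f hf (by
            simpa [he] using toLin_mem g hm)))
        (fun g h => hom_ext fun z => by simp [he])
        (fun g h m hm => hom_ext fun z => hf (by
          simp only [toLin_ofLin, LinearMap.coe_comp, LinearEquiv.coe_coe, Function.comp_apply, he]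
          exact LinearMap.congr_fun (congrArg toLin hm) z)) }⟩

instance : IsNormalEpiCategory (GrMod 𝒜) where
  normalEpiOfEpi {M N} f _ := by
    have hf := surjective_of_epi f
    let e := (toLin f).quotKerEquivOfSurjective hf
    have he : ∀ m, e.symm (toLin f m) = (toLin f).ker.mkQ m := fun m => by
      rw [LinearEquiv.symm_apply_eq]; rfl
    have hgr : ∀ i, ∀ n ∈ N.gr i, ∃ m ∈ M.gr i, toLin f m = n := by
      intro i n hn
      obtain ⟨m, rfl⟩ := hf n
      exact ⟨_, proj_mem M.isInternal i m, by rw [toLin_proj, proj_self _ hn]⟩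
    have key : ∀ {Z : GrMod 𝒜} (g : M ⟶ Z), kerι f ≫ g = 0 → (toLin f).ker ≤ (toLin g).ker :=
      fun g h z hz => LinearMap.congr_fun (congrArg toLin h) ⟨z, hz⟩
    exact ⟨{
      W := ker f
      g := kerι f
      w := kerι_comp f
      isColimit := CokernelCofork.IsColimit.ofπ _ _
        (fun g h => ofLin ((toLin f).ker.liftQ (toLin g) (key g h) ∘ₗ e.symm.toLinearMap)
          (by
            intro i n hn
            obtain ⟨m, hm, rfl⟩ := hgr i n hn
            simpa [he] using toLin_mem g hm))
        (fun g h => hom_ext fun z => by simp [he])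
        (fun g h m hm => hom_ext fun z => by
          obtain ⟨z, rfl⟩ := hf z
          simp only [toLin_ofLin, LinearMap.coe_comp, LinearEquiv.coe_coe, Function.comp_apply, he]
          exact LinearMap.congr_fun (congrArg toLin hm) z) }⟩

end Kernel

/-- The zero graded module. -/
def zero (𝒜 : ℤ → Submodule K A) : GrMod 𝒜 where
  carrier := PUnit
  gr _ := ⊤
  isInternal := isInternal_of_proj (fun _ => 0) (fun _ _ _ => rfl) (fun _ _ _ _ _ => rfl)
    (fun x => by rw [Subsingleton.elim x 0]; exact Submodule.zero_mem _)
  smul_mem _ _ := trivial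

instance : HasZeroObject (GrMod 𝒜) :=
  ⟨zero 𝒜, (IsZero.iff_id_eq_zero _).2 (hom_ext fun _ => rfl)⟩

/-- The direct sum of two graded modules. -/
def prod (M N : GrMod 𝒜) : GrMod 𝒜 where
  carrier := M × N
  gr i := (M.gr i).prod (N.gr i)
  isInternal := by
    refine isInternal_of_proj
      (fun i => (proj M.isInternal i).prodMap (proj N.isInternal i)) ?_ ?_ ?_
    · rintro i ⟨x, y⟩ ⟨hx, hy⟩
      simp [proj_self _ hx, proj_self _ hy]
    · rintro i j hij ⟨x, y⟩ ⟨hx, hy⟩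
      simp [proj_of_ne _ hij hx, proj_of_ne _ hij hy]
    · rintro ⟨x, y⟩
      have h1 : ∀ x, ((x, 0) : M × N) ∈ ⨆ i, (M.gr i).prod (N.gr i) := fun x => by
        have : (⨆ i, M.gr i) ≤ (⨆ i, (M.gr i).prod (N.gr i)).comap (LinearMap.inl K M N) :=
          iSup_le fun i m hm => Submodule.mem_iSup_of_mem i ⟨hm, Submodule.zero_mem _⟩
        exact this (mem_iSup_of_isInternal M.isInternal x)
      have h2 : ∀ y, ((0, y) : M × N) ∈ ⨆ i, (M.gr i).prod (N.gr i) := fun y => by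
        have : (⨆ i, N.gr i) ≤ (⨆ i, (M.gr i).prod (N.gr i)).comap (LinearMap.inr K M N) :=
          iSup_le fun i m hm => Submodule.mem_iSup_of_mem i ⟨Submodule.zero_mem _, hm⟩
        exact this (mem_iSup_of_isInternal N.isInternal y)
      simpa using Submodule.add_mem _ (h1 x) (h2 y)
  smul_mem ha hm := ⟨M.smul_mem ha hm.1, N.smul_mem ha hm.2⟩

instance : HasBinaryBiproducts (GrMod 𝒜) where
  has_binary_biproduct M N := hasBinaryBiproduct_of_total
    { pt := prod M N
      fst := ofLin (LinearMap.fst A M N) fun _ _ h => h.1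
      snd := ofLin (LinearMap.snd A M N) fun _ _ h => h.2
      inl := ofLin (LinearMap.inl A M N) fun _ _ h => ⟨h, Submodule.zero_mem _⟩
      inr := ofLin (LinearMap.inr A M N) fun _ _ h => ⟨Submodule.zero_mem _, h⟩
      inl_fst := rfl
      inl_snd := rfl
      inr_fst := rfl
      inr_snd := rfl }
    (hom_ext fun x => Prod.ext (add_zero x.1) (zero_add x.2))

instance : HasFiniteProducts (GrMod 𝒜) :=
  hasFiniteProducts_of_has_binary_and_terminal

instance [FiniteDimensional K A] : Abelian (GrMod 𝒜) where

end GrMod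
end GrMod

section Functors
variable {K : Type u} [Field K] {A : Type u} [Ring A] [Algebra K A] {R : Type u} [Ring R]
  [Algebra K R]

namespace GrMod

/-- Restriction of scalars of graded modules along a homomorphism of graded algebras. -/
def restrict {ℛ : ℤ → Submodule K R} {𝒜 : ℤ → Submodule K A} [FiniteDimensional K A]
    (φ : R →ₐ[K] A) (hφ : ∀ i, ∀ r ∈ ℛ i, φ r ∈ 𝒜 i) (M : GrMod 𝒜) : GrMod ℛ :=
  letI : Module R M := Module.compHom M φ.toRingHom
  haveI : IsScalarTower K R M := ⟨fun c r m => by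
    change φ (c • r) • m = c • φ r • m
    rw [map_smul, smul_assoc]⟩
  { carrier := M
    finite := by
      have := M.finiteDimensional
      exact Module.Finite.of_restrictScalars_finite K R M
    gr := M.gr
    isInternal := M.isInternal
    smul_mem := fun ha hm => M.smul_mem (hφ _ _ ha) hm }

section Dual
open MulOpposite

/-- The action of the opposite algebra on the dual of a module, `(a f)(m) = f(a m)`. -/
@[reducible] def dualModule (K R M : Type u) [Field K] [Ring R] [Algebra K R] [AddCommGroup M]
    [Module K M] [Module R M] [IsScalarTower K R M] : Module Rᵐᵒᵖ (Module.Dual K M) where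
  smul a f := f ∘ₗ Algebra.lsmul K K M a.unop
  one_smul f := LinearMap.ext fun m => congrArg f (one_smul R m)
  mul_smul a b f := LinearMap.ext fun m => congrArg f (mul_smul b.unop a.unop m)
  smul_zero _ := rfl
  smul_add _ _ _ := rfl
  add_smul a b f := LinearMap.ext fun m =>
    (congrArg f (add_smul a.unop b.unop m)).trans (map_add f _ _)
  zero_smul f := LinearMap.ext fun m => (congrArg f (zero_smul R m)).trans (map_zero f)

/-- The standard dual `M* = Hom_K(M, K)` of a graded left module, as a graded left module over the
opposite algebra; `(M*)_i` consists of the linear forms vanishing on `M_j` for `j ≠ i`. -/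
def dual {ℛ : ℤ → Submodule K R} [FiniteDimensional K R] (M : GrMod ℛ) :
    GrMod (opGrading ℛ) :=
  letI : Module Rᵐᵒᵖ (Module.Dual K M) := dualModule K R M
  haveI : IsScalarTower K Rᵐᵒᵖ (Module.Dual K M) := ⟨fun c r f => LinearMap.ext fun m => by
    change f ((c • r.unop) • m) = c • f (r.unop • m)
    rw [smul_assoc, map_smul]⟩
  { carrier := Module.Dual K M
    finite := by
      have := M.finiteDimensional
      exact Module.Finite.of_restrictScalars_finite K Rᵐᵒᵖ (Module.Dual K M)
    gr := fun i =>
      { carrier := {f | ∀ j, j ≠ i → ∀ m ∈ M.gr j, f m = 0}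
        add_mem' := fun {f g} hf hg j hj m hm => by
          rw [LinearMap.add_apply, hf j hj m hm, hg j hj m hm, add_zero]
        zero_mem' := fun _ _ _ _ => rfl
        smul_mem' := fun c f hf j hj m hm => by
          rw [LinearMap.smul_apply, hf j hj m hm, smul_zero] }
    isInternal := by
      have := M.finiteDimensional
      refine isInternal_of_proj (fun i => (proj M.isInternal i).dualMap) ?_ ?_ ?_
      · intro i f hf
        refine LinearMap.ext fun m => ?_
        refine Submodule.iSup_induction M.gr
          (motive := fun m => f (proj M.isInternal i m) = f m)
          (mem_iSup_of_isInternal M.isInternal m) ?_ (by simp) ?_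
        · intro j m hm
          by_cases h : i = j
          · subst h
            rw [proj_self _ hm]
          · rw [proj_of_ne _ h hm, map_zero, hf j (Ne.symm h) m hm]
        · intro x y hx hy
          simp only [map_add, hx, hy]
      · intro i j hij f hf
        exact LinearMap.ext fun m => hf i hij _ (proj_mem _ i m)
      · intro f
        have : f = ∑ i ∈ (finite_support M.isInternal).toFinset,
            (proj M.isInternal i).dualMap f := by
          refine LinearMap.ext fun m => ?_
          rw [LinearMap.sum_apply]
          simp only [LinearMap.dualMap_apply]
          rw [← map_sum, sum_proj M.isInternal _ (by simp)]
        rw [this]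
        refine Submodule.sum_mem _ fun i _ => Submodule.mem_iSup_of_mem i ?_
        intro j hj m hm
        rw [LinearMap.dualMap_apply, proj_of_ne _ (Ne.symm hj) hm, map_zero]
    smul_mem := by
      intro i j a f ha hf k hk m hm
      refine hf (-i + k) (fun h => hk (by omega)) _ (M.smul_mem ha hm) }

end Dual

section Induction
variable {ℛ : ℤ → Submodule K R} {𝒜 : ℤ → Submodule K A} (ι : R →ₐ[K] A) (M : GrMod ℛ)

/-- The submodule of `A ⊗_K M` generated by the elements `aι(r) ⊗ m - a ⊗ rm`. -/
def tensorRel : Submodule A (A ⊗[K] M) :=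
  Submodule.span A {x | ∃ (a : A) (r : R) (m : M), x = (a * ι r) ⊗ₜ[K] m - a ⊗ₜ[K] (r • m)}

/-- The homogeneous component of degree `n` of `A ⊗_K M`. -/
def tensorGr (𝒜 : ℤ → Submodule K A) (M : GrMod ℛ) (n : ℤ) : Submodule K (A ⊗[K] M) :=
  Submodule.span K {x | ∃ i j : ℤ, i + j = n ∧ ∃ a ∈ 𝒜 i, ∃ m ∈ M.gr j, x = a ⊗ₜ[K] m}

theorem tensorRel_le : ∀ x ∈ tensorRel ι M, x ∈ Submodule.span K
    {x | ∃ (a : A) (r : R) (m : M), x = (a * ι r) ⊗ₜ[K] m - a ⊗ₜ[K] (r • m)} := by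
  intro x hx
  induction hx using Submodule.span_induction with
  | mem x h => exact Submodule.subset_span h
  | zero => exact Submodule.zero_mem _
  | add x y _ _ hx hy => exact Submodule.add_mem _ hx hy
  | smul b x _ hx =>
    clear * - hx
    induction hx using Submodule.span_induction with
    | mem x h =>
      obtain ⟨a, r, m, rfl⟩ := h
      refine Submodule.subset_span ⟨b * a, r, m, ?_⟩
      rw [smul_sub, TensorProduct.smul_tmul', TensorProduct.smul_tmul', smul_eq_mul, smul_eq_mul,
        mul_assoc]
    | zero => rw [smul_zero]; exact Submodule.zero_mem _
    | add x y _ _ hx hy => rw [smul_add]; exact Submodule.add_mem _ hx hy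
    | smul c x _ hx => rw [smul_comm]; exact Submodule.smul_mem _ c hx

theorem tensorGr_isInternal [FiniteDimensional K A] (h𝒜 : DirectSum.IsInternal 𝒜) :
    DirectSum.IsInternal (tensorGr 𝒜 M) := by
  have hP : ∀ n : ℤ, ∀ i j, ∀ a ∈ 𝒜 i, ∀ m ∈ M.gr j,
      (∑ k ∈ (finite_support h𝒜).toFinset,
        TensorProduct.map (proj h𝒜 k) (proj M.isInternal (n - k))) (a ⊗ₜ[K] m) =
      if i + j = n then a ⊗ₜ[K] m else 0 := by
    intro n i j a ha m hm
    by_cases h0 : a = 0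
    · simp [h0]
    have hi : i ∈ (finite_support h𝒜).toFinset := by
      simp only [Set.Finite.mem_toFinset, Set.mem_ofPred_eq]
      exact fun hb => h0 (by simpa [hb] using ha)
    rw [LinearMap.sum_apply, Finset.sum_eq_single i]
    · rw [TensorProduct.map_tmul, proj_self _ ha]
      split_ifs with h
      · rw [proj_self _ (by rwa [show n - i = j by omega])]
      · rw [proj_of_ne _ (show n - i ≠ j by omega) hm, TensorProduct.tmul_zero]
    · intro k _ hk
      rw [TensorProduct.map_tmul, proj_of_ne _ hk ha, TensorProduct.zero_tmul]
    · exact fun h => absurd hi h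
  refine isInternal_of_proj (fun n => ∑ k ∈ (finite_support h𝒜).toFinset,
        TensorProduct.map (proj h𝒜 k) (proj M.isInternal (n - k))) ?_ ?_ ?_
  · intro n x hx
    induction hx using Submodule.span_induction with
    | mem x h =>
      obtain ⟨i, j, hij, a, ha, m, hm, rfl⟩ := h
      rw [hP n i j a ha m hm, if_pos hij]
    | zero => simp
    | add x y _ _ hx hy => rw [map_add, hx, hy]
    | smul c x _ hx => rw [map_smul, hx]
  · intro n n' hn x hx
    induction hx using Submodule.span_induction with
    | mem x h =>
      obtain ⟨i, j, hij, a, ha, m, hm, rfl⟩ := h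
      rw [hP n i j a ha m hm, if_neg (by omega)]
    | zero => simp
    | add x y _ _ hx hy => rw [map_add, hx, hy, add_zero]
    | smul c x _ hx => rw [map_smul, hx, smul_zero]
  · intro x
    induction x using TensorProduct.induction_on with
    | zero => exact Submodule.zero_mem _
    | add x y hx hy => exact Submodule.add_mem _ hx hy
    | tmul a m =>
      refine Submodule.iSup_induction 𝒜 (motive := fun a => a ⊗ₜ[K] m ∈ ⨆ n, tensorGr 𝒜 M n)
        (mem_iSup_of_isInternal h𝒜 a) ?_ (by simp) ?_
      · intro i a ha
        refine Submodule.iSup_induction M.gr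
          (motive := fun m => a ⊗ₜ[K] m ∈ ⨆ n, tensorGr 𝒜 M n)
          (mem_iSup_of_isInternal M.isInternal m) ?_ (by simp) ?_
        · intro j m hm
          exact Submodule.mem_iSup_of_mem (i + j)
            (Submodule.subset_span ⟨i, j, rfl, a, ha, m, hm, rfl⟩)
        · intro x y hx hy
          rw [TensorProduct.tmul_add]; exact Submodule.add_mem _ hx hy
      · intro x y hx hy
        rw [TensorProduct.add_tmul]; exact Submodule.add_mem _ hx hy

theorem proj_tensorRel [FiniteDimensional K A] (h𝒜 : IsGrading 𝒜) (hℛ : IsGrading ℛ)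
    (hι : ∀ i, ∀ r ∈ ℛ i, ι r ∈ 𝒜 i) (n : ℤ) (x : A ⊗[K] M) (hx : x ∈ tensorRel ι M) :
    proj (M := A ⊗[K] M) (S := tensorGr 𝒜 M) (tensorGr_isInternal M h𝒜.isInternal) n x ∈ tensorRel ι M := by
  have hgen : ∀ (a : A) (r : R) (m : M),
      (a * ι r) ⊗ₜ[K] m - a ⊗ₜ[K] (r • m) ∈ tensorRel ι M := fun a r m =>
    Submodule.subset_span ⟨a, r, m, rfl⟩
  replace hx := tensorRel_le ι M x hx
  set p : A ⊗[K] M →ₗ[K] A ⊗[K] M :=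
    proj (M := A ⊗[K] M) (S := tensorGr 𝒜 M) (tensorGr_isInternal M h𝒜.isInternal) n with hp
  induction hx using Submodule.span_induction with
  | zero => rw [map_zero]; exact Submodule.zero_mem _
  | add x y _ _ hx hy => rw [map_add]; exact Submodule.add_mem _ hx hy
  | smul c x _ hx => rw [map_smul]; exact Submodule.smul_of_tower_mem _ c hx
  | mem x h =>
    obtain ⟨a, r, m, rfl⟩ := h
    refine Submodule.iSup_induction 𝒜 (motive := fun a =>
      p ((a * ι r) ⊗ₜ[K] m - a ⊗ₜ[K] (r • m)) ∈ tensorRel ι M)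
      (mem_iSup_of_isInternal h𝒜.isInternal a) ?_ (by simp) ?_
    swap
    · intro x y hx hy
      rw [add_mul, TensorProduct.add_tmul, TensorProduct.add_tmul, add_sub_add_comm, map_add]
      exact Submodule.add_mem _ hx hy
    intro i a ha
    refine Submodule.iSup_induction ℛ (motive := fun r =>
      p ((a * ι r) ⊗ₜ[K] m - a ⊗ₜ[K] (r • m)) ∈ tensorRel ι M)
      (mem_iSup_of_isInternal hℛ.isInternal r) ?_ (by simp) ?_
    swap
    · intro x y hx hy
      rw [map_add, mul_add, add_smul, TensorProduct.add_tmul, TensorProduct.tmul_add,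
        add_sub_add_comm, map_add]
      exact Submodule.add_mem _ hx hy
    intro j r hr
    refine Submodule.iSup_induction M.gr (motive := fun m =>
      p ((a * ι r) ⊗ₜ[K] m - a ⊗ₜ[K] (r • m)) ∈ tensorRel ι M)
      (mem_iSup_of_isInternal M.isInternal m) ?_ (by simp) ?_
    swap
    · intro x y hx hy
      rw [smul_add, TensorProduct.tmul_add, TensorProduct.tmul_add, add_sub_add_comm, map_add]
      exact Submodule.add_mem _ hx hy
    intro k m hm
    have hmem : (a * ι r) ⊗ₜ[K] m - a ⊗ₜ[K] (r • m) ∈ tensorGr 𝒜 M (i + j + k) := by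
      refine Submodule.sub_mem _ (Submodule.subset_span
        ⟨i + j, k, rfl, _, h𝒜.mul_mem ha (hι j r hr), m, hm, rfl⟩) (Submodule.subset_span
        ⟨i, j + k, by omega, a, ha, _, M.smul_mem hr hm, rfl⟩)
    by_cases h : n = i + j + k
    · subst h
      rw [hp, proj_self _ hmem]
      exact hgen a r m
    · rw [hp, proj_of_ne _ h hmem]
      exact Submodule.zero_mem _

theorem smul_tensorGr (h𝒜 : IsGrading 𝒜) {i n : ℤ} {a : A} {x : A ⊗[K] M} (ha : a ∈ 𝒜 i)
    (hx : x ∈ tensorGr 𝒜 M n) : a • x ∈ tensorGr 𝒜 M (i + n) := by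
  induction hx using Submodule.span_induction with
  | mem x h =>
    obtain ⟨k, l, hkl, b, hb, m, hm, rfl⟩ := h
    exact Submodule.subset_span ⟨i + k, l, by omega, a * b, h𝒜.mul_mem ha hb, m, hm, rfl⟩
  | zero => rw [smul_zero]; exact Submodule.zero_mem _
  | add x y _ _ hx hy => rw [smul_add]; exact Submodule.add_mem _ hx hy
  | smul c x _ hx => rw [smul_comm]; exact Submodule.smul_mem _ c hx

/-- The induced graded module `A ⊗_R M`, for a homomorphism `ι : R → A` of graded algebras and a
graded `R`-module `M`: the quotient of `A ⊗_K M` by the relations `aι(r) ⊗ m = a ⊗ rm`, with `a ⊗ m`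
of degree `i + j` for `a` of degree `i` and `m` of degree `j`. -/
def induce [FiniteDimensional K A] [FiniteDimensional K R] (h𝒜 : IsGrading 𝒜) (hℛ : IsGrading ℛ)
    (hι : ∀ i, ∀ r ∈ ℛ i, ι r ∈ 𝒜 i) : GrMod 𝒜 where
  carrier := (A ⊗[K] M) ⧸ tensorRel ι M
  finite := by
    have := M.finiteDimensional
    exact Module.Finite.of_restrictScalars_finite K A _
  gr n := (tensorGr 𝒜 M n).map ((tensorRel ι M).mkQ.restrictScalars K)
  isInternal := isInternal_quotient (M := A ⊗[K] M) (S := tensorGr 𝒜 M)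
    (tensorGr_isInternal M h𝒜.isInternal) (tensorRel ι M)
    (proj_tensorRel ι M h𝒜 hℛ hι)
  smul_mem := by
    rintro i n a _ ha ⟨x, hx, rfl⟩
    exact ⟨a • x, smul_tensorGr M h𝒜 ha hx, rfl⟩

end Induction
end GrMod
end Functors

section Triangular
variable {K : Type u} [Field K] {A : Type u} [Ring A] [Algebra K A]

/-- The grading induced on a subalgebra, `S_i = S ∩ A_i`. -/
def subGrading (𝒜 : ℤ → Submodule K A) (S : Subalgebra K A) : ℤ → Submodule K S :=
  fun i => (𝒜 i).comap S.val.toLinearMap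

/-- A triangular decomposition `(A⁻, T, A⁺)` of a graded algebra `A`. -/
structure TriangularDecomposition (𝒜 : ℤ → Submodule K A) [GradedAlgebra 𝒜] where
  neg : Subalgebra K A
  T : Subalgebra K A
  pos : Subalgebra K A
  neg_homogeneous : ∀ a ∈ neg, ∀ i, (DirectSum.decompose 𝒜 a i : A) ∈ neg
  pos_homogeneous : ∀ a ∈ pos, ∀ i, (DirectSum.decompose 𝒜 a i : A) ∈ pos
  /-- the multiplication map `A⁻ ⊗ T ⊗ A⁺ → A` is an isomorphism of vector spaces -/
  bijective : Function.Bijective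
    (LinearMap.mul' K A ∘ₗ TensorProduct.map
      (LinearMap.mul' K A ∘ₗ TensorProduct.map neg.val.toLinearMap T.val.toLinearMap)
      pos.val.toLinearMap : (neg ⊗[K] T) ⊗[K] pos →ₗ[K] A)
  T_le : Subalgebra.toSubmodule T ≤ 𝒜 0
  pos_supp : ∀ i, i < 0 → Subalgebra.toSubmodule pos ⊓ 𝒜 i = ⊥
  neg_supp : ∀ i, 0 < i → Subalgebra.toSubmodule neg ⊓ 𝒜 i = ⊥
  pos_zero : Subalgebra.toSubmodule pos ⊓ 𝒜 0 = Subalgebra.toSubmodule ⊥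
  neg_zero : Subalgebra.toSubmodule neg ⊓ 𝒜 0 = Subalgebra.toSubmodule ⊥
  pos_comm : Subalgebra.toSubmodule pos * Subalgebra.toSubmodule T =
    Subalgebra.toSubmodule T * Subalgebra.toSubmodule pos
  neg_comm : Subalgebra.toSubmodule neg * Subalgebra.toSubmodule T =
    Subalgebra.toSubmodule T * Subalgebra.toSubmodule neg
  /-- `T` is split: the endomorphisms of every simple `T`-module are the scalars -/
  split : ∀ (S : Type u) [AddCommGroup S] [Module K S] [Module T S] [IsScalarTower K T S]
    [IsSimpleModule T S] (f : S →ₗ[T] S), ∃ c : K, ∀ x, f x = c • x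

section Borel
variable (𝒜 : ℤ → Submodule K A) [GradedAlgebra 𝒜]

/-- The properties shared by the pairs `(A⁺, T)` and `(A⁻, T)`. -/
structure IsHalf (P T : Subalgebra K A) : Prop where
  homogeneous : ∀ a ∈ P, ∀ i, (DirectSum.decompose 𝒜 a i : A) ∈ P
  T_le : Subalgebra.toSubmodule T ≤ 𝒜 0
  supp : ∀ i, i ≠ 0 → (∀ a ∈ P, (DirectSum.decompose 𝒜 a i : A) = 0) ∨
    ∀ a ∈ P, (DirectSum.decompose 𝒜 a (-i) : A) = 0
  zero : ∀ a ∈ P, (DirectSum.decompose 𝒜 a 0 : A) ∈ (⊥ : Subalgebra K A)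
  comm : Subalgebra.toSubmodule P * Subalgebra.toSubmodule T =
    Subalgebra.toSubmodule T * Subalgebra.toSubmodule P

variable {𝒜}

theorem TriangularDecomposition.isHalf_pos (D : TriangularDecomposition 𝒜) :
    IsHalf 𝒜 D.pos D.T where
  homogeneous := D.pos_homogeneous
  T_le := D.T_le
  supp i hi := by
    have key : ∀ j, j < 0 → ∀ a ∈ D.pos, (DirectSum.decompose 𝒜 a j : A) = 0 := fun j hj a ha =>
      (Submodule.mem_bot K).1 (D.pos_supp j hj ▸ ⟨D.pos_homogeneous a ha j, Submodule.coe_mem _⟩)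
    rcases lt_or_gt_of_ne hi with h | h
    · exact Or.inl (key i h)
    · exact Or.inr (key _ (by omega))
  zero a ha := by
    have : (DirectSum.decompose 𝒜 a 0 : A) ∈ Subalgebra.toSubmodule D.pos ⊓ 𝒜 0 :=
      ⟨D.pos_homogeneous a ha 0, Submodule.coe_mem _⟩
    rwa [D.pos_zero] at this
  comm := D.pos_comm

theorem TriangularDecomposition.isHalf_neg (D : TriangularDecomposition 𝒜) :
    IsHalf 𝒜 D.neg D.T where
  homogeneous := D.neg_homogeneous
  T_le := D.T_le
  supp i hi := by
    have key : ∀ j, 0 < j → ∀ a ∈ D.neg, (DirectSum.decompose 𝒜 a j : A) = 0 := fun j hj a ha =>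
      (Submodule.mem_bot K).1 (D.neg_supp j hj ▸ ⟨D.neg_homogeneous a ha j, Submodule.coe_mem _⟩)
    rcases lt_or_gt_of_ne hi with h | h
    · exact Or.inr (key _ (by omega))
    · exact Or.inl (key i h)
  zero a ha := by
    have : (DirectSum.decompose 𝒜 a 0 : A) ∈ Subalgebra.toSubmodule D.neg ⊓ 𝒜 0 :=
      ⟨D.neg_homogeneous a ha 0, Submodule.coe_mem _⟩
    rwa [D.neg_zero] at this
  comm := D.neg_comm

variable {P T : Subalgebra K A}

theorem one_mem_mul (P T : Subalgebra K A) :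
    (1 : A) ∈ Subalgebra.toSubmodule P * Subalgebra.toSubmodule T := by
  have h := Submodule.mul_mem_mul ((Subalgebra.mem_toSubmodule P).2 P.one_mem)
    ((Subalgebra.mem_toSubmodule T).2 T.one_mem)
  rwa [mul_one] at h

/-- The Borel subalgebra `B = P T = T P`, for `P = A⁺` or `P = A⁻`. -/
def borel (h : IsHalf 𝒜 P T) : Subalgebra K A :=
  (Subalgebra.toSubmodule P * Subalgebra.toSubmodule T).toSubalgebra
    (one_mem_mul P T)
    (fun x y hx hy => by
      have hxy := Submodule.mul_mem_mul hx hy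
      rwa [mul_assoc, ← mul_assoc (Subalgebra.toSubmodule T), ← h.comm, mul_assoc, ← mul_assoc,
        P.isIdempotentElem_toSubmodule, T.isIdempotentElem_toSubmodule] at hxy)

theorem decompose_mul_T (h : IsHalf 𝒜 P T) {a t : A} (ht : t ∈ T) (i : ℤ) :
    (DirectSum.decompose 𝒜 (a * t) i : A) = DirectSum.decompose 𝒜 a i * t := by
  have := DirectSum.coe_decompose_mul_add_of_right_mem 𝒜 (i := i) (a := a) (h.T_le ht)
  rwa [add_zero] at this

theorem borel_decompose_mem (h : IsHalf 𝒜 P T) (b : A) (hb : b ∈ borel h) (i : ℤ) :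
    (DirectSum.decompose 𝒜 b i : A) ∈ borel h := by
  refine Submodule.mul_induction_on (M := Subalgebra.toSubmodule P)
    (N := Subalgebra.toSubmodule T) (r := b) (C := fun b => (DirectSum.decompose 𝒜 b i : A) ∈ borel h)
    hb ?_ ?_
  · intro a ha t ht
    rw [decompose_mul_T h ht]
    exact Submodule.mul_mem_mul (h.homogeneous a ha i) ht
  · intro x y hx hy
    rw [DirectSum.decompose_add]
    exact (borel h).add_mem hx hy

theorem borel_decompose_zero_mem (h : IsHalf 𝒜 P T) (b : A) (hb : b ∈ borel h) :
    (DirectSum.decompose 𝒜 b 0 : A) ∈ T := by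
  refine Submodule.mul_induction_on (M := Subalgebra.toSubmodule P)
    (N := Subalgebra.toSubmodule T) (r := b) (C := fun b => (DirectSum.decompose 𝒜 b 0 : A) ∈ T) hb ?_ ?_
  · intro a ha t ht
    rw [decompose_mul_T h ht]
    obtain ⟨c, hc⟩ := Algebra.mem_bot.1 (h.zero a ha)
    rw [← hc]
    exact T.mul_mem (T.algebraMap_mem c) ht
  · intro x y hx hy
    rw [DirectSum.decompose_add]
    exact T.add_mem hx hy

theorem borel_supp (h : IsHalf 𝒜 P T) (i : ℤ) (hi : i ≠ 0) :
    (∀ b ∈ borel h, (DirectSum.decompose 𝒜 b i : A) = 0) ∨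
      ∀ b ∈ borel h, (DirectSum.decompose 𝒜 b (-i) : A) = 0 := by
  have key : ∀ j, (∀ a ∈ P, (DirectSum.decompose 𝒜 a j : A) = 0) →
      ∀ b ∈ borel h, (DirectSum.decompose 𝒜 b j : A) = 0 := by
    intro j hj b hb
    refine Submodule.mul_induction_on (M := Subalgebra.toSubmodule P)
      (N := Subalgebra.toSubmodule T) (r := b) (C := fun b => (DirectSum.decompose 𝒜 b j : A) = 0) hb ?_ ?_
    · intro a ha t ht
      rw [decompose_mul_T h ht, hj a ha, zero_mul]
    · intro x y hx hy
      rw [DirectSum.decompose_add, DirectSum.add_apply, Submodule.coe_add, hx, hy,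
        add_zero]
  exact (h.supp i hi).imp (key i) (key (-i))

theorem borel_decompose_zero_mul (h : IsHalf 𝒜 P T) (b c : A) (hb : b ∈ borel h)
    (hc : c ∈ borel h) : (DirectSum.decompose 𝒜 (b * c) 0 : A) =
      DirectSum.decompose 𝒜 b 0 * DirectSum.decompose 𝒜 c 0 := by
  classical
  have key : ∀ i, (DirectSum.decompose 𝒜 ((DirectSum.decompose 𝒜 b i : A) * c) 0 : A) =
      DirectSum.decompose 𝒜 (DirectSum.decompose 𝒜 b i : A) 0 * DirectSum.decompose 𝒜 c 0 := by
    intro i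
    have h1 := DirectSum.coe_decompose_mul_add_of_left_mem 𝒜 (i := i) (j := -i) (b := c)
      (Submodule.coe_mem (DirectSum.decompose 𝒜 b i))
    rw [add_neg_cancel] at h1
    rw [h1]
    by_cases hi : i = 0
    · subst hi
      rw [DirectSum.decompose_of_mem_same 𝒜 (Submodule.coe_mem _), neg_zero]
    · rw [DirectSum.decompose_of_mem_ne 𝒜 (Submodule.coe_mem (DirectSum.decompose 𝒜 b i)) hi,
        zero_mul]
      rcases borel_supp h i hi with h2 | h2
      · rw [h2 b hb, zero_mul]
      · rw [h2 c hc, mul_zero]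
  have hsum := DirectSum.sum_support_decompose 𝒜 b
  generalize hs : DFinsupp.support (DirectSum.decompose 𝒜 b) = s at hsum
  have h1 : b * c = ∑ i ∈ s, (DirectSum.decompose 𝒜 b i : A) * c := by
    rw [← Finset.sum_mul, hsum]
  have h2 : (DirectSum.decompose 𝒜 b 0 : A) =
      ∑ i ∈ s, (DirectSum.decompose 𝒜 (DirectSum.decompose 𝒜 b i : A) 0 : A) := by
    conv_lhs => rw [← hsum]
    rw [DirectSum.decompose_sum, DFinsupp.finsetSum_apply, AddSubmonoidClass.coe_finsetSum]
  rw [h1, DirectSum.decompose_sum, DFinsupp.finsetSum_apply, AddSubmonoidClass.coe_finsetSum, h2,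
    Finset.sum_mul]
  exact Finset.sum_congr rfl fun i _ => key i

/-- The projection `B → T` onto the component of degree zero, an algebra homomorphism. -/
def borelProj (h : IsHalf 𝒜 P T) : borel h →ₐ[K] T :=
  AlgHom.ofLinearMap
    { toFun := fun b => ⟨DirectSum.decompose 𝒜 (b : A) 0, borel_decompose_zero_mem h b b.2⟩
      map_add' := fun b c => Subtype.ext (by simp)
      map_smul' := fun k b => Subtype.ext (by simp [DirectSum.smul_apply]) }
    (Subtype.ext (DirectSum.decompose_of_mem_same 𝒜 (SetLike.GradedOne.one_mem)))
    (fun b c => Subtype.ext (borel_decompose_zero_mul h b c b.2 c.2))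

theorem isGrading_sub (S : Subalgebra K A)
    (hS : ∀ a ∈ S, ∀ i, (DirectSum.decompose 𝒜 a i : A) ∈ S) : IsGrading (subGrading 𝒜 S) where
  isInternal := by
    classical
    refine isInternal_of_proj (fun i =>
      { toFun := fun b => ⟨DirectSum.decompose 𝒜 (b : A) i, hS b b.2 i⟩
        map_add' := fun b c => Subtype.ext (by simp)
        map_smul' := fun k b => Subtype.ext (by simp [DirectSum.smul_apply]) }) ?_ ?_ ?_
    · exact fun i x hx => Subtype.ext (DirectSum.decompose_of_mem_same 𝒜 hx)
    · exact fun i j hij x hx => Subtype.ext (DirectSum.decompose_of_mem_ne 𝒜 hx hij.symm)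
    · intro x
      have : x = ∑ i ∈ DFinsupp.support (DirectSum.decompose 𝒜 (x : A)),
          (⟨DirectSum.decompose 𝒜 (x : A) i, hS x x.2 i⟩ : S) := by
        apply Subtype.ext
        rw [AddSubmonoidClass.coe_finsetSum]
        exact (DirectSum.sum_support_decompose 𝒜 (x : A)).symm
      rw [this]
      exact Submodule.sum_mem _ fun i _ => Submodule.mem_iSup_of_mem i
        (Submodule.coe_mem (DirectSum.decompose 𝒜 (x : A) i))
  one_mem := SetLike.GradedOne.one_mem (A := 𝒜)
  mul_mem ha hb := SetLike.mul_mem_graded (A := 𝒜) ha hb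

theorem borelProj_mem (h : IsHalf 𝒜 P T) (i : ℤ) (b : borel h)
    (hb : b ∈ subGrading 𝒜 (borel h) i) : borelProj h b ∈ subGrading 𝒜 T i := by
  change (DirectSum.decompose 𝒜 (b : A) 0 : A) ∈ 𝒜 i
  by_cases hi : i = 0
  · subst hi
    exact Submodule.coe_mem _
  · have hb' : (b : A) ∈ 𝒜 i := hb
    rw [DirectSum.decompose_of_mem_ne 𝒜 hb' hi]
    exact Submodule.zero_mem _

end Borel

namespace TriangularDecomposition
variable {𝒜 : ℤ → Submodule K A} [GradedAlgebra 𝒜] (D : TriangularDecomposition 𝒜)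
  [FiniteDimensional K A]

/-- The category `G(T)` of finitely generated graded `T`-modules. -/
abbrev GrT : Type (u + 1) := GrMod (subGrading 𝒜 D.T)

/-- The proper standard module `A ⊗_{B⁺} Inf M`, where `Inf M` is the inflation of `M` along
`B⁺ → T`. -/
def properStandard (M : D.GrT) : GrMod 𝒜 :=
  GrMod.induce (borel D.isHalf_pos).val
    (M.restrict (borelProj D.isHalf_pos) (borelProj_mem D.isHalf_pos))
    (IsGrading.of 𝒜) (isGrading_sub _ (borel_decompose_mem D.isHalf_pos)) (fun _ _ hr => hr)

/-- The proper standard module of a graded `Tᵒᵖ`-module for the opposite decomposition of `Aᵒᵖ`,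
whose positive Borel subalgebra is `(B⁻)ᵒᵖ`. -/
def properStandardOp (N : GrMod (opGrading (subGrading 𝒜 D.T))) : GrMod (opGrading 𝒜) :=
  GrMod.induce (AlgHom.op (borel D.isHalf_neg).val)
    (N.restrict (AlgHom.op (borelProj D.isHalf_neg))
      (fun i r hr => borelProj_mem D.isHalf_neg (-i) r.unop hr))
    (IsGrading.of 𝒜).op (isGrading_sub _ (borel_decompose_mem D.isHalf_neg)).op
    (fun _ _ hr => hr)

/-- The proper costandard module: the dual of the proper standard `Aᵒᵖ`-module of `M*`, where
`(Aᵒᵖ)ᵒᵖ` is identified with `A`. -/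
def properCostandard (M : D.GrT) : GrMod 𝒜 :=
  (D.properStandardOp M.dual).dual.restrict (AlgEquiv.opOp K A).toAlgHom
    (fun i r hr => by
      change r ∈ 𝒜 (- -i)
      rwa [neg_neg])

theorem exists_degree (M : D.GrT) [Simple M] : ∃! d : ℤ, M.gr d ≠ ⊥ := by
  have hproj : ∀ (i : ℤ) (t : D.T) (m : M),
      proj M.isInternal i (t • m) = t • proj M.isInternal i m := by
    intro i t m
    refine Submodule.iSup_induction M.gr
      (motive := fun m => proj M.isInternal i (t • m) = t • proj M.isInternal i m)
      (mem_iSup_of_isInternal M.isInternal m) ?_ (by simp) ?_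
    · intro j m hm
      have ht : t • m ∈ M.gr j := by
        have := M.smul_mem (i := 0) (a := t) (D.T_le t.2) hm
        rwa [zero_add] at this
      by_cases h : i = j
      · subst h
        rw [proj_self _ hm, proj_self _ ht]
      · rw [proj_of_ne _ h hm, proj_of_ne _ h ht, smul_zero]
    · intro x y hx hy
      simp only [smul_add, map_add, hx, hy]
  have hendo : ∀ i : ℤ, ∃ f : M ⟶ M, ∀ m, GrMod.toLin f m = proj M.isInternal i m := fun i =>
    ⟨GrMod.ofLin
      { toFun := proj M.isInternal i
        map_add' := map_add _
        map_smul' := hproj i }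
      (fun j m hm => by
        change proj M.isInternal i m ∈ M.gr j
        by_cases h : i = j
        · subst h; exact proj_mem _ _ _
        · rw [proj_of_ne _ h hm]; exact Submodule.zero_mem _), fun m => rfl⟩
  have hinj : ∀ i, M.gr i ≠ ⊥ → ∀ m, proj M.isInternal i m = 0 → m = 0 := by
    intro i hi m hm
    obtain ⟨f, hf⟩ := hendo i
    have hne : f ≠ 0 := by
      intro h0
      refine hi ((Submodule.eq_bot_iff _).2 fun x hx => ?_)
      have := hf x
      rw [h0, proj_self _ hx] at this
      exact this.symm
    have := isIso_of_hom_simple hne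
    exact GrMod.injective_of_mono f (by rw [hf, hm, map_zero])
  have hex : ∃ d, M.gr d ≠ ⊥ := by
    by_contra hcon
    push Not at hcon
    refine Simple.not_isZero M ((IsZero.iff_id_eq_zero _).2 (GrMod.hom_ext fun m => ?_))
    have := mem_iSup_of_isInternal M.isInternal m
    simpa [hcon] using this
  obtain ⟨d, hd⟩ := hex
  refine ⟨d, hd, fun e he => ?_⟩
  by_contra hne
  exact he ((Submodule.eq_bot_iff _).2 fun x hx => hinj d hd x (proj_of_ne _ (Ne.symm hne) hx))

end TriangularDecomposition
end Triangular

section Degree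
open StdStrat
variable {K : Type u} [Field K] {A : Type u} [Ring A] [Algebra K A] {𝒜 : ℤ → Submodule K A}
  [GradedAlgebra 𝒜] [FiniteDimensional K A]

/-- The degree function on `Irr G(T)`: the unique degree in which a simple graded `T`-module is
concentrated. -/
noncomputable def TriangularDecomposition.deg (D : TriangularDecomposition 𝒜) (l : Irr D.GrT) : ℤ :=
  (D.exists_degree l.rep).choose

end Degree

end GradedAlg

open StdStrat GradedAlg

/-! The algebra enters only through B = B⁺, C = B⁻ and T: A is free as a right B-module on A⁻ and
free as a left C-module on A⁺ (`borelData`). This package of data is stable under passing to the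
opposite algebra, which exchanges B and C, so graded duality yields the costandard half of the
statement from the standard half.

If N is concentrated in degree d, then A ⊗_B N lies in degrees ≤ d and its component of degree d is
N. If M also lies in degrees ≤ d, elements of B of positive degree kill M_d, so Hom_A(A ⊗_B N, M) =
Hom_T(N, M_d) (`stdTopEquiv`). Hence, on modules in degrees ≤ d, the exact functor M ↦ M_d has a
left adjoint which is exact by freeness and fully faithful because the unit is invertible
(`isIso_topUnit`). Duality gives the exact right adjoint (`costdTopEquiv`).

The same adjunction classifies simple modules. A simple quotient L(λ) of A ⊗_B λ is its head and has
λ as top component, and every simple module is recovered from its own top component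
(`existsUnique_iso`). It follows that the Serre subcategory spanned by the L(λ) with deg λ ≤ d
consists of all modules in degrees ≤ d (`below_iff`). On it the kernel of M ↦ M_d is the next
smaller subcategory, so this functor is the Serre quotient functor (`isLocalization_layerTop`): the
layer is the category of graded T-modules in degree d, and the two adjoints are standardization and
costandardization.

For the filtrations, a projective A-module remains projective over C (`projective_resC`). Let M be
C-projective with highest degree e. Over C the canonical map A ⊗_B M_e → M splits
(`exists_retraction_fromTop`), because A ⊗_B M_e is generated over C by its top component. So this
map is injective, M_e is T-projective and the cokernel is again C-projective. Removing in this way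
all degrees > d leaves the largest quotient in degrees ≤ d, with kernel filtered by standard modules
(`exists_truncation`). For the projective cover of L(λ) and d = deg λ this quotient is Δ(λ): it maps
onto Δ(λ), a lift of P_T(λ) to its top component gives a section, and the section is onto by
essentiality. -/

namespace GradedAlg
namespace GrMod
-- Graded modules through their elements and homogeneous components
section Basic
variable {K : Type u} [Field K] {A : Type u} [Ring A] [Algebra K A] {𝒜 : ℤ → Submodule K A}

theorem toLin_smulK {M N : GrMod 𝒜} (f : M ⟶ N) (c : K) (m : M) :
    toLin f (c • m) = c • toLin f m :=
  (((toLin f).restrictScalars K).map_smul c m)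

/-- A `K`-linear map compatible with the actions and the gradings is a morphism. -/
def ofK {M N : GrMod 𝒜} (f : M →ₗ[K] N) (hs : ∀ (a : A) (m : M), f (a • m) = a • f m)
    (hf : ∀ i, ∀ m ∈ M.gr i, f m ∈ N.gr i) : M ⟶ N :=
  ofLin { toFun := f, map_add' := map_add f, map_smul' := hs } hf

@[simp] theorem toLin_ofK {M N : GrMod 𝒜} (f : M →ₗ[K] N)
    (hs : ∀ (a : A) (m : M), f (a • m) = a • f m)
    (hf : ∀ i, ∀ m ∈ M.gr i, f m ∈ N.gr i) (m : M) : toLin (ofK f hs hf) m = f m := rfl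

theorem comp_apply {M N P : GrMod 𝒜} (f : M ⟶ N) (g : N ⟶ P) (m : M) :
    toLin (f ≫ g) m = toLin g (toLin f m) := rfl

theorem add_apply {M N : GrMod 𝒜} (f g : M ⟶ N) (m : M) :
    toLin (f + g) m = toLin f m + toLin g m := rfl

theorem congr_toLin {M N : GrMod 𝒜} {f g : M ⟶ N} (h : f = g) (m : M) :
    toLin f m = toLin g m := by rw [h]

theorem hom_inv_apply {M N : GrMod 𝒜} (e : M ≅ N) (m : M) : toLin e.inv (toLin e.hom m) = m :=
  congr_toLin e.hom_inv_id m

theorem inv_hom_apply {M N : GrMod 𝒜} (e : M ≅ N) (n : N) : toLin e.hom (toLin e.inv n) = n :=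
  congr_toLin e.inv_hom_id n

theorem mono_of_injective {M N : GrMod 𝒜} (f : M ⟶ N) (h : Function.Injective (toLin f)) :
    Mono f :=
  ⟨fun _ _ hab => hom_ext fun z => h (congr_toLin hab z)⟩

theorem epi_of_surjective {M N : GrMod 𝒜} (f : M ⟶ N) (h : Function.Surjective (toLin f)) :
    Epi f :=
  ⟨fun a b hab => hom_ext fun z => by
    obtain ⟨m, rfl⟩ := h z
    exact congr_toLin hab m⟩

theorem isZero_iff (M : GrMod 𝒜) : IsZero M ↔ ∀ m : M, m = 0 := by
  rw [IsZero.iff_id_eq_zero]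
  exact ⟨fun h m => congr_toLin h m, fun h => hom_ext fun m => h m⟩

/-- Homogeneous elements span. Only additivity is asked for, so the criterion also applies to
composites that are not bundled as linear maps. -/
theorem ext_of_gr {M : GrMod 𝒜} {P : Type*} [AddCommGroup P] {f g : M → P}
    (hf : ∀ x y, f (x + y) = f x + f y) (hg : ∀ x y, g (x + y) = g x + g y)
    (h : ∀ i, ∀ m ∈ M.gr i, f m = g m) (m : M) : f m = g m := by
  have hf0 : f 0 = 0 := by simpa using hf 0 0
  have hg0 : g 0 = 0 := by simpa using hg 0 0
  exact Submodule.iSup_induction M.gr (motive := fun m => f m = g m)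
    (mem_iSup_of_isInternal M.isInternal m) h (by rw [hf0, hg0])
    (fun x y hx hy => by rw [hf, hg, hx, hy])

theorem isZero_iff_gr (M : GrMod 𝒜) : IsZero M ↔ ∀ i, M.gr i = ⊥ := by
  rw [isZero_iff]
  refine ⟨fun h i => (Submodule.eq_bot_iff _).2 fun x _ => h x, fun h m => ?_⟩
  have := mem_iSup_of_isInternal M.isInternal m
  simpa [h] using this

theorem gr_eq_bot_of_injective {M N : GrMod 𝒜} (f : M ⟶ N)
    (hf : Function.Injective (toLin f)) {i : ℤ} (h : N.gr i = ⊥) : M.gr i = ⊥ := by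
  refine (Submodule.eq_bot_iff _).2 fun x hx => hf ?_
  have := toLin_mem f hx
  rw [h, Submodule.mem_bot] at this
  rw [this, map_zero]

theorem exists_mem_gr_of_surjective {M N : GrMod 𝒜} (f : M ⟶ N)
    (hf : Function.Surjective (toLin f)) {i : ℤ} {n : N} (hn : n ∈ N.gr i) :
    ∃ m ∈ M.gr i, toLin f m = n := by
  obtain ⟨m, rfl⟩ := hf n
  exact ⟨_, proj_mem M.isInternal i m, by rw [toLin_proj, proj_self _ hn]⟩

theorem gr_eq_bot_of_surjective {M N : GrMod 𝒜} (f : M ⟶ N)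
    (hf : Function.Surjective (toLin f)) {i : ℤ} (h : M.gr i = ⊥) : N.gr i = ⊥ := by
  refine (Submodule.eq_bot_iff _).2 fun x hx => ?_
  obtain ⟨m, hm, rfl⟩ := exists_mem_gr_of_surjective f hf hx
  rw [h, Submodule.mem_bot] at hm
  rw [hm, map_zero]

theorem proj_eq_zero_of_gr {M : GrMod 𝒜} {i : ℤ} (h : M.gr i = ⊥) (m : M) :
    proj M.isInternal i m = 0 := by
  have := proj_mem M.isInternal i m
  rwa [h, Submodule.mem_bot] at this

/-- Build an isomorphism from a bijective morphism. -/
noncomputable def isoOfBijective {M N : GrMod 𝒜} (f : M ⟶ N)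
    (h : Function.Bijective (toLin f)) : M ≅ N where
  hom := f
  inv := ofLin (LinearEquiv.ofBijective (toLin f) h).symm.toLinearMap (by
    intro i n hn
    obtain ⟨m, hm, rfl⟩ := exists_mem_gr_of_surjective f h.2 hn
    have : (LinearEquiv.ofBijective (toLin f) h).symm (toLin f m) = m :=
      (LinearEquiv.ofBijective (toLin f) h).symm_apply_apply m
    exact this.symm ▸ hm)
  hom_inv_id := hom_ext fun m => (LinearEquiv.ofBijective (toLin f) h).symm_apply_apply m
  inv_hom_id := hom_ext fun m => (LinearEquiv.ofBijective (toLin f) h).apply_symm_apply m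

theorem isIso_of_bijective {M N : GrMod 𝒜} (f : M ⟶ N)
    (h : Function.Bijective (toLin f)) : IsIso f :=
  (isoOfBijective f h).isIso_hom

theorem bijective_of_isIso {M N : GrMod 𝒜} (f : M ⟶ N) [IsIso f] :
    Function.Bijective (toLin f) :=
  ⟨Function.LeftInverse.injective (hom_inv_apply (asIso f)),
    Function.RightInverse.surjective (inv_hom_apply (asIso f))⟩

/-- Products with scalars: the component of degree `i` of `a m` in terms of the components. -/
theorem proj_smul_of_mem {M : GrMod 𝒜} {i j k : ℤ} {a : A} (ha : a ∈ 𝒜 i) (hk : i + j = k)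
    (m : M) : proj M.isInternal k (a • m) = a • proj M.isInternal j m := by
  refine ext_of_gr (f := fun m => proj M.isInternal k (a • m))
    (g := fun m => a • proj M.isInternal j m) (by simp) (by simp) ?_ m
  intro l m hm
  by_cases h : j = l
  · subst h
    rw [proj_self _ hm, proj_self _ (hk ▸ M.smul_mem ha hm)]
  · rw [proj_of_ne _ h hm, smul_zero, proj_of_ne _ _ (M.smul_mem ha hm)]
    omega

end Basic

/-! ### Dimension, exactness and finite length -/

section Abelian
variable {K : Type u} [Field K] {A : Type u} [Ring A] [Algebra K A] {𝒜 : ℤ → Submodule K A}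
  [FiniteDimensional K A]

instance (M : GrMod 𝒜) : FiniteDimensional K M := M.finiteDimensional

/-- The dimension of a graded module. -/
noncomputable def dim (M : GrMod 𝒜) : ℕ := Module.finrank K M

theorem dim_le_of_mono {M N : GrMod 𝒜} (f : M ⟶ N) [Mono f] : M.dim ≤ N.dim :=
  LinearMap.finrank_le_finrank_of_injective (f := (toLin f).restrictScalars K)
    (injective_of_mono f)

theorem dim_le_of_epi {M N : GrMod 𝒜} (f : M ⟶ N) [Epi f] : N.dim ≤ M.dim :=
  (toLin f |>.restrictScalars K).finrank_le_finrank_of_surjective (surjective_of_epi f)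

theorem isIso_of_mono_of_dim {M N : GrMod 𝒜} (f : M ⟶ N) [Mono f] (h : N.dim ≤ M.dim) :
    IsIso f := by
  have hf := injective_of_mono f
  exact isIso_of_bijective f ⟨hf, (LinearMap.injective_iff_surjective_of_finrank_eq_finrank
    (f := (toLin f).restrictScalars K) (le_antisymm (dim_le_of_mono f) h)).1 hf⟩

theorem isIso_of_epi_of_dim {M N : GrMod 𝒜} (f : M ⟶ N) [Epi f] (h : M.dim ≤ N.dim) :
    IsIso f := by
  have hf := surjective_of_epi f
  exact isIso_of_bijective f ⟨(LinearMap.injective_iff_surjective_of_finrank_eq_finrank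
    (f := (toLin f).restrictScalars K) (le_antisymm h (dim_le_of_epi f))).2 hf, hf⟩

theorem dim_eq_zero_iff {M : GrMod 𝒜} : M.dim = 0 ↔ IsZero M := by
  rw [isZero_iff, dim, Module.finrank_zero_iff]
  exact ⟨fun h m => Subsingleton.elim _ _, fun h => ⟨fun a b => (h a).trans (h b).symm⟩⟩

/-- Together with `exists_of_exact`, this translates between categorical exactness and exactness on
elements. -/
theorem shortComplex_exact {S : ShortComplex (GrMod 𝒜)}
    (h : ∀ x, toLin S.g x = 0 → ∃ y, toLin S.f y = x) : S.Exact := by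
  rw [ShortComplex.exact_iff_kernel_ι_comp_cokernel_π_zero]
  refine hom_ext fun z => ?_
  obtain ⟨y, hy⟩ := h (toLin (kernel.ι S.g) z) (congr_toLin (kernel.condition S.g) z)
  rw [comp_apply, ← hy]
  exact congr_toLin (cokernel.condition S.f) y

theorem exists_of_exact {S : ShortComplex (GrMod 𝒜)} (hS : S.Exact) (x : S.X₂)
    (hx : toLin S.g x = 0) : ∃ y, toLin S.f y = x := by
  rw [ShortComplex.exact_iff_epi_kernel_lift] at hS
  have h1 := surjective_of_epi (kernel.lift S.g S.f S.zero)
  have h2 : kernel.lift S.g (kerι S.g) (kerι_comp S.g) ≫ kernel.ι S.g = kerι S.g :=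
    kernel.lift_ι _ _ _
  obtain ⟨y, hy⟩ := h1 (toLin (kernel.lift S.g (kerι S.g) (kerι_comp S.g)) ⟨x, hx⟩)
  refine ⟨y, ?_⟩
  rw [← kernel.lift_ι S.g S.f S.zero, comp_apply, hy]
  exact congr_toLin h2 _

theorem dim_eq_of_shortExact {S : ShortComplex (GrMod 𝒜)} (hS : S.ShortExact) :
    S.X₂.dim = S.X₁.dim + S.X₃.dim := by
  have := hS.mono_f
  have := hS.epi_g
  have hf := injective_of_mono S.f
  have hg := surjective_of_epi S.g
  have h := LinearMap.finrank_range_add_finrank_ker ((toLin S.g).restrictScalars K)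
  have hr : LinearMap.range ((toLin S.g).restrictScalars K) = ⊤ := LinearMap.range_eq_top.2 hg
  rw [hr, finrank_top] at h
  have hk : LinearMap.ker ((toLin S.g).restrictScalars K) =
      LinearMap.range ((toLin S.f).restrictScalars K) := by
    ext x
    refine ⟨fun hx => exists_of_exact hS.exact x hx, ?_⟩
    rintro ⟨y, rfl⟩
    exact congr_toLin S.zero y
  rw [hk, LinearMap.finrank_range_of_inj (f := (toLin S.f).restrictScalars K) hf] at h
  unfold dim
  omega

theorem isIso_of_epi_endo {M : GrMod 𝒜} (f : M ⟶ M) [Epi f] : IsIso f :=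
  isIso_of_epi_of_dim f le_rfl

/-- A monomorphism between objects of equal finite dimension is invertible. Both chain conditions on
subobjects follow from this. -/
theorem strictMono_dim (X : GrMod 𝒜) :
    StrictMono (fun S : Subobject X => dim (S : GrMod 𝒜)) := by
  intro S T h
  refine lt_of_not_ge fun hle => ?_
  have := isIso_of_mono_of_dim (Subobject.ofLE S T h.le) hle
  exact h.not_ge (Subobject.le_of_comm (inv (Subobject.ofLE S T h.le)) (by simp))

instance (X : GrMod 𝒜) : IsArtinianObject X :=
  ⟨(strictMono_dim X).wellFoundedLT⟩

instance (X : GrMod 𝒜) : IsNoetherianObject X := by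
  refine ⟨StrictAnti.wellFoundedGT (f := fun S : Subobject X => X.dim - dim (S : GrMod 𝒜)) ?_⟩
  intro S T h
  have h1 := strictMono_dim X h
  -- This bound keeps the truncated subtraction from collapsing, so that the codimension strictly
  -- decreases.
  have h2 : dim (T : GrMod 𝒜) ≤ X.dim := dim_le_of_mono T.arrow
  dsimp only at h1 ⊢
  omega

theorem exists_mono_of_not_isZero {X : GrMod 𝒜} (h : ¬ IsZero X) :
    ∃ (S : GrMod 𝒜) (i : S ⟶ X), Simple S ∧ Mono i :=
  ⟨_, simpleSubobjectArrow h, inferInstance, inferInstance⟩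

/-- Induction on the dimension: if `X` is not simple, its quotient by a simple subobject is nonzero
and smaller, and a simple quotient of that one is a simple quotient of `X`. -/
theorem exists_epi_of_not_isZero {X : GrMod 𝒜} (h : ¬ IsZero X) :
    ∃ (S : GrMod 𝒜) (p : X ⟶ S), Simple S ∧ Epi p := by
  induction hn : X.dim using Nat.strong_induction_on generalizing X with
  | _ n ih =>
  by_cases hs : Simple X
  · exact ⟨X, 𝟙 X, hs, inferInstance⟩
  obtain ⟨S, i, hS, hi⟩ := exists_mono_of_not_isZero h
  have hi' : ¬ IsIso i := fun _ => hs (Simple.of_iso (asIso i).symm)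
  have hE : (ShortComplex.mk i (cokernel.π i) (cokernel.condition i)).ShortExact :=
    { exact := ShortComplex.exact_cokernel i }
  have hd := dim_eq_of_shortExact hE
  dsimp only at hd
  have h0 : S.dim ≠ 0 := fun h0 => Simple.not_isZero S (dim_eq_zero_iff.1 h0)
  have hc : ¬ IsZero (cokernel i) := fun hc => by
    rw [← dim_eq_zero_iff] at hc
    exact hi' (isIso_of_mono_of_dim i (by omega))
  obtain ⟨Q, p, hQ, hp⟩ := ih _ (by omega) hc rfl
  exact ⟨Q, cokernel.π i ≫ p, hQ, inferInstance⟩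

end Abelian

end GrMod
end GradedAlg

namespace StdStrat
-- Essential morphisms, projective covers and injective hulls under opposites and equivalences
section Covers
variable {C : Type*} [Category* C] {D : Type*} [Category* D]

theorem isEssentialEpi_id (X : C) : IsEssentialEpi (𝟙 X) :=
  ⟨inferInstance, fun _ g h => by rwa [Category.comp_id] at h⟩

theorem IsEssentialEpi.comp_iso {P X Y : C} {p : P ⟶ X} (hp : IsEssentialEpi p) (e : X ≅ Y) :
    IsEssentialEpi (p ≫ e.hom) := by
  have := hp.1
  refine ⟨inferInstance, fun Z g hg => hp.2 g ?_⟩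
  have h : g ≫ p = (g ≫ p ≫ e.hom) ≫ e.inv := by simp
  rw [h]
  infer_instance

theorem IsProjectiveCover.comp_iso {P X Y : C} {p : P ⟶ X} (hp : IsProjectiveCover p)
    (e : X ≅ Y) : IsProjectiveCover (p ≫ e.hom) :=
  ⟨hp.1, hp.2.comp_iso e⟩

theorem IsEssentialMono.iso_comp {I X Y : C} {i : X ⟶ I} (hi : IsEssentialMono i) (e : Y ≅ X) :
    IsEssentialMono (e.hom ≫ i) := by
  have := hi.1
  refine ⟨inferInstance, fun Z g hg => hi.2 g ?_⟩
  have h : i ≫ g = e.inv ≫ (e.hom ≫ i) ≫ g := by simp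
  rw [h]
  infer_instance

theorem IsInjectiveHull.iso_comp {I X Y : C} {i : X ⟶ I} (hi : IsInjectiveHull i) (e : Y ≅ X) :
    IsInjectiveHull (e.hom ≫ i) :=
  ⟨hi.1, hi.2.iso_comp e⟩

theorem IsEssentialEpi.op {P X : C} {p : P ⟶ X} (hp : IsEssentialEpi p) :
    IsEssentialMono p.op := by
  have := hp.1
  refine ⟨inferInstance, fun Y g hg => ?_⟩
  have : Epi (g.unop ≫ p) := inferInstanceAs (Epi (p.op ≫ g).unop)
  have := hp.2 g.unop this
  exact inferInstanceAs (Mono g.unop.op)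

theorem IsEssentialMono.op {I X : C} {i : X ⟶ I} (hi : IsEssentialMono i) :
    IsEssentialEpi i.op := by
  have := hi.1
  refine ⟨inferInstance, fun Y g hg => ?_⟩
  have : Mono (i ≫ g.unop) := inferInstanceAs (Mono (g ≫ i.op).unop)
  have := hi.2 g.unop this
  exact inferInstanceAs (Epi g.unop.op)

theorem IsProjectiveCover.op {P X : C} {p : P ⟶ X} (hp : IsProjectiveCover p) :
    IsInjectiveHull p.op :=
  ⟨have := hp.1; inferInstance, hp.2.op⟩

theorem IsInjectiveHull.op {I X : C} {i : X ⟶ I} (hi : IsInjectiveHull i) :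
    IsProjectiveCover i.op :=
  ⟨have := hi.1; inferInstance, hi.2.op⟩

variable (F : C ⥤ D) [F.IsEquivalence]

theorem IsEssentialEpi.map {P X : C} {p : P ⟶ X} (hp : IsEssentialEpi p) :
    IsEssentialEpi (F.map p) := by
  have := hp.1
  refine ⟨inferInstance, fun Y g hg => ?_⟩
  -- The test object `Y` need not be in the image of `F`; it is replaced by an isomorphic one that
  -- is, so that the test morphism comes from `C`.
  let e := F.objObjPreimageIso Y
  have h : F.map (F.preimage (e.hom ≫ g)) = e.hom ≫ g := F.map_preimage _
  have h1 : Epi (F.preimage (e.hom ≫ g) ≫ p) := by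
    apply F.epi_of_epi_map
    rw [F.map_comp, h, Category.assoc]
    infer_instance
  have h2 := hp.2 _ h1
  have h3 : g = e.inv ≫ F.map (F.preimage (e.hom ≫ g)) := by rw [h]; simp
  rw [h3]
  infer_instance

theorem IsEssentialMono.map {I X : C} {i : X ⟶ I} (hi : IsEssentialMono i) :
    IsEssentialMono (F.map i) := by
  have := hi.1
  refine ⟨inferInstance, fun Y g hg => ?_⟩
  let e := F.objObjPreimageIso Y
  have h : F.map (F.preimage (g ≫ e.inv)) = g ≫ e.inv := F.map_preimage _
  have h1 : Mono (i ≫ F.preimage (g ≫ e.inv)) := by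
    apply F.mono_of_mono_map
    rw [F.map_comp, h, ← Category.assoc]
    infer_instance
  have h2 := hi.2 _ h1
  have h3 : g = F.map (F.preimage (g ≫ e.inv)) ≫ e.hom := by rw [h]; simp
  rw [h3]
  infer_instance

theorem IsProjectiveCover.map {P X : C} {p : P ⟶ X} (hp : IsProjectiveCover p) :
    IsProjectiveCover (F.map p) :=
  ⟨(F.asEquivalence.map_projective_iff P).2 hp.1, hp.2.map F⟩

theorem IsInjectiveHull.map {I X : C} {i : X ⟶ I} (hi : IsInjectiveHull i) :
    IsInjectiveHull (F.map i) :=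
  ⟨(F.asEquivalence.map_injective_iff I).2 hi.1, hi.2.map F⟩

end Covers

/-! ### Uniqueness of covers and heads, and objects with a filtration -/

section Abelian
open ZeroObject
variable {C : Type*} [Category* C] [Abelian C]

/-- A lift `P ⟶ P'` over the isomorphism is epi because `p'` is essential, hence splits because `P'`
is projective. The section also lies over the isomorphism, so it is epi because `p` is essential,
and it is mono as a section. -/
theorem IsProjectiveCover.nonempty_iso {P P' X X' : C} {p : P ⟶ X} {p' : P' ⟶ X'}
    (hp : IsProjectiveCover p) (hp' : IsProjectiveCover p') (e : X ≅ X') : Nonempty (P ≅ P') := by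
  have := hp.1
  have := hp'.1
  have := hp.2.1
  have := hp'.2.1
  have hf := Projective.factorThru_comp (p ≫ e.hom) p'
  set f := Projective.factorThru (p ≫ e.hom) p'
  have : Epi f := hp'.2.2 f (by rw [hf]; infer_instance)
  have hs := Projective.factorThru_comp (𝟙 P') f
  set s := Projective.factorThru (𝟙 P') f
  have h1 : s ≫ p = p' ≫ e.inv := by
    rw [← cancel_mono e.hom, Category.assoc, ← hf, ← Category.assoc, hs]
    simp
  have : Epi s := hp.2.2 s (by rw [h1]; infer_instance)
  have : Mono s := mono_of_mono_fac hs
  have : IsIso s := isIso_of_mono_of_epi s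
  exact ⟨(asIso s).symm⟩

theorem epi_of_ne_zero {X S : C} [Simple S] {f : X ⟶ S} (h : f ≠ 0) : Epi f :=
  epi_of_nonzero_to_simple h

theorem ne_zero_of_epi {X S : C} [Simple S] (f : X ⟶ S) [Epi f] : f ≠ 0 := fun h => by
  subst h
  exact Simple.not_isZero S (IsZero.of_epi_zero X S)

/-- The head of an essential extension of a simple object is unique. -/
theorem IsEssentialEpi.exists_iso {X L S : C} [Simple L] [Simple S] {q : X ⟶ L}
    (hq : IsEssentialEpi q) {f : X ⟶ S} (hf : f ≠ 0) : ∃ e : L ≅ S, q ≫ e.hom = f := by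
  have := hq.1
  have := epi_of_ne_zero hf
  -- If the kernel of `f` had nonzero image in the simple object `L`, it would map onto `L`, hence
  -- be everything by essentiality, forcing `f = 0`.
  have h0 : kernel.ι f ≫ q = 0 := by
    by_contra h
    have := hq.2 _ (epi_of_ne_zero h)
    exact hf (by rw [← cancel_epi (kernel.ι f), kernel.condition, comp_zero])
  obtain ⟨l, hl'⟩ : ∃ l : S ⟶ L, f ≫ l = q :=
    ⟨_, (CokernelCofork.IsColimit.desc' (Abelian.epiIsCokernelOfKernel
      (KernelFork.ofι (kernel.ι f) (kernel.condition f)) (kernelIsKernel f)) q h0).2⟩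
  have hl0 : l ≠ 0 := fun h => ne_zero_of_epi q (by rw [← hl', h, comp_zero])
  have := isIso_of_hom_simple hl0
  exact ⟨(asIso l).symm, by simp [← hl']⟩

/-- A test morphism into `Y` is pulled back along `q` to one into `X`; pullbacks of epimorphisms are
epi in an abelian category, so essentiality of the composite applies and descends. -/
theorem IsEssentialEpi.of_comp {X Y L : C} {q : X ⟶ Y} {r : Y ⟶ L} [Epi q]
    (h : IsEssentialEpi (q ≫ r)) : IsEssentialEpi r := by
  have := h.1
  refine ⟨epi_of_epi q r, fun Z g hg => ?_⟩
  have h1 : Epi (pullback.snd g q ≫ q ≫ r) := by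
    rw [← Category.assoc, ← pullback.condition, Category.assoc]
    infer_instance
  have h2 := h.2 _ h1
  have h3 : Epi (pullback.fst g q ≫ g) := by
    rw [pullback.condition]
    infer_instance
  exact epi_of_epi (pullback.fst g q) g

variable {S S' : ObjectProperty C}

theorem IsFilteredBy.of_iso {X Y : C} (hX : IsFilteredBy S X) (e : X ≅ Y) :
    IsFilteredBy S Y := by
  cases hX with
  | zero _ h => exact .zero _ (h.of_iso e.symm)
  | ext E hE h₁ h₃ =>
    have i : E ≅ ShortComplex.mk (E.f ≫ e.hom) (e.inv ≫ E.g) (by simp) :=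
      ShortComplex.isoMk (Iso.refl _) e (Iso.refl _)
    exact .ext _ (ShortComplex.shortExact_of_iso i hE) h₁ h₃

theorem IsFilteredBy.single {X : C} (hX : S X) : IsFilteredBy S X := by
  refine .ext (ShortComplex.mk (0 : 0 ⟶ X) (𝟙 X) (by simp)) ?_ (.zero _ (isZero_zero _)) hX
  exact { exact := (ShortComplex.exact_iff_mono _ rfl).2 (inferInstanceAs (Mono (𝟙 X)))
          mono_f := (inferInstanceAs (Mono (0 : (0 : C) ⟶ X)))
          epi_g := inferInstanceAs (Epi (𝟙 X)) }

/-- The constructor `ext` attaches one subquotient at the top. Attaching a whole filtered quotient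
is an induction on its filtration: the kernel of the map from the middle term to the last
subquotient is an extension of the remaining part by the same subobject. -/
theorem IsFilteredBy.extension {X₃ : C} (h₃ : IsFilteredBy S X₃) :
    ∀ (E : ShortComplex C), E.ShortExact → IsFilteredBy S E.X₁ → (E.X₃ ≅ X₃) →
      IsFilteredBy S E.X₂ := by
  induction h₃ with
  | zero X h =>
    intro E hE h₁ e
    have := hE.mono_f
    have : Epi E.f := hE.exact.epi_f ((h.of_iso e).eq_of_tgt _ _)
    have := isIso_of_mono_of_epi E.f
    exact h₁.of_iso (asIso E.f)
  | ext F hF h₁F h₃F ih =>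
    intro E hE h₁ e
    have := hE.mono_f
    have := hE.epi_g
    have := hF.mono_f
    have := hF.epi_g
    let k := E.g ≫ e.hom ≫ F.g
    have hk : E.f ≫ k = 0 := by simp [k]
    have h0 : kernel.ι k ≫ (E.g ≫ e.hom) ≫ F.g = 0 := by
      simpa only [k, Category.assoc] using kernel.condition k
    let a : kernel k ⟶ F.X₁ := hF.exact.lift (kernel.ι k ≫ E.g ≫ e.hom) (by simpa using h0)
    have ha : a ≫ F.f = kernel.ι k ≫ E.g ≫ e.hom := hF.exact.lift_f _ _
    let b : E.X₁ ⟶ kernel k := kernel.lift k E.f hk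
    have hb : b ≫ kernel.ι k = E.f := kernel.lift_ι _ _ _
    have hbm : Mono b := mono_of_mono_fac hb
    have hba : b ≫ a = 0 := by
      rw [← cancel_mono F.f, Category.assoc, ha, ← Category.assoc b, hb]
      simp
    have hEx : (ShortComplex.mk b a hba).Exact := by
      rw [ShortComplex.exact_iff_exact_up_to_refinements]
      intro A x₂ hx
      dsimp only at x₂ hx
      have h2 : (x₂ ≫ kernel.ι k) ≫ E.g = 0 := by
        rw [← cancel_mono e.hom, zero_comp, Category.assoc, Category.assoc, ← ha,
          ← Category.assoc, hx, zero_comp]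
      refine ⟨A, 𝟙 A, inferInstance, hE.exact.lift _ h2, ?_⟩
      rw [← cancel_mono (kernel.ι k)]
      dsimp only
      rw [Category.id_comp, Category.assoc, hb]
      exact (hE.exact.lift_f _ h2).symm
    -- A generalized element of the smaller quotient lifts to the middle term of `E` after
    -- refinement, and the lift lies in the kernel of `k` since `F` is a complex.
    have hae : Epi a := by
      rw [epi_iff_surjective_up_to_refinements]
      intro A y
      obtain ⟨A', π, hπ, x, hx⟩ := surjective_up_to_refinements_of_epi (E.g ≫ e.hom) (y ≫ F.f)
      refine ⟨A', π, hπ, kernel.lift k x ?_, ?_⟩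
      · have : x ≫ k = (x ≫ E.g ≫ e.hom) ≫ F.g := by simp [k]
        rw [this, ← hx]
        simp
      · rw [← cancel_mono F.f, Category.assoc, Category.assoc, ha, kernel.lift_ι_assoc, hx]
    have hker : IsFilteredBy S (kernel k) :=
      ih (ShortComplex.mk b a hba) { exact := hEx } h₁ (Iso.refl _)
    have hkE : Epi k := inferInstance
    exact .ext (ShortComplex.mk (kernel.ι k) k (kernel.condition k))
      { exact := ShortComplex.exact_kernel k } hker h₃F

theorem IsFilteredBy.mono {X : C} (h : IsFilteredBy S X) (hS : S ≤ S') : IsFilteredBy S' X := by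
  induction h with
  | zero X h => exact .zero X h
  | ext E hE _ h₃ ih => exact .ext E hE ih (hS _ h₃)

/-- A contravariant functor turns the filtration upside down: the last subquotient becomes a
subobject, which is why closure under extensions is needed. -/
theorem IsFilteredBy.map_op {D : Type*} [Category* D] [Abelian D] (F : Cᵒᵖ ⥤ D)
    [PreservesFiniteLimits F] [PreservesFiniteColimits F] {Q : ObjectProperty D} {X : C}
    (h : IsFilteredBy S X) (hS : ∀ Y, S Y → Q (F.obj (.op Y))) :
    IsFilteredBy Q (F.obj (.op X)) := by
  have : F.PreservesZeroMorphisms := inferInstance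
  induction h with
  | zero X h => exact .zero _ (F.map_isZero h.op)
  | ext E hE _ h₃ ih =>
    exact ih.extension (E.op.map F) (hE.op.map_of_exact F) (.single (hS _ h₃)) (Iso.refl _)

end Abelian
end StdStrat

/-! ### Existence of projective covers -/

namespace GradedAlg.GrMod
variable {K : Type u} [Field K] {A : Type u} [Ring A] [Algebra K A] {𝒜 : ℤ → Submodule K A}
  [FiniteDimensional K A]

/-- A projective cover is a summand of any projective presentation: it is a minimal submodule
mapping onto `X`. -/
theorem exists_projectiveCover_of_epi {P X : GrMod 𝒜} [Projective P] (p : P ⟶ X) [Epi p] :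
    ∃ (Q : GrMod 𝒜) (q : Q ⟶ X), IsProjectiveCover q := by
  -- These are the dimensions of the subobjects of `P` that still map onto `X`. For one of least
  -- dimension, the image of a test morphism cannot be smaller, which gives essentiality.
  let good : Set ℕ := {n | ∃ (Y : GrMod 𝒜) (i : Y ⟶ P), Mono i ∧ Epi (i ≫ p) ∧ Y.dim = n}
  have hne : good.Nonempty := ⟨_, P, 𝟙 P, inferInstance, by simpa, rfl⟩
  obtain ⟨Y, i, hi, hq, hd⟩ := WellFounded.min_mem (r := (· < ·)) wellFounded_lt good hne
  have hmin : ∀ n ∈ good, Y.dim ≤ n := fun n hn => hd ▸ WellFounded.min_le wellFounded_lt hn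
  have hess : IsEssentialEpi (i ≫ p) := by
    refine ⟨hq, fun Z g hg => ?_⟩
    have h1 : Epi ((image.ι g ≫ i) ≫ p) := by
      have : Epi (factorThruImage g ≫ (image.ι g ≫ i) ≫ p) := by
        simpa using hg
      exact epi_of_epi (factorThruImage g) _
    have := isIso_of_mono_of_dim (image.ι g) (hmin _ ⟨_, image.ι g ≫ i, inferInstance, h1, rfl⟩)
    rw [← image.fac g]
    infer_instance
  refine ⟨Y, i ≫ p, ?_, hess⟩
  -- Projectivity of `P` gives `h : P ⟶ Y` over `X`. The endomorphism `i ≫ h` of `Y` is epi by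
  -- essentiality, hence invertible by dimension, so `Y` is a retract of `P`.
  have hh := Projective.factorThru_comp p (i ≫ p)
  set h := Projective.factorThru p (i ≫ p)
  have : Epi (i ≫ h) := hess.2 _ (by rw [Category.assoc, hh]; exact hq)
  have := isIso_of_epi_endo (i ≫ h)
  exact Retract.projective (Y := P) ⟨i, h ≫ inv (i ≫ h), by rw [← Category.assoc]; simp⟩

theorem exists_projectiveCover [EnoughProjectives (GrMod 𝒜)] (X : GrMod 𝒜) :
    ∃ (Q : GrMod 𝒜) (q : Q ⟶ X), IsProjectiveCover q :=
  exists_projectiveCover_of_epi (Projective.π X)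

end GradedAlg.GrMod

/-! ### Restriction and induction of graded modules, and enough projectives -/

namespace GradedAlg
namespace GrMod
variable {K : Type u} [Field K] {A : Type u} [Ring A] [Algebra K A] {R : Type u} [Ring R]
  [Algebra K R] {𝒜 : ℤ → Submodule K A} {ℛ : ℤ → Submodule K R}
  [FiniteDimensional K A] [FiniteDimensional K R]

/-- A functor between categories of graded modules preserving short exact sequences, checked on
elements, is exact. -/
theorem exact_of_elements (F : GrMod 𝒜 ⥤ GrMod ℛ) [F.PreservesZeroMorphisms] [F.Additive]
    (h : ∀ {X Y Z : GrMod 𝒜} (f : X ⟶ Y) (g : Y ⟶ Z), Function.Injective (toLin f) →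
      Function.Surjective (toLin g) → (∀ y, toLin g y = 0 → ∃ x, toLin f x = y) →
      Function.Injective (toLin (F.map f)) ∧ Function.Surjective (toLin (F.map g)) ∧
      ∀ y, toLin (F.map g) y = 0 → ∃ x, toLin (F.map f) x = y) :
    PreservesFiniteLimits F ∧ PreservesFiniteColimits F := by
  refine (F.exact_tfae.out 0 3).1 fun S hS => ?_
  have := hS.mono_f
  have := hS.epi_g
  obtain ⟨h1, h2, h3⟩ := h S.f S.g (injective_of_mono _) (surjective_of_epi _)
    (exists_of_exact hS.exact)
  exact { exact := shortComplex_exact h3, mono_f := mono_of_injective _ h1,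
          epi_g := epi_of_surjective _ h2 }

section Restrict
variable (φ : R →ₐ[K] A) (hφ : ∀ i, ∀ r ∈ ℛ i, φ r ∈ 𝒜 i)

/-- The identity of the vector space underlying a restricted module. -/
def ofRes (M : GrMod 𝒜) : M.restrict φ hφ ≃ₗ[K] M where
  toFun m := m
  invFun m := m
  map_add' _ _ := rfl
  map_smul' _ _ := rfl
  left_inv _ := rfl
  right_inv _ := rfl

variable {φ hφ} in
theorem ofRes_smul {M : GrMod 𝒜} (r : R) (m : M.restrict φ hφ) :
    ofRes φ hφ M (r • m) = φ r • ofRes φ hφ M m := rfl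

variable {φ hφ} in
theorem ofRes_mem {M : GrMod 𝒜} {m : M.restrict φ hφ} {i : ℤ} :
    ofRes φ hφ M m ∈ M.gr i ↔ m ∈ (M.restrict φ hφ).gr i := Iff.rfl

/-- Restriction of scalars as a functor. -/
abbrev res : GrMod 𝒜 ⥤ GrMod ℛ where
  obj M := M.restrict φ hφ
  map {M N} f := ofLin (M := M.restrict φ hφ) (N := N.restrict φ hφ)
    { toFun := toLin f
      map_add' := map_add (toLin f)
      map_smul' := fun r m => map_smul (toLin f) (φ r) (ofRes φ hφ M m) } (fun _ _ hm => toLin_mem f hm)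
  map_id _ := rfl
  map_comp _ _ := rfl

theorem res_map_apply {M N : GrMod 𝒜} (f : M ⟶ N) (m : M.restrict φ hφ) :
    ofRes φ hφ N (toLin ((res φ hφ).map f) m) = toLin f (ofRes φ hφ M m) := rfl

instance : (res φ hφ : GrMod 𝒜 ⥤ GrMod ℛ).Additive where
  map_add := rfl

theorem res_exact : PreservesFiniteLimits (res φ hφ : GrMod 𝒜 ⥤ GrMod ℛ) ∧
    PreservesFiniteColimits (res φ hφ : GrMod 𝒜 ⥤ GrMod ℛ) :=
  exact_of_elements _ fun _ _ hf hg h => ⟨hf, hg, h⟩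

instance : PreservesFiniteLimits (res φ hφ : GrMod 𝒜 ⥤ GrMod ℛ) := (res_exact φ hφ).1

instance : PreservesFiniteColimits (res φ hφ : GrMod 𝒜 ⥤ GrMod ℛ) := (res_exact φ hφ).2

end Restrict

section Induce
variable (ι : R →ₐ[K] A) (h𝒜 : IsGrading 𝒜) (hℛ : IsGrading ℛ)
  (hι : ∀ i, ∀ r ∈ ℛ i, ι r ∈ 𝒜 i)

/-- The elements `a ⊗ m` of an induced module. -/
def itmul {M : GrMod ℛ} (a : A) (m : M) : M.induce ι h𝒜 hℛ hι :=
  (tensorRel ι M).mkQ (a ⊗ₜ[K] m)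

variable {M N : GrMod ℛ}

theorem smul_itmul (b a : A) (m : M) :
    b • itmul ι h𝒜 hℛ hι a m = itmul ι h𝒜 hℛ hι (b * a) m := rfl

theorem itmul_add (a : A) (m n : M) :
    itmul ι h𝒜 hℛ hι a (m + n) = itmul ι h𝒜 hℛ hι a m + itmul ι h𝒜 hℛ hι a n := by
  unfold itmul
  rw [tmul_add]
  exact map_add _ _ _

theorem itmul_smulK (a : A) (c : K) (m : M) :
    itmul ι h𝒜 hℛ hι a (c • m) = c • itmul ι h𝒜 hℛ hι a m := by
  unfold itmul
  rw [tmul_smul]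
  rfl

theorem itmul_mul (a : A) (r : R) (m : M) :
    itmul ι h𝒜 hℛ hι (a * ι r) m = itmul ι h𝒜 hℛ hι a (r • m) := by
  refine (Submodule.Quotient.eq _).2 ?_
  exact Submodule.subset_span ⟨a, r, m, rfl⟩

theorem itmul_mem {i j k : ℤ} (h : i + j = k) {a : A} {m : M} (ha : a ∈ 𝒜 i) (hm : m ∈ M.gr j) :
    itmul ι h𝒜 hℛ hι a m ∈ (M.induce ι h𝒜 hℛ hι).gr k :=
  ⟨a ⊗ₜ[K] m, Submodule.subset_span ⟨i, j, h, a, ha, m, hm, rfl⟩, rfl⟩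

theorem induce_induction {p : M.induce ι h𝒜 hℛ hι → Prop} (x : M.induce ι h𝒜 hℛ hι)
    (h0 : p 0) (ht : ∀ a m, p (itmul ι h𝒜 hℛ hι a m)) (ha : ∀ x y, p x → p y → p (x + y)) :
    p x := by
  obtain ⟨x, rfl⟩ := (tensorRel ι M).mkQ_surjective x
  induction x using TensorProduct.induction_on with
  | zero => exact h0
  | tmul a m => exact ht a m
  | add x y hx hy => exact ha _ _ hx hy

theorem induce_hom_ext {N : GrMod 𝒜} {f g : M.induce ι h𝒜 hℛ hι ⟶ N}
    (h : ∀ m, toLin f (itmul ι h𝒜 hℛ hι 1 m) = toLin g (itmul ι h𝒜 hℛ hι 1 m)) : f = g := by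
  refine hom_ext fun x => ?_
  refine induce_induction ι h𝒜 hℛ hι (p := fun x => toLin f x = toLin g x) x ?_ ?_ ?_
  · rw [map_zero, map_zero]
  · intro a m
    have : itmul ι h𝒜 hℛ hι a m = a • itmul ι h𝒜 hℛ hι 1 m := by
      rw [smul_itmul, mul_one]
    rw [this, map_smul, map_smul, h]
  · intro x y hx hy
    rw [map_add, map_add, hx, hy]

/-- The map `a ⊗ m ↦ a f(m)` on `A ⊗_K M`. -/
def tensorLift {N : GrMod 𝒜} (f : M →ₗ[K] N) : A ⊗[K] M →ₗ[A] N :=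
  haveI : SMulCommClass K A N := IsScalarTower.to_smulCommClass
  TensorProduct.AlgebraTensorModule.lift (LinearMap.toSpanSingleton A (M →ₗ[K] N) f)

theorem tensorLift_tmul {N : GrMod 𝒜} (f : M →ₗ[K] N) (a : A) (m : M) :
    tensorLift f (a ⊗ₜ[K] m) = a • f m := rfl

/-- The morphism out of an induced module corresponding to a morphism of `R`-modules. -/
def induceLift {N : GrMod 𝒜} (f : M ⟶ N.restrict ι hι) : M.induce ι h𝒜 hℛ hι ⟶ N :=
  let f' : M →ₗ[K] N := (ofRes ι hι N).toLinearMap ∘ₗ (toLin f).restrictScalars K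
  ofLin (M := M.induce ι h𝒜 hℛ hι) ((tensorRel ι M).liftQ (tensorLift f') (by
      refine Submodule.span_le.2 ?_
      rintro _ ⟨a, r, m, rfl⟩
      have h : f' (r • m) = ι r • f' m := by
        simp only [f', LinearMap.comp_apply, LinearMap.coe_restrictScalars, map_smul]
        rfl
      rw [SetLike.mem_coe, LinearMap.mem_ker, map_sub, tensorLift_tmul, tensorLift_tmul, mul_smul,
        h, sub_self])) (by
    rintro i _ ⟨x, hx, rfl⟩
    change tensorLift f' x ∈ N.gr i
    induction hx using Submodule.span_induction with
    | mem x h =>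
      obtain ⟨k, l, rfl, a, ha, m, hm, rfl⟩ := h
      rw [tensorLift_tmul]
      exact N.smul_mem ha ((ofRes_mem (φ := ι) (hφ := hι)).2 (toLin_mem f hm))
    | zero => rw [map_zero]; exact Submodule.zero_mem _
    | add x y _ _ hx hy => rw [map_add]; exact Submodule.add_mem _ hx hy
    | smul c x _ hx =>
      have := ((tensorLift f').restrictScalars K).map_smul c x
      exact this ▸ Submodule.smul_mem _ c hx)

theorem induceLift_itmul {N : GrMod 𝒜} (f : M ⟶ N.restrict ι hι) (a : A) (m : M) :
    toLin (induceLift ι h𝒜 hℛ hι f) (itmul ι h𝒜 hℛ hι a m) =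
      a • ofRes ι hι N (toLin f m) := rfl

/-- The unit `M ⟶ A ⊗_R M` of the adjunction between induction and restriction. -/
def induceUnit (M : GrMod ℛ) : M ⟶ (M.induce ι h𝒜 hℛ hι).restrict ι hι :=
  ofK (N := (M.induce ι h𝒜 hℛ hι).restrict ι hι)
    { toFun := fun m => itmul ι h𝒜 hℛ hι 1 m
      map_add' := itmul_add ι h𝒜 hℛ hι 1
      map_smul' := itmul_smulK ι h𝒜 hℛ hι 1 }
    (fun r m => by
      change itmul ι h𝒜 hℛ hι 1 (r • m) = ι r • itmul ι h𝒜 hℛ hι 1 m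
      rw [smul_itmul, ← itmul_mul, mul_one, one_mul])
    (fun i m hm => itmul_mem ι h𝒜 hℛ hι (zero_add i) h𝒜.one_mem hm)

theorem induceUnit_apply (m : M) :
    ofRes ι hι _ (toLin (induceUnit ι h𝒜 hℛ hι M) m) = itmul ι h𝒜 hℛ hι 1 m := rfl

/-- The morphism of induced modules given by a morphism of modules. -/
def induceMap (f : M ⟶ N) : M.induce ι h𝒜 hℛ hι ⟶ N.induce ι h𝒜 hℛ hι :=
  induceLift ι h𝒜 hℛ hι (f ≫ induceUnit ι h𝒜 hℛ hι N)

theorem induceMap_itmul (f : M ⟶ N) (a : A) (m : M) :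
    toLin (induceMap ι h𝒜 hℛ hι f) (itmul ι h𝒜 hℛ hι a m) =
      itmul ι h𝒜 hℛ hι a (toLin f m) := by
  rw [induceMap, induceLift_itmul, comp_apply, induceUnit_apply, smul_itmul, mul_one]

/-- Induction as a functor. -/
abbrev ind : GrMod ℛ ⥤ GrMod 𝒜 where
  obj M := M.induce ι h𝒜 hℛ hι
  map f := induceMap ι h𝒜 hℛ hι f
  map_id M := induce_hom_ext ι h𝒜 hℛ hι fun m => by
    rw [induceMap_itmul]
    rfl
  map_comp f g := induce_hom_ext ι h𝒜 hℛ hι fun m => by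
    rw [comp_apply, induceMap_itmul, induceMap_itmul, induceMap_itmul, comp_apply]

/-- The bijection between morphisms out of an induced module and into a restricted one. -/
def induceEquiv (M : GrMod ℛ) (N : GrMod 𝒜) :
    (M.induce ι h𝒜 hℛ hι ⟶ N) ≃ (M ⟶ N.restrict ι hι) where
  toFun f := induceUnit ι h𝒜 hℛ hι M ≫ (res ι hι).map f
  invFun f := induceLift ι h𝒜 hℛ hι f
  left_inv f := induce_hom_ext ι h𝒜 hℛ hι fun m => by
    rw [induceLift_itmul, one_smul]
    rfl
  right_inv f := hom_ext fun m => (ofRes ι hι N).injective (by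
    rw [comp_apply, res_map_apply, induceUnit_apply, induceLift_itmul, one_smul])

/-- Induction is left adjoint to restriction. -/
def indAdj : ind ι h𝒜 hℛ hι ⊣ res ι hι :=
  Adjunction.mkOfHomEquiv
    { homEquiv := induceEquiv ι h𝒜 hℛ hι
      homEquiv_naturality_left_symm := fun f g => induce_hom_ext ι h𝒜 hℛ hι fun m => by
        rw [comp_apply, induceMap_itmul]
        rfl
      homEquiv_naturality_right := fun _ _ => rfl }

instance : (ind ι h𝒜 hℛ hι).Additive where
  map_add {M N f g} := induce_hom_ext ι h𝒜 hℛ hι fun m => by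
    rw [add_apply, induceMap_itmul, induceMap_itmul, induceMap_itmul, add_apply, itmul_add]

section Free
variable {Z : Type u} [AddCommGroup Z] [Module K Z] (z : Z →ₗ[K] A)

/-- The multiplication map `Z ⊗ R → A`, `z ⊗ r ↦ z ι(r)`. -/
def mulMap : Z ⊗[K] R →ₗ[K] A := LinearMap.mul' K A ∘ₗ TensorProduct.map z ι.toLinearMap

theorem mulMap_tmul (x : Z) (r : R) : mulMap ι z (x ⊗ₜ r) = z x * ι r := rfl

/-- The canonical map `Z ⊗_K M → A ⊗_R M`. -/
def freeMap (M : GrMod ℛ) : Z ⊗[K] M →ₗ[K] M.induce ι h𝒜 hℛ hι :=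
  (tensorRel ι M).mkQ.restrictScalars K ∘ₗ TensorProduct.map z LinearMap.id

theorem freeMap_tmul (x : Z) (m : M) :
    freeMap ι h𝒜 hℛ hι z M (x ⊗ₜ m) = itmul ι h𝒜 hℛ hι (z x) m := rfl

/-- Writing A as Z ⊗ R, the map zι(r) ⊗ m ↦ z ⊗ rm on A ⊗_K M respects the relations defining A ⊗_R
M, and the map it induces is a left inverse. -/
theorem freeMap_injective (hz : Function.Bijective (mulMap ι z)) (M : GrMod ℛ) :
    Function.Injective (freeMap ι h𝒜 hℛ hι z M) := by
  let e := LinearEquiv.ofBijective _ hz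
  let act : R ⊗[K] M →ₗ[K] M := TensorProduct.lift
    (LinearMap.mk₂ K (fun (r : R) (m : M) => r • m) (fun _ _ _ => add_smul _ _ _)
      (fun _ _ _ => smul_assoc _ _ _) (fun _ _ _ => smul_add _ _ _)
      (fun c r m => smul_comm r c m))
  let ψ : A ⊗[K] M →ₗ[K] Z ⊗[K] M :=
    TensorProduct.map LinearMap.id act ∘ₗ (TensorProduct.assoc K Z R M).toLinearMap ∘ₗ
      TensorProduct.map e.symm.toLinearMap LinearMap.id
  have hψ : ∀ x r m, ψ ((z x * ι r) ⊗ₜ m) = x ⊗ₜ (r • m) := by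
    intro x r m
    have : e.symm (z x * ι r) = x ⊗ₜ r := by
      rw [LinearEquiv.symm_apply_eq]; rfl
    simp only [ψ, LinearMap.comp_apply, TensorProduct.map_tmul, LinearEquiv.coe_coe, this]
    rfl
  have hrel : (tensorRel ι M).restrictScalars K ≤ LinearMap.ker ψ := by
    intro w hw
    refine (Submodule.span_le.2 ?_ : _ ≤ LinearMap.ker ψ) (tensorRel_le ι M w hw)
    rintro _ ⟨a, r, m, rfl⟩
    obtain ⟨w, rfl⟩ := hz.2 a
    change ψ _ = 0
    induction w using TensorProduct.induction_on with
    | zero => simp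
    | add x y hx hy =>
      rw [map_add, add_mul, add_tmul, add_tmul, add_sub_add_comm, map_add, hx, hy, add_zero]
    | tmul x s =>
      rw [mulMap_tmul, mul_assoc, ← map_mul, map_sub, hψ, hψ, mul_smul, sub_self]
  let Ψ : M.induce ι h𝒜 hℛ hι →ₗ[K] Z ⊗[K] M :=
    ((tensorRel ι M).restrictScalars K).liftQ ψ hrel
  have hΨ : ∀ w, Ψ (freeMap ι h𝒜 hℛ hι z M w) = w := by
    intro w
    induction w using TensorProduct.induction_on with
    | zero => rw [map_zero, map_zero]
    | add x y hx hy => rw [map_add, map_add, hx, hy]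
    | tmul x m =>
      have := hψ x 1 m
      rw [map_one, mul_one, one_smul] at this
      exact this
  exact Function.LeftInverse.injective hΨ

theorem freeMap_surjective (hz : Function.Surjective (mulMap ι z)) (M : GrMod ℛ) :
    Function.Surjective (freeMap ι h𝒜 hℛ hι z M) := by
  intro x
  refine induce_induction ι h𝒜 hℛ hι
    (p := fun x => ∃ w, freeMap ι h𝒜 hℛ hι z M w = x) x ⟨0, map_zero _⟩ ?_ ?_
  · intro a m
    obtain ⟨w, rfl⟩ := hz a
    induction w using TensorProduct.induction_on with
    | zero => exact ⟨0, by simp [itmul]; rfl⟩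
    | add x y hx hy =>
      obtain ⟨x', hx'⟩ := hx
      obtain ⟨y', hy'⟩ := hy
      refine ⟨x' + y', ?_⟩
      rw [map_add, hx', hy', map_add]
      unfold itmul
      rw [add_tmul]
      exact (map_add _ _ _).symm
    | tmul x r =>
      refine ⟨x ⊗ₜ (r • m), ?_⟩
      rw [freeMap_tmul, ← itmul_mul, mulMap_tmul]
  · rintro _ _ ⟨x, rfl⟩ ⟨y, rfl⟩
    exact ⟨x + y, map_add _ _ _⟩

theorem freeMap_naturality (f : M ⟶ N) (w : Z ⊗[K] M) :
    toLin (induceMap ι h𝒜 hℛ hι f) (freeMap ι h𝒜 hℛ hι z M w) =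
      freeMap ι h𝒜 hℛ hι z N (LinearMap.lTensor Z ((toLin f).restrictScalars K) w) := by
  induction w using TensorProduct.induction_on with
  | zero => simp only [map_zero]
  | add x y hx hy => simp only [map_add, hx, hy]
  | tmul x m => exact induceMap_itmul ι h𝒜 hℛ hι f _ m

/-- Induction is exact if `A` is a free right module over `R`. -/
theorem ind_exact (hz : Function.Bijective (mulMap ι z)) :
    PreservesFiniteLimits (ind ι h𝒜 hℛ hι) := by
  have hc : PreservesFiniteColimits (ind ι h𝒜 hℛ hι) :=
    have := (indAdj ι h𝒜 hℛ hι).leftAdjoint_preservesColimits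
    inferInstance
  refine ((ind ι h𝒜 hℛ hι).preservesFiniteLimits_tfae.out 0 3).1 fun S hS => ?_
  have := hS.mono_f
  have hex : ∀ S : ShortComplex (GrMod ℛ), S.ShortExact → (S.map (ind ι h𝒜 hℛ hι)).Exact ∧
      Epi ((ind ι h𝒜 hℛ hι).map S.g) :=
    ((ind ι h𝒜 hℛ hι).preservesFiniteColimits_tfae.out 3 0).1 hc
  refine ⟨(hex S hS).1,
    mono_of_injective _ ?_⟩
  rw [← LinearMap.ker_eq_bot, LinearMap.ker_eq_bot']
  intro x hx
  obtain ⟨w, rfl⟩ := freeMap_surjective ι h𝒜 hℛ hι z hz.2 _ x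
  -- Freeness identifies the induced morphism with the original one tensored over the field with Z,
  -- and this preserves injectivity by flatness.
  rw [freeMap_naturality] at hx
  have h1 := freeMap_injective ι h𝒜 hℛ hι z hz _ (hx.trans (map_zero _).symm)
  have h2 := Module.Flat.lTensor_preserves_injective_linearMap (M := Z)
    ((toLin S.f).restrictScalars K) (injective_of_mono S.f) (h1.trans (map_zero _).symm)
  exact (congrArg _ h2).trans (map_zero _)

end Free

/-- If `R` consists of scalars, then all graded `R`-modules are projective. -/
theorem projective_of_scalars (hR : ∀ r : R, ∃ c : K, r = algebraMap K R c) (V : GrMod ℛ) :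
    Projective V := by
  refine ⟨fun {E X} f e he => ?_⟩
  obtain ⟨s, hs⟩ := ((toLin e).restrictScalars K).exists_rightInverse_of_surjective
    (LinearMap.range_eq_top.2 (surjective_of_epi e))
  replace hs : ∀ x, toLin e (s x) = x := fun x => LinearMap.congr_fun hs x
  -- The linear section `s` of `e` may ignore degrees. Only its degree-preserving part is kept: the
  -- sum over `i` of projection to degree `i`, then `f`, then `s`, then projection to degree `i`.
  let t := (finite_support V.isInternal).toFinset
  let g : V →ₗ[K] E := ∑ i ∈ t, proj E.isInternal i ∘ₗ s ∘ₗ (toLin f).restrictScalars K ∘ₗ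
    proj V.isInternal i
  refine ⟨ofK g ?_ ?_, ?_⟩
  · intro r m
    obtain ⟨c, rfl⟩ := hR r
    rw [algebraMap_smul, algebraMap_smul, map_smul]
  · intro i m hm
    rw [LinearMap.sum_apply]
    refine Submodule.sum_mem _ fun j _ => ?_
    by_cases h : j = i
    · subst h
      exact proj_mem _ _ _
    · rw [LinearMap.comp_apply, LinearMap.comp_apply, LinearMap.comp_apply, proj_of_ne _ h hm,
        map_zero, map_zero, map_zero]
      exact Submodule.zero_mem _
  · refine hom_ext fun m => ?_
    rw [comp_apply, toLin_ofK, LinearMap.sum_apply, map_sum]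
    simp only [LinearMap.comp_apply, toLin_proj, hs, LinearMap.coe_restrictScalars]
    simp only [proj_self _ (proj_mem _ _ _), ← toLin_proj]
    rw [← map_sum, sum_proj _ _ (by simp [t])]

end Induce

/-- The grading concentrated in degree zero. -/
def trivialGrading (K R : Type u) [Field K] [Ring R] [Algebra K R] : ℤ → Submodule K R :=
  fun i => if i = 0 then ⊤ else ⊥

theorem isGrading_trivialGrading : IsGrading (trivialGrading K R) where
  isInternal := isInternal_of_proj (fun i => if i = 0 then LinearMap.id else 0)
    (by
      intro i x hx
      by_cases h : i = 0
      · simp [h]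
      · simpa [trivialGrading, h, eq_comm] using hx)
    (by
      intro i j hij x hx
      by_cases h : j = 0
      · subst h; simp [hij]
      · rw [trivialGrading, if_neg h, Submodule.mem_bot] at hx
        simp [hx])
    (fun x => Submodule.mem_iSup_of_mem 0 (by simp [trivialGrading]))
  one_mem := by simp [trivialGrading]
  mul_mem {i j a b} ha hb := by
    simp only [trivialGrading] at *
    by_cases hi : i = 0 <;> by_cases hj : j = 0
    · simp [hi, hj]
    · rw [if_neg hj, Submodule.mem_bot] at hb
      simp [hb]
    · rw [if_neg hi, Submodule.mem_bot] at ha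
      simp [ha]
    · rw [if_neg hi, Submodule.mem_bot] at ha
      simp [ha]

/-- Every M is a quotient of the module induced from its restriction to the scalars. Graded modules
over the scalars are projective, and induction preserves projectives because restriction is exact.
-/
theorem enoughProjectives (h𝒜 : IsGrading 𝒜) : EnoughProjectives (GrMod 𝒜) := by
  let ι : (⊥ : Subalgebra K A) →ₐ[K] A := (⊥ : Subalgebra K A).val
  have hι : ∀ i, ∀ r ∈ trivialGrading K (⊥ : Subalgebra K A) i, ι r ∈ 𝒜 i := by
    intro i r hr
    by_cases h : i = 0
    · subst h
      obtain ⟨c, hc⟩ := Algebra.mem_bot.1 r.2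
      change (r : A) ∈ 𝒜 0
      rw [← hc, Algebra.algebraMap_eq_smul_one]
      exact Submodule.smul_mem _ c h𝒜.one_mem
    · rw [trivialGrading, if_neg h, Submodule.mem_bot] at hr
      rw [hr, map_zero]
      exact Submodule.zero_mem _
  have hR : ∀ r : (⊥ : Subalgebra K A), ∃ c : K, r = algebraMap K _ c := fun r => by
    obtain ⟨c, hc⟩ := Algebra.mem_bot.1 r.2
    exact ⟨c, Subtype.ext hc.symm⟩
  refine ⟨fun M => ⟨{
    p := (M.restrict ι hι).induce ι h𝒜 isGrading_trivialGrading hι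
    projective := (indAdj ι h𝒜 isGrading_trivialGrading hι).map_projective _
      (projective_of_scalars hR _)
    f := induceLift ι h𝒜 isGrading_trivialGrading hι (𝟙 _)
    epi := epi_of_surjective _ fun m =>
      ⟨itmul ι h𝒜 isGrading_trivialGrading hι 1 ((ofRes ι hι M).symm m), one_smul A m⟩ }⟩⟩

end GrMod
end GradedAlg

/-! ### Simple objects under opposites and equivalences, and graded duality -/

theorem StdStrat.simple_op {C : Type*} [Category* C] [Abelian C] (X : C) [Simple X] :
    Simple (Opposite.op X) := by
  refine ⟨fun {Y} f _ => ⟨fun _ h0 => ?_, fun h0 => ?_⟩⟩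
  · have h1 : f.unop = 0 := congrArg Quiver.Hom.unop h0
    have : IsIso (0 : X ⟶ Y.unop) := h1 ▸ inferInstanceAs (IsIso f.unop)
    exact Simple.not_isZero X ((IsZero.iff_id_eq_zero _).2
      (by rw [← IsIso.hom_inv_id (0 : X ⟶ Y.unop), zero_comp]))
  · have h1 : f.unop ≠ 0 := fun h => h0 (Quiver.Hom.unop_inj h)
    have := isIso_of_epi_of_nonzero h1
    exact inferInstanceAs (IsIso f.unop.op)

theorem StdStrat.simple_map {C D : Type*} [Category* C] [Category* D] [Preadditive C]
    [Preadditive D] (F : C ⥤ D) [F.IsEquivalence] [F.PreservesZeroMorphisms] (X : C) [Simple X] :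
    Simple (F.obj X) := by
  refine ⟨fun {Y} f _ => ?_⟩
  let e := F.objObjPreimageIso Y
  let g := F.preimage (e.hom ≫ f)
  have hg : F.map g = e.hom ≫ f := F.map_preimage _
  have hm : Mono g := F.mono_of_mono_map (by rw [hg]; infer_instance)
  have h1 : IsIso f ↔ IsIso g := by
    rw [← isIso_iff_of_reflects_iso g F, hg, isIso_comp_left_iff]
  have h2 : f = 0 ↔ g = 0 := by
    rw [← F.map_eq_zero_iff, hg, Preadditive.IsIso.comp_left_eq_zero]
  rw [h1, Simple.mono_isIso_iff_nonzero g, ne_eq, ne_eq, h2]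

namespace GradedAlg
namespace GrMod
open MulOpposite
variable {K : Type u} [Field K] {R : Type u} [Ring R] [Algebra K R] {ℛ : ℤ → Submodule K R}
  [FiniteDimensional K R]

section Dual

/-- The elements of the dual module as linear forms. -/
def toDual (M : GrMod ℛ) : M.dual ≃ₗ[K] Module.Dual K M where
  toFun f := f
  invFun f := f
  map_add' _ _ := rfl
  map_smul' _ _ := rfl
  left_inv _ := rfl
  right_inv _ := rfl

theorem toDual_smul {M : GrMod ℛ} (a : Rᵐᵒᵖ) (f : M.dual) (m : M) :
    M.toDual (a • f) m = M.toDual f (a.unop • m) := rfl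

theorem mem_dual_gr {M : GrMod ℛ} {f : M.dual} {i : ℤ} :
    f ∈ M.dual.gr i ↔ ∀ j, j ≠ i → ∀ m ∈ M.gr j, M.toDual f m = 0 := Iff.rfl

/-- The transpose of a morphism. -/
def dualMap {M N : GrMod ℛ} (f : M ⟶ N) : N.dual ⟶ M.dual :=
  ofK (M.toDual.symm.toLinearMap ∘ₗ ((toLin f).restrictScalars K).dualMap ∘ₗ
      N.toDual.toLinearMap)
    (fun a g => M.toDual.injective (LinearMap.ext fun m => by
      change N.toDual (a • g) (toLin f m) = N.toDual g (toLin f (a.unop • m))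
      rw [toDual_smul, map_smul (toLin f)]))
    (fun _ _ hg j hj m hm => hg j hj _ (toLin_mem f hm))

theorem dualMap_apply {M N : GrMod ℛ} (f : M ⟶ N) (g : N.dual) (m : M) :
    M.toDual (toLin (dualMap f) g) m = N.toDual g (toLin f m) := rfl

theorem dual_hom_ext {M : GrMod ℛ} {X : GrMod (opGrading ℛ)} {f g : X ⟶ M.dual}
    (h : ∀ x m, M.toDual (toLin f x) m = M.toDual (toLin g x) m) : f = g :=
  hom_ext fun x => M.toDual.injective (LinearMap.ext (h x))

/-- Graded duality, as a contravariant functor. -/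
abbrev dualF (ℛ : ℤ → Submodule K R) : (GrMod ℛ)ᵒᵖ ⥤ GrMod (opGrading ℛ) where
  obj M := M.unop.dual
  map f := dualMap f.unop
  map_id _ := rfl
  map_comp _ _ := rfl

/-- The dual of a graded module over the opposite algebra, as a module over `R`. -/
def undual (X : GrMod (opGrading ℛ)) : GrMod ℛ :=
  X.dual.restrict (AlgEquiv.opOp K R).toAlgHom (fun i r hr => by
    change r ∈ ℛ (- -i)
    rwa [neg_neg])

/-- The elements of the dual of a module over the opposite algebra as linear forms. -/
def toUndual (X : GrMod (opGrading ℛ)) : X.undual ≃ₗ[K] Module.Dual K X where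
  toFun f := f
  invFun f := f
  map_add' _ _ := rfl
  map_smul' _ _ := rfl
  left_inv _ := rfl
  right_inv _ := rfl

theorem toUndual_smul {X : GrMod (opGrading ℛ)} (a : R) (f : X.undual) (x : X) :
    X.toUndual (a • f) x = X.toUndual f (op a • x) := rfl

theorem mem_undual_gr {X : GrMod (opGrading ℛ)} {f : X.undual} {i : ℤ} :
    f ∈ X.undual.gr i ↔ ∀ j, j ≠ i → ∀ x ∈ X.gr j, X.toUndual f x = 0 := Iff.rfl

/-- The transpose of a morphism of modules over the opposite algebra. -/
def undualMap {X Y : GrMod (opGrading ℛ)} (f : X ⟶ Y) : Y.undual ⟶ X.undual :=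
  ofK (X.toUndual.symm.toLinearMap ∘ₗ ((toLin f).restrictScalars K).dualMap ∘ₗ
      Y.toUndual.toLinearMap)
    (fun a g => X.toUndual.injective (LinearMap.ext fun x => by
      change Y.toUndual (a • g) (toLin f x) = Y.toUndual g (toLin f (op a • x))
      rw [toUndual_smul, map_smul (toLin f)]))
    (fun _ _ hg j hj m hm => hg j hj _ (toLin_mem f hm))

theorem undual_hom_ext {M : GrMod ℛ} {X : GrMod (opGrading ℛ)} {f g : M ⟶ X.undual}
    (h : ∀ m x, X.toUndual (toLin f m) x = X.toUndual (toLin g m) x) : f = g :=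
  hom_ext fun x => X.toUndual.injective (LinearMap.ext (h x))

/-- Duality for modules over the opposite algebra, as a contravariant functor. -/
abbrev undualF (ℛ : ℤ → Submodule K R) : (GrMod (opGrading ℛ))ᵒᵖ ⥤ GrMod ℛ where
  obj X := X.unop.undual
  map f := undualMap f.unop
  map_id _ := rfl
  map_comp _ _ := rfl

/-- Morphisms into dual modules in either sense are invariant pairings. -/
def dualEquiv (X : GrMod (opGrading ℛ)) (M : GrMod ℛ) : (X ⟶ M.dual) ≃ (M ⟶ X.undual) where
  toFun f := ofK (X.toUndual.symm.toLinearMap ∘ₗ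
      (M.toDual.toLinearMap ∘ₗ (toLin f).restrictScalars K).flip)
    (fun a m => X.toUndual.injective (LinearMap.ext fun x => by
      change M.toDual (toLin f x) (a • m) = M.toDual (toLin f (op a • x)) m
      rw [map_smul (toLin f)]
      rfl))
    (fun i m hm j hj x hx => mem_dual_gr.1 (toLin_mem f hx) i hj.symm m hm)
  invFun f := ofK (M.toDual.symm.toLinearMap ∘ₗ
      (X.toUndual.toLinearMap ∘ₗ (toLin f).restrictScalars K).flip)
    (fun a x => M.toDual.injective (LinearMap.ext fun m => by
      change X.toUndual (toLin f m) (a • x) = X.toUndual (toLin f (a.unop • m)) x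
      rw [map_smul (toLin f)]
      rfl))
    (fun i m hm j hj x hx => mem_undual_gr.1 (toLin_mem f hx) i hj.symm m hm)
  left_inv _ := rfl
  right_inv _ := rfl

/-- The identity of `M.dual` corresponds under `dualEquiv` to the evaluation map into the bidual,
and `M` is finite-dimensional. -/
theorem bijective_eval (M : GrMod ℛ) :
    Function.Bijective (toLin (dualEquiv M.dual M (𝟙 _))) :=
  (Module.evalEquiv K M).bijective

theorem bijective_eval' (X : GrMod (opGrading ℛ)) :
    Function.Bijective (toLin ((dualEquiv X X.undual).symm (𝟙 _))) :=
  (Module.evalEquiv K X).bijective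

/-- The canonical isomorphism of a module with its bidual. -/
noncomputable def evalIso (M : GrMod ℛ) : M ≅ M.dual.undual :=
  isoOfBijective _ (bijective_eval M)

/-- The canonical isomorphism of a module over the opposite algebra with its bidual. -/
noncomputable def evalIso' (X : GrMod (opGrading ℛ)) : X ≅ X.undual.dual :=
  isoOfBijective _ (bijective_eval' X)

/-- Graded duality is an equivalence. -/
noncomputable def dualEquivalence (ℛ : ℤ → Submodule K R) :
    (GrMod ℛ)ᵒᵖ ≌ GrMod (opGrading ℛ) :=
  CategoryTheory.Equivalence.mk (dualF ℛ) (undualF ℛ).rightOp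
    (NatIso.ofComponents (fun M => (evalIso M.unop).symm.op) (fun {M N} f =>
      Quiver.Hom.unop_inj (by
        change (evalIso N.unop).inv ≫ f.unop =
          undualMap (dualMap f.unop) ≫ (evalIso M.unop).inv
        rw [Iso.inv_comp_eq, ← Category.assoc, Iso.eq_comp_inv]
        rfl)))
    (NatIso.ofComponents (fun X => (evalIso' X).symm) (fun {X Y} f => by
        change dualMap (undualMap f) ≫ (evalIso' Y).inv = (evalIso' X).inv ≫ f
        rw [Iso.eq_inv_comp, ← Category.assoc, Iso.comp_inv_eq]
        rfl))

instance : (dualF ℛ).IsEquivalence := (dualEquivalence ℛ).isEquivalence_functor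

instance : (undualF ℛ).IsEquivalence := by
  have : (undualF ℛ).rightOp.IsEquivalence := (dualEquivalence ℛ).isEquivalence_inverse
  exact ((undualF ℛ).rightOp.asEquivalence.leftOp).isEquivalence_functor

/-- Duality does not negate degrees, since the grading of the opposite algebra is reversed instead.
Bounds such as "in degrees ≤ d" and the labels' degrees are therefore unchanged under duality. -/
theorem dual_gr_eq_bot_iff {M : GrMod ℛ} {i : ℤ} : M.dual.gr i = ⊥ ↔ M.gr i = ⊥ := by
  constructor
  · intro h
    refine (Submodule.eq_bot_iff _).2 fun m hm => ?_
    refine (Module.forall_dual_apply_eq_zero_iff K m).1 fun f => ?_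
    -- An arbitrary linear form becomes homogeneous of degree `i` after composition with the
    -- projection, without changing its value on `m`.
    have h1 : M.toDual.symm (f ∘ₗ proj M.isInternal i) ∈ M.dual.gr i := fun j hj x hx => by
      change f (proj M.isInternal i x) = 0
      rw [proj_of_ne _ hj.symm hx, map_zero]
    rw [h, Submodule.mem_bot, LinearEquiv.map_eq_zero_iff] at h1
    rw [← proj_self M.isInternal hm]
    exact LinearMap.congr_fun h1 m
  · intro h
    refine (Submodule.eq_bot_iff _).2 fun f hf => M.toDual.injective (LinearMap.ext fun m => ?_)
    refine ext_of_gr (M := M) (f := fun m => M.toDual f m) (g := fun m => 0)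
      (by simp) (by simp) (fun j m hm => ?_) m
    by_cases hj : j = i
    · subst hj
      rw [h, Submodule.mem_bot] at hm
      rw [hm, map_zero]
    · exact hf j hj m hm

theorem undual_gr_eq_bot_iff {X : GrMod (opGrading ℛ)} {i : ℤ} :
    X.undual.gr i = ⊥ ↔ X.gr i = ⊥ := by
  rw [← dual_gr_eq_bot_iff (M := X.undual)]
  exact ⟨fun h => gr_eq_bot_of_injective (evalIso' X).hom
      (Function.LeftInverse.injective (hom_inv_apply (evalIso' X))) h,
    fun h => gr_eq_bot_of_surjective (evalIso' X).hom
      (Function.RightInverse.surjective (inv_hom_apply (evalIso' X))) h⟩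

instance : (dualF ℛ).Additive where
  map_add {M _ _ _} := dual_hom_ext fun φ _ => map_add (M.unop.toDual φ) _ _

instance : (undualF ℛ).Additive where
  map_add {M _ _ _} := undual_hom_ext fun φ _ => map_add (M.unop.toUndual φ) _ _

instance (M : GrMod ℛ) [Simple M] : Simple M.dual :=
  have := simple_op M
  simple_map (dualF ℛ) (.op M)

instance (X : GrMod (opGrading ℛ)) [Simple X] : Simple X.undual :=
  have := simple_op X
  simple_map (undualF ℛ) (.op X)

/-- Duality commutes with restriction of scalars. -/
def dualRestrictIso {A : Type u} [Ring A] [Algebra K A] {𝒜 : ℤ → Submodule K A}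
    [FiniteDimensional K A] (φ : R →ₐ[K] A) (hφ : ∀ i, ∀ r ∈ ℛ i, φ r ∈ 𝒜 i)
    (hφ' : ∀ i, ∀ r ∈ opGrading ℛ i, AlgHom.op φ r ∈ opGrading 𝒜 i) (M : GrMod 𝒜) :
    (M.restrict φ hφ).dual ≅ M.dual.restrict (AlgHom.op φ) hφ' where
  hom := ofK (N := M.dual.restrict (AlgHom.op φ) hφ') ((ofRes (AlgHom.op φ) hφ' M.dual).symm.toLinearMap ∘ₗ M.toDual.symm.toLinearMap ∘ₗ
    (ofRes φ hφ M).symm.toLinearMap.dualMap ∘ₗ (M.restrict φ hφ).toDual.toLinearMap)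
    (fun _ _ => rfl) (fun _ _ hm => hm)
  inv := ofK (M := M.dual.restrict (AlgHom.op φ) hφ') ((M.restrict φ hφ).toDual.symm.toLinearMap ∘ₗ
    (ofRes φ hφ M).toLinearMap.dualMap ∘ₗ M.toDual.toLinearMap ∘ₗ
    (ofRes (AlgHom.op φ) hφ' M.dual).toLinearMap)
    (fun _ _ => rfl) (fun _ _ hm => hm)
  hom_inv_id := rfl
  inv_hom_id := rfl

end Dual
end GrMod
end GradedAlg

/-! ### Homogeneous components over an algebra in degree zero, and degree bounds -/

namespace GradedAlg
namespace GrMod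
section Component
variable {K : Type u} [Field K] {T : Type u} [Ring T] [Algebra K T] {𝒯 : ℤ → Submodule K T}
  [FiniteDimensional K T]

theorem ext_of_isInternal {M : Type*} [AddCommGroup M] [Module K M] {S : ℤ → Submodule K M}
    (h : DirectSum.IsInternal S) {P : Type*} [AddCommGroup P] {f g : M → P}
    (hf : ∀ x y, f (x + y) = f x + f y) (hg : ∀ x y, g (x + y) = g x + g y)
    (hfg : ∀ i, ∀ m ∈ S i, f m = g m) (m : M) : f m = g m := by
  have hf0 : f 0 = 0 := by simpa using hf 0 0
  have hg0 : g 0 = 0 := by simpa using hg 0 0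
  exact Submodule.iSup_induction S (motive := fun m => f m = g m)
    (mem_iSup_of_isInternal h m) hfg (by rw [hf0, hg0])
    (fun x y hx hy => by rw [hf, hg, hx, hy])

theorem mem_zero_of_concentrated (h𝒯 : DirectSum.IsInternal 𝒯) (hT : ∀ i, i ≠ 0 → 𝒯 i = ⊥)
    (t : T) : t ∈ 𝒯 0 := by
  have : (⨆ i, 𝒯 i) ≤ 𝒯 0 := iSup_le fun i => by
    by_cases h : i = 0
    · rw [h]
    · rw [hT i h]; exact bot_le
  exact this (mem_iSup_of_isInternal h𝒯 t)

variable (h : ∀ t, t ∈ 𝒯 0)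

/-- The component of degree `d` as a submodule, for an algebra concentrated in degree zero. -/
def compSub (h : ∀ t, t ∈ 𝒯 0) (d : ℤ) (N : GrMod 𝒯) : Submodule T N where
  carrier := N.gr d
  add_mem' := Submodule.add_mem _
  zero_mem' := Submodule.zero_mem _
  smul_mem' t m hm := by
    have := N.smul_mem (h t) hm
    rwa [zero_add] at this

theorem compSub_proj (d : ℤ) (N : GrMod 𝒯) (i : ℤ) (x : N) (hx : x ∈ compSub h d N) :
    proj N.isInternal i x ∈ compSub h d N := by
  by_cases hi : i = d
  · subst hi; exact proj_mem _ _ _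
  · rw [proj_of_ne _ hi hx]; exact Submodule.zero_mem _

/-- The component of degree `d`, for an algebra concentrated in degree zero. -/
def comp (d : ℤ) (N : GrMod 𝒯) : GrMod 𝒯 := N.sub (compSub h d N) (compSub_proj h d N)

/-- The inclusion of the component of degree `d`. -/
def compι (d : ℤ) (N : GrMod 𝒯) : comp h d N ⟶ N := N.subι (compSub h d N) (compSub_proj h d N)

theorem compι_mem {d : ℤ} {N : GrMod 𝒯} (x : comp h d N) : toLin (compι h d N) x ∈ N.gr d := x.2

theorem compι_injective (d : ℤ) (N : GrMod 𝒯) : Function.Injective (toLin (compι h d N)) :=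
  Subtype.val_injective

theorem proj_smul_of_concentrated (h : ∀ t, t ∈ 𝒯 0) {N : GrMod 𝒯} (d : ℤ) (t : T) (n : N) :
    proj N.isInternal d (t • n) = t • proj N.isInternal d n :=
  proj_smul_of_mem (h t) (zero_add d) n

/-- The projection onto the component of degree `d`. -/
noncomputable def compπ (d : ℤ) (N : GrMod 𝒯) : N ⟶ comp h d N :=
  ofLin (N := comp h d N) (LinearMap.codRestrict (compSub h d N)
    { toFun := proj N.isInternal d
      map_add' := map_add _
      map_smul' := proj_smul_of_concentrated h d } (fun n => proj_mem _ _ n))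
    (fun i n hn => by
      change proj N.isInternal d n ∈ N.gr i
      by_cases hi : d = i
      · subst hi; exact proj_mem _ _ _
      · rw [proj_of_ne _ hi hn]; exact Submodule.zero_mem _)

theorem compι_compπ_apply {d : ℤ} {N : GrMod 𝒯} (n : N) :
    toLin (compι h d N) (toLin (compπ h d N) n) = proj N.isInternal d n := rfl

theorem compι_compπ (d : ℤ) (N : GrMod 𝒯) : compι h d N ≫ compπ h d N = 𝟙 _ :=
  hom_ext fun n => compι_injective h d N (proj_self _ (compι_mem h n))

/-- The idempotent projecting onto degree `d` is natural; this is what makes `compF` compatible with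
composition. -/
theorem proj_endo_comp {M N : GrMod 𝒯} (f : M ⟶ N) (d : ℤ) :
    (compπ h d M ≫ compι h d M) ≫ f = f ≫ compπ h d N ≫ compι h d N :=
  hom_ext fun m => toLin_proj f d m

/-- The component of degree `d`, as a functor. -/
noncomputable abbrev compF (d : ℤ) : GrMod 𝒯 ⥤ GrMod 𝒯 where
  obj N := comp h d N
  map {M N} f := compι h d M ≫ f ≫ compπ h d N
  map_id N := by rw [Category.id_comp, compι_compπ]
  map_comp {M N P} f g := by
    have key := congrArg (· ≫ compπ h d P) (proj_endo_comp h g d)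
    simp only [Category.assoc, compι_compπ, Category.comp_id] at key ⊢
    rw [key]

theorem compF_map_apply {M N : GrMod 𝒯} (f : M ⟶ N) (d : ℤ) (m : comp h d M) :
    toLin (compι h d N) (toLin ((compF h d).map f) m) = toLin f (toLin (compι h d M) m) :=
  proj_self _ (toLin_mem f (compι_mem h m))

instance (d : ℤ) : (compF h d).Additive where
  map_add {M N f g} := by
    change compι h d M ≫ (f + g) ≫ compπ h d N = _
    rw [Preadditive.add_comp, Preadditive.comp_add]

theorem compF_exact (d : ℤ) : PreservesFiniteLimits (compF h d) ∧
    PreservesFiniteColimits (compF h d) := by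
  refine exact_of_elements _ fun {X Y Z} f g hf hg hfg => ⟨?_, ?_, ?_⟩
  · intro a b hab
    refine compι_injective h d X (hf ?_)
    rw [← compF_map_apply, hab, compF_map_apply]
  · intro z
    obtain ⟨y, hy, hyz⟩ := exists_mem_gr_of_surjective g hg (compι_mem h z)
    refine ⟨toLin (compπ h d Y) y, compι_injective h d Z ?_⟩
    rw [compF_map_apply, compι_compπ_apply, proj_self _ hy, hyz]
  · intro y hy
    have h1 : toLin g (toLin (compι h d Y) y) = 0 := by
      rw [← compF_map_apply, hy, map_zero]
    obtain ⟨x, hx⟩ := hfg _ h1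
    refine ⟨toLin (compπ h d X) x, compι_injective h d Y ?_⟩
    rw [compF_map_apply, compι_compπ_apply, toLin_proj, hx, proj_self _ (compι_mem h y)]

instance (d : ℤ) : PreservesFiniteLimits (compF h d) := (compF_exact h d).1

instance (d : ℤ) : PreservesFiniteColimits (compF h d) := (compF_exact h d).2

end Component

section Bounds
variable {K : Type u} [Field K] {A : Type u} [Ring A] [Algebra K A]

/-- The graded modules concentrated in degrees in a given set. -/
def support (𝒜 : ℤ → Submodule K A) (I : Set ℤ) : ObjectProperty (GrMod 𝒜) :=
  fun M => ∀ i, i ∉ I → M.gr i = ⊥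

/-- The graded modules concentrated in degrees `≤ d`. -/
abbrev upTo (𝒜 : ℤ → Submodule K A) (d : ℤ) := support 𝒜 (Set.Iic d)

/-- The graded modules concentrated in degree `d`. -/
abbrev conc (𝒜 : ℤ → Submodule K A) (d : ℤ) := support 𝒜 {d}

variable {𝒜 : ℤ → Submodule K A} [FiniteDimensional K A]

theorem support_of_mono {I : Set ℤ} {M N : GrMod 𝒜} (f : M ⟶ N) [Mono f] (h : support 𝒜 I N) :
    support 𝒜 I M :=
  fun i hi => gr_eq_bot_of_injective f (injective_of_mono f) (h i hi)

theorem support_of_epi {I : Set ℤ} {M N : GrMod 𝒜} (f : M ⟶ N) [Epi f] (h : support 𝒜 I M) :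
    support 𝒜 I N :=
  fun i hi => gr_eq_bot_of_surjective f (surjective_of_epi f) (h i hi)

instance (I : Set ℤ) : (support 𝒜 I).IsSerreClass where
  exists_zero := by
    obtain ⟨Z, hZ⟩ := HasZeroObject.zero (C := GrMod 𝒜)
    exact ⟨Z, hZ, fun i _ => (isZero_iff_gr Z).1 hZ i⟩
  prop_of_mono f _ h := support_of_mono f h
  prop_of_epi f _ h := support_of_epi f h
  prop_X₂_of_shortExact {S} hS h₁ h₃ := fun i hi => by
    have := hS.mono_f
    refine (Submodule.eq_bot_iff _).2 fun x hx => ?_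
    have h1 := toLin_mem S.g hx
    rw [h₃ i hi, Submodule.mem_bot] at h1
    obtain ⟨y, rfl⟩ := exists_of_exact hS.exact x h1
    have h2 := mem_gr_of_injective S.f (injective_of_mono S.f) hx
    rw [h₁ i hi, Submodule.mem_bot] at h2
    rw [h2, map_zero]

theorem conc_mem_gr {d : ℤ} {M : GrMod 𝒜} (h : conc 𝒜 d M) (m : M) : m ∈ M.gr d := by
  have : (⨆ i, M.gr i) ≤ M.gr d := iSup_le fun i => by
    by_cases hi : i = d
    · rw [hi]
    · rw [h i hi]; exact bot_le
  exact this (mem_iSup_of_isInternal M.isInternal m)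

theorem conc_hom_mem {d : ℤ} {M N : GrMod 𝒜} (h : conc 𝒜 d M) (f : M ⟶ N) (m : M) :
    toLin f m ∈ N.gr d := toLin_mem f (conc_mem_gr h m)

end Bounds

section Component
variable {K : Type u} [Field K] {T : Type u} [Ring T] [Algebra K T] {𝒯 : ℤ → Submodule K T}
  [FiniteDimensional K T] (h : ∀ t, t ∈ 𝒯 0)

theorem comp_conc (d : ℤ) (N : GrMod 𝒯) : conc 𝒯 d (comp h d N) := by
  intro i hi
  refine (Submodule.eq_bot_iff _).2 fun x hx => compι_injective h d N ?_
  have h1 : toLin (compι h d N) x ∈ N.gr i := toLin_mem _ hx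
  rw [← proj_self N.isInternal h1, proj_of_ne _ hi (compι_mem h x), map_zero]

/-- Morphisms from a module concentrated in degree `d`. -/
noncomputable def toCompEquiv {d : ℤ} {N : GrMod 𝒯} (hN : conc 𝒯 d N) (Z : GrMod 𝒯) :
    (N ⟶ Z) ≃ (N ⟶ comp h d Z) where
  toFun f := f ≫ compπ h d Z
  invFun g := g ≫ compι h d Z
  left_inv f := hom_ext fun n => proj_self _ (conc_hom_mem hN f n)
  right_inv g := (Category.assoc _ _ _).trans (by rw [compι_compπ, Category.comp_id])

/-- Morphisms to a module concentrated in degree `d`. -/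
noncomputable def fromCompEquiv {d : ℤ} {N : GrMod 𝒯} (hN : conc 𝒯 d N) (Z : GrMod 𝒯) :
    (Z ⟶ N) ≃ (comp h d Z ⟶ N) where
  toFun f := compι h d Z ≫ f
  invFun g := compπ h d Z ≫ g
  left_inv f := hom_ext fun n => by
    have h1 : toLin f (proj Z.isInternal d n) = proj N.isInternal d (toLin f n) := toLin_proj f d n
    rw [proj_self _ (conc_mem_gr hN _)] at h1
    exact h1
  right_inv g := (Category.assoc _ _ _).symm.trans (by rw [compι_compπ, Category.id_comp])

end Component
end GrMod

/-! ### Borel subalgebras and the passage to the opposite algebra -/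

/-- A graded algebra `A` with Borel subalgebras `B` (in degrees `≥ 0`) and `C` (in degrees `≤ 0`)
with common degree zero part `T`, such that `A` is free as a right `B`-module, with basis in `C`,
and free as a left `C`-module, with basis in `B`. -/
structure BorelData {K : Type u} [Field K] {A B C T : Type u} [Ring A] [Ring B] [Ring C] [Ring T]
    [Algebra K A] [Algebra K B] [Algebra K C] [Algebra K T] (𝒜 : ℤ → Submodule K A)
    (ℬ : ℤ → Submodule K B) (𝒞 : ℤ → Submodule K C) (𝒯 : ℤ → Submodule K T) where
  gradingA : IsGrading 𝒜
  gradingB : IsGrading ℬ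
  gradingC : IsGrading 𝒞
  gradingT : IsGrading 𝒯
  ιB : B →ₐ[K] A
  ιC : C →ₐ[K] A
  j : T →ₐ[K] A
  jB : T →ₐ[K] B
  jC : T →ₐ[K] C
  pB : B →ₐ[K] T
  pC : C →ₐ[K] T
  ιB_mem : ∀ i, ∀ b ∈ ℬ i, ιB b ∈ 𝒜 i
  ιC_mem : ∀ i, ∀ c ∈ 𝒞 i, ιC c ∈ 𝒜 i
  j_mem : ∀ i, ∀ t ∈ 𝒯 i, j t ∈ 𝒜 i
  pB_mem : ∀ i, ∀ b ∈ ℬ i, pB b ∈ 𝒯 i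
  pC_mem : ∀ i, ∀ c ∈ 𝒞 i, pC c ∈ 𝒯 i
  ιB_jB : ∀ t, ιB (jB t) = j t
  ιC_jC : ∀ t, ιC (jC t) = j t
  pB_jB : ∀ t, pB (jB t) = t
  pC_jC : ∀ t, pC (jC t) = t
  T_deg : ∀ i, i ≠ 0 → 𝒯 i = ⊥
  B_deg : ∀ i, i < 0 → ℬ i = ⊥
  C_deg : ∀ i, 0 < i → 𝒞 i = ⊥
  B_zero : ∀ b ∈ ℬ 0, jB (pB b) = b
  C_zero : ∀ c ∈ 𝒞 0, jC (pC c) = c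
  -- The bases are recorded as bare vector spaces with maps to `C` and `B`, which keeps the
  -- structure symmetric under opposites. In the application they are A⁻ and A⁺.
  X : Type u
  Y : Type u
  [addCommGroupX : AddCommGroup X]
  [moduleX : Module K X]
  [addCommGroupY : AddCommGroup Y]
  [moduleY : Module K Y]
  x : X →ₗ[K] C
  y : Y →ₗ[K] B
  x_one : ∃ x₁, x x₁ = 1
  y_one : ∃ y₁, y y₁ = 1
  bijective_left : Function.Bijective (LinearMap.mul' K A ∘ₗ
    TensorProduct.map (ιC.toLinearMap ∘ₗ x) ιB.toLinearMap : X ⊗[K] B →ₗ[K] A)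
  bijective_right : Function.Bijective (LinearMap.mul' K A ∘ₗ
    TensorProduct.map ιC.toLinearMap (ιB.toLinearMap ∘ₗ y) : C ⊗[K] Y →ₗ[K] A)

namespace BorelData
attribute [instance] addCommGroupX moduleX addCommGroupY moduleY

variable {K : Type u} [Field K] {A B C T : Type u} [Ring A] [Ring B] [Ring C] [Ring T]
    [Algebra K A] [Algebra K B] [Algebra K C] [Algebra K T] {𝒜 : ℤ → Submodule K A}
    {ℬ : ℤ → Submodule K B} {𝒞 : ℤ → Submodule K C} {𝒯 : ℤ → Submodule K T}

open MulOpposite in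
/-- The Borel subalgebras of the opposite algebra. -/
def op (S : BorelData 𝒜 ℬ 𝒞 𝒯) :
    BorelData (opGrading 𝒜) (opGrading 𝒞) (opGrading ℬ) (opGrading 𝒯) where
  gradingA := S.gradingA.op
  gradingB := S.gradingC.op
  gradingC := S.gradingB.op
  gradingT := S.gradingT.op
  ιB := AlgHom.op S.ιC
  ιC := AlgHom.op S.ιB
  j := AlgHom.op S.j
  jB := AlgHom.op S.jC
  jC := AlgHom.op S.jB
  pB := AlgHom.op S.pC
  pC := AlgHom.op S.pB
  ιB_mem i c hc := S.ιC_mem (-i) c.unop hc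
  ιC_mem i c hc := S.ιB_mem (-i) c.unop hc
  j_mem i c hc := S.j_mem (-i) c.unop hc
  pB_mem i c hc := S.pC_mem (-i) c.unop hc
  pC_mem i c hc := S.pB_mem (-i) c.unop hc
  ιB_jB t := congrArg MulOpposite.op (S.ιC_jC t.unop)
  ιC_jC t := congrArg MulOpposite.op (S.ιB_jB t.unop)
  pB_jB t := congrArg MulOpposite.op (S.pC_jC t.unop)
  pC_jC t := congrArg MulOpposite.op (S.pB_jB t.unop)
  T_deg i hi := by
    rw [opGrading, S.T_deg (-i) (by omega)]
    exact LinearMap.ker_eq_bot.2 (opLinearEquiv K).symm.injective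
  B_deg i hi := by
    rw [opGrading, S.C_deg (-i) (by omega)]
    exact LinearMap.ker_eq_bot.2 (opLinearEquiv K).symm.injective
  C_deg i hi := by
    rw [opGrading, S.B_deg (-i) (by omega)]
    exact LinearMap.ker_eq_bot.2 (opLinearEquiv K).symm.injective
  B_zero c hc := congrArg MulOpposite.op (S.C_zero c.unop (by simpa [opGrading] using hc))
  C_zero c hc := congrArg MulOpposite.op (S.B_zero c.unop (by simpa [opGrading] using hc))
  X := S.Y
  Y := S.X
  x := (opLinearEquiv K).toLinearMap ∘ₗ S.y
  y := (opLinearEquiv K).toLinearMap ∘ₗ S.x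
  x_one := by
    obtain ⟨y₁, h⟩ := S.y_one
    exact ⟨y₁, congrArg MulOpposite.op h⟩
  y_one := by
    obtain ⟨x₁, h⟩ := S.x_one
    exact ⟨x₁, congrArg MulOpposite.op h⟩
  bijective_left := by
    -- Reversing products and flipping tensor factors turns freeness over one Borel subalgebra, on
    -- one side, into freeness over the other on the other side.
    let e := (TensorProduct.congr (LinearEquiv.refl K S.Y) (opLinearEquiv K (M := C)).symm).trans
      (TensorProduct.comm K S.Y C)
    have h : ∀ w, (LinearMap.mul' K Aᵐᵒᵖ ∘ₗ TensorProduct.map ((AlgHom.op S.ιB).toLinearMap ∘ₗ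
        (opLinearEquiv K).toLinearMap ∘ₗ S.y) (AlgHom.op S.ιC).toLinearMap) w =
        opLinearEquiv K ((LinearMap.mul' K A ∘ₗ
          TensorProduct.map S.ιC.toLinearMap (S.ιB.toLinearMap ∘ₗ S.y)) (e w)) := by
      intro w
      induction w using TensorProduct.induction_on with
      | zero => simp only [map_zero]
      | add x y hx hy => simp only [map_add, hx, hy]
      | tmul x y => rfl
    exact (funext h : _ = (opLinearEquiv K) ∘ _ ∘ e) ▸
      (opLinearEquiv K).bijective.comp (S.bijective_right.comp e.bijective)
  bijective_right := by
    let e := (TensorProduct.congr (opLinearEquiv K (M := B)).symm (LinearEquiv.refl K S.X)).trans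
      (TensorProduct.comm K B S.X)
    have h : ∀ w, (LinearMap.mul' K Aᵐᵒᵖ ∘ₗ TensorProduct.map (AlgHom.op S.ιB).toLinearMap
        ((AlgHom.op S.ιC).toLinearMap ∘ₗ (opLinearEquiv K).toLinearMap ∘ₗ S.x)) w =
        opLinearEquiv K ((LinearMap.mul' K A ∘ₗ
          TensorProduct.map (S.ιC.toLinearMap ∘ₗ S.x) S.ιB.toLinearMap) (e w)) := by
      intro w
      induction w using TensorProduct.induction_on with
      | zero => simp only [map_zero]
      | add x y hx hy => simp only [map_add, hx, hy]
      | tmul x y => rfl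
    exact (funext h : _ = (opLinearEquiv K) ∘ _ ∘ e) ▸
      (opLinearEquiv K).bijective.comp (S.bijective_left.comp e.bijective)

end BorelData
end GradedAlg

/-! ### Proper standard modules and their adjunction with the top component -/

namespace GradedAlg
open GrMod
namespace BorelData
variable {K : Type u} [Field K] {A B C T : Type u} [Ring A] [Ring B] [Ring C] [Ring T]
    [Algebra K A] [Algebra K B] [Algebra K C] [Algebra K T] {𝒜 : ℤ → Submodule K A}
    {ℬ : ℤ → Submodule K B} {𝒞 : ℤ → Submodule K C} {𝒯 : ℤ → Submodule K T}
    [FiniteDimensional K A] [FiniteDimensional K B] [FiniteDimensional K C]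
    [FiniteDimensional K T]

section Standard

theorem mem_zero (S : BorelData 𝒜 ℬ 𝒞 𝒯) (t : T) : t ∈ 𝒯 0 :=
  mem_zero_of_concentrated S.gradingT.isInternal S.T_deg t

variable (S : BorelData 𝒜 ℬ 𝒞 𝒯)

/-- The proper standard module. -/
abbrev std (N : GrMod 𝒯) : GrMod 𝒜 :=
  (N.restrict S.pB S.pB_mem).induce S.ιB S.gradingA S.gradingB S.ιB_mem

/-- The functor of proper standard modules. -/
abbrev stdF : GrMod 𝒯 ⥤ GrMod 𝒜 :=
  res S.pB S.pB_mem ⋙ ind S.ιB S.gradingA S.gradingB S.ιB_mem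

/-- The restriction of an `A`-module to `T`. -/
abbrev resT (M : GrMod 𝒜) : GrMod 𝒯 := M.restrict S.j S.j_mem

instance : PreservesFiniteLimits S.stdF :=
  have := ind_exact S.ιB S.gradingA S.gradingB S.ιB_mem (S.ιC.toLinearMap ∘ₗ S.x)
    S.bijective_left
  inferInstance

instance : PreservesFiniteColimits S.stdF :=
  have := (indAdj S.ιB S.gradingA S.gradingB S.ιB_mem).leftAdjoint_preservesColimits
  inferInstance

/-- The elements `a ⊗ n` of a proper standard module. -/
def stmul {N : GrMod 𝒯} (a : A) (n : N) : S.std N :=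
  itmul S.ιB S.gradingA S.gradingB S.ιB_mem a ((ofRes S.pB S.pB_mem N).symm n)

variable {N N' : GrMod 𝒯} {M M' : GrMod 𝒜}

theorem smul_stmul (b a : A) (n : N) : b • S.stmul a n = S.stmul (b * a) n := rfl

theorem stmul_eq_smul (a : A) (n : N) : S.stmul a n = a • S.stmul 1 n := by
  rw [smul_stmul, mul_one]

theorem stmul_add (a : A) (n n' : N) : S.stmul a (n + n') = S.stmul a n + S.stmul a n' := by
  rw [stmul, map_add, itmul_add]
  rfl

theorem stmul_smulK (a : A) (c : K) (n : N) : S.stmul a (c • n) = c • S.stmul a n := by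
  rw [stmul, map_smul, itmul_smulK]
  rfl

theorem stmul_zero (a : A) : S.stmul a (0 : N) = 0 := by
  simpa using S.stmul_smulK a 0 (0 : N)

theorem add_stmul (a a' : A) (n : N) : S.stmul (a + a') n = S.stmul a n + S.stmul a' n := by
  rw [stmul_eq_smul, add_smul, ← stmul_eq_smul, ← stmul_eq_smul]

theorem stmul_ιB (a : A) (b : B) (n : N) : S.stmul (a * S.ιB b) n = S.stmul a (S.pB b • n) :=
  itmul_mul S.ιB S.gradingA S.gradingB S.ιB_mem a b ((ofRes S.pB S.pB_mem N).symm n)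

theorem stmul_j (a : A) (t : T) (n : N) : S.stmul (a * S.j t) n = S.stmul a (t • n) := by
  rw [← S.ιB_jB, stmul_ιB, S.pB_jB]

theorem stmul_mem {i k l : ℤ} (h : i + k = l) {a : A} {n : N} (ha : a ∈ 𝒜 i) (hn : n ∈ N.gr k) :
    S.stmul a n ∈ (S.std N).gr l :=
  itmul_mem S.ιB S.gradingA S.gradingB S.ιB_mem h ha hn

theorem std_hom_ext {f g : S.std N ⟶ M}
    (h : ∀ n : N, toLin f (S.stmul 1 n) = toLin g (S.stmul 1 n)) : f = g :=
  induce_hom_ext S.ιB S.gradingA S.gradingB S.ιB_mem fun m => h (ofRes S.pB S.pB_mem N m)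

theorem stdF_map_stmul (f : N ⟶ N') (a : A) (n : N) :
    toLin (S.stdF.map f) (S.stmul a n) = S.stmul a (toLin f n) :=
  induceMap_itmul S.ιB S.gradingA S.gradingB S.ιB_mem _ a _

theorem std_induction {p : S.std N → Prop} (x : S.std N) (h0 : p 0)
    (ht : ∀ c n, p (S.stmul (S.ιC c) n)) (ha : ∀ x y, p x → p y → p (x + y)) : p x := by
  obtain ⟨w, rfl⟩ := freeMap_surjective S.ιB S.gradingA S.gradingB S.ιB_mem
    (S.ιC.toLinearMap ∘ₗ S.x) S.bijective_left.2 _ x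
  induction w using TensorProduct.induction_on with
  | zero => rw [map_zero]; exact h0
  | add x y hx hy => rw [map_add]; exact ha _ _ hx hy
  | tmul x n => exact ht (S.x x) (ofRes S.pB S.pB_mem N n)

/-- The part of `b` of positive degree moves `m` above degree `d`, where `M` vanishes, and the
degree zero part lies in T. So B acts on the top component through its projection to T, and a
T-linear map into it extends to the proper standard module. -/
theorem smul_of_upTo {d : ℤ} (hM : upTo 𝒜 d M) {m : M} (hm : m ∈ M.gr d) (b : B) :
    S.ιB b • m = S.j (S.pB b) • m := by
  refine ext_of_isInternal S.gradingB.isInternal (f := fun b => S.ιB b • m)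
    (g := fun b => S.j (S.pB b) • m) (fun x y => by rw [map_add, add_smul])
    (fun x y => by rw [map_add, map_add, add_smul]) (fun i b hb => ?_) b
  rcases lt_trichotomy i 0 with h | h | h
  · rw [S.B_deg i h, Submodule.mem_bot] at hb
    rw [hb, map_zero, map_zero, map_zero]
  · subst h
    rw [← S.ιB_jB, S.B_zero b hb]
  · have h1 := S.pB_mem i b hb
    rw [S.T_deg i h.ne', Submodule.mem_bot] at h1
    have h2 := M.smul_mem (S.ιB_mem i b hb) hm
    rw [hM (i + d) (by simpa using h), Submodule.mem_bot] at h2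
    rw [h1, h2, map_zero, zero_smul]

/-- Morphisms from a proper standard module to a module bounded by its highest degree. -/
def stdEquiv {d : ℤ} (hN : conc 𝒯 d N) (hM : upTo 𝒜 d M) : (S.std N ⟶ M) ≃ (N ⟶ S.resT M) where
  toFun f := ofK (N := S.resT M)
    { toFun := fun n => (ofRes S.j S.j_mem M).symm (toLin f (S.stmul 1 n))
      map_add' := fun n n' => by rw [stmul_add, map_add, map_add]
      map_smul' := fun c n => by
        rw [stmul_smulK, toLin_smulK, map_smul]
        rfl }
    (fun t n => by
      refine (ofRes S.j S.j_mem M).injective ?_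
      change toLin f (S.stmul 1 (t • n)) = S.j t • toLin f (S.stmul 1 n)
      rw [← map_smul, smul_stmul, ← S.stmul_j, mul_one, one_mul])
    (fun i n hn => toLin_mem f (S.stmul_mem (zero_add i) S.gradingA.one_mem hn))
  invFun g := induceLift S.ιB S.gradingA S.gradingB S.ιB_mem
    (ofK (M := N.restrict S.pB S.pB_mem) (N := M.restrict S.ιB S.ιB_mem)
      ((ofRes S.ιB S.ιB_mem M).symm.toLinearMap ∘ₗ (ofRes S.j S.j_mem M).toLinearMap ∘ₗ
        (toLin g).restrictScalars K ∘ₗ (ofRes S.pB S.pB_mem N).toLinearMap)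
      (fun b n => by
        refine (ofRes S.ιB S.ιB_mem M).injective ?_
        change ofRes S.j S.j_mem M (toLin g (S.pB b • ofRes S.pB S.pB_mem N n)) =
          S.ιB b • ofRes S.j S.j_mem M (toLin g (ofRes S.pB S.pB_mem N n))
        rw [map_smul (toLin g), ofRes_smul, S.smul_of_upTo hM
          (m := ofRes S.j S.j_mem M (toLin g (ofRes S.pB S.pB_mem N n))) (conc_hom_mem hN g _)])
      (fun i n hn => toLin_mem g hn))
  left_inv f := S.std_hom_ext fun n => one_smul A (toLin f (S.stmul 1 n))
  right_inv g := hom_ext fun n => (ofRes S.j S.j_mem M).injective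
    (one_smul A (ofRes S.j S.j_mem M (toLin g n)))

/-- The module is spanned by the products c ⊗ n with c in C, which has no positive degrees, and n in
degree `d`. -/
theorem std_upTo {d : ℤ} (hN : conc 𝒯 d N) : upTo 𝒜 d (S.std N) := by
  intro i hi
  have hi' : d < i := by simpa using hi
  have key : ∀ x : S.std N, proj (S.std N).isInternal i x = 0 := by
    intro x
    refine S.std_induction (p := fun x => proj (S.std N).isInternal i x = 0) x (map_zero _) (fun c n => ?_)
      (fun x y hx hy => by rw [map_add, hx, hy, add_zero])
    refine ext_of_isInternal S.gradingC.isInternal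
      (f := fun c => proj (S.std N).isInternal i (S.stmul (S.ιC c) n)) (g := fun _ => 0)
      (fun x y => by rw [map_add, add_stmul, map_add]) (by simp) (fun k c hc => ?_) c
    by_cases hk : 0 < k
    · rw [S.C_deg k hk, Submodule.mem_bot] at hc
      rw [hc, map_zero, stmul_eq_smul, zero_smul, map_zero]
    · exact proj_of_ne _ (by omega) (S.stmul_mem rfl (S.ιC_mem k c hc) (conc_mem_gr hN n))
  refine (Submodule.eq_bot_iff _).2 fun x hx => ?_
  rw [← proj_self (S.std N).isInternal hx, key]

theorem stmul_one_injective : Function.Injective (fun n : N => S.stmul 1 n) := by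
  intro n n' h
  obtain ⟨x₁, hx⟩ := S.x_one
  have h1 : ∀ n, freeMap S.ιB S.gradingA S.gradingB S.ιB_mem (S.ιC.toLinearMap ∘ₗ S.x) _
      (x₁ ⊗ₜ (ofRes S.pB S.pB_mem N).symm n) = S.stmul 1 n := by
    intro n
    rw [freeMap_tmul, LinearMap.comp_apply, hx, AlgHom.toLinearMap_apply, map_one]
    rfl
  have h2 := freeMap_injective S.ιB S.gradingA S.gradingB S.ιB_mem (S.ιC.toLinearMap ∘ₗ S.x)
    S.bijective_left _ ((h1 n).trans (h.trans (h1 n').symm))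
  -- By freeness the elements 1 ⊗ n correspond to x₁ ⊗ n, and a linear form with value 1 on `x₁`
  -- recovers n. If `x₁ = 0`, then 1 = 0 in T and N is zero.
  by_cases h0 : x₁ = 0
  · have h3 : (1 : T) = 0 := by
      rw [← map_one S.pC, ← hx, h0, map_zero, map_zero]
    rw [← one_smul T n, ← one_smul T n', h3, zero_smul, zero_smul]
  · obtain ⟨φ, hφ⟩ := Module.Projective.exists_dual_eq_one K h0
    have h4 := congrArg (TensorProduct.lid K (N.restrict S.pB S.pB_mem) ∘
      LinearMap.rTensor (N.restrict S.pB S.pB_mem) φ) h2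
    simp only [Function.comp_apply, LinearMap.rTensor_tmul, TensorProduct.lid_tmul, hφ,
      one_smul] at h4
    exact (ofRes S.pB S.pB_mem N).symm.injective h4

/-- Only the degree zero part of `c` contributes to degree `d`, and in degree zero C is T, which
moves across the tensor sign. So the top component of the proper standard module is 1 ⊗ N. -/
theorem proj_stmul {d : ℤ} (hN : conc 𝒯 d N) (c : C) (n : N) :
    proj (S.std N).isInternal d (S.stmul (S.ιC c) n) = S.stmul 1 (S.pC c • n) := by
  refine ext_of_isInternal S.gradingC.isInternal
    (f := fun c => proj (S.std N).isInternal d (S.stmul (S.ιC c) n))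
    (g := fun c => S.stmul 1 (S.pC c • n))
    (fun x y => by rw [map_add, add_stmul, map_add])
    (fun x y => by rw [map_add, add_smul, stmul_add]) (fun k c hc => ?_) c
  have hmem := S.stmul_mem rfl (S.ιC_mem k c hc) (conc_mem_gr hN n)
  by_cases hk : k = 0
  · subst hk
    rw [zero_add] at hmem
    rw [proj_self _ hmem, ← S.stmul_j, one_mul, ← S.ιC_jC, S.C_zero c hc]
  · have h1 := S.pC_mem k c hc
    rw [S.T_deg k hk, Submodule.mem_bot] at h1
    rw [proj_of_ne _ (by omega) hmem, h1, zero_smul, stmul_zero]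

/-- The functor taking the component of degree `d`, as a `T`-module. -/
noncomputable abbrev topF (d : ℤ) : GrMod 𝒜 ⥤ GrMod 𝒯 :=
  res S.j S.j_mem ⋙ compF S.mem_zero d

/-- The adjunction bijection for proper standard modules. -/
noncomputable def stdTopEquiv {d : ℤ} (hN : conc 𝒯 d N) (hM : upTo 𝒜 d M) :
    (S.std N ⟶ M) ≃ (N ⟶ (S.topF d).obj M) :=
  (S.stdEquiv hN hM).trans (toCompEquiv S.mem_zero hN _)

theorem topF_map_apply {d : ℤ} (f : M ⟶ M') (m : (S.topF d).obj M) :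
    ofRes S.j S.j_mem M' (toLin (compι S.mem_zero d (S.resT M')) (toLin ((S.topF d).map f) m)) =
      toLin f (ofRes S.j S.j_mem M (toLin (compι S.mem_zero d (S.resT M)) m)) :=
  congrArg (ofRes S.j S.j_mem M') (compF_map_apply S.mem_zero ((res S.j S.j_mem).map f) d m)

theorem stdTopEquiv_apply {d : ℤ} (hN : conc 𝒯 d N) (hM : upTo 𝒜 d M) (f : S.std N ⟶ M) (n : N) :
    ofRes S.j S.j_mem M (toLin (compι S.mem_zero d (S.resT M)) (toLin (S.stdTopEquiv hN hM f) n)) =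
      toLin f (S.stmul 1 n) :=
  proj_self _ (conc_hom_mem hN (S.stdEquiv hN hM f) n)

theorem stdTopEquiv_naturality {d : ℤ} (hN : conc 𝒯 d N) (hM : upTo 𝒜 d M) (hM' : upTo 𝒜 d M')
    (f : S.std N ⟶ M) (g : M ⟶ M') :
    S.stdTopEquiv hN hM' (f ≫ g) = S.stdTopEquiv hN hM f ≫ (S.topF d).map g := by
  refine hom_ext fun n => compι_injective S.mem_zero d _ ((ofRes S.j S.j_mem M').injective ?_)
  rw [stdTopEquiv_apply, GrMod.comp_apply, GrMod.comp_apply, topF_map_apply, stdTopEquiv_apply]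

theorem stdTopEquiv_naturality_left {d : ℤ} (hN : conc 𝒯 d N) (hN' : conc 𝒯 d N')
    (hM : upTo 𝒜 d M) (f : N ⟶ N') (g : S.std N' ⟶ M) :
    S.stdTopEquiv hN hM (S.stdF.map f ≫ g) = f ≫ S.stdTopEquiv hN' hM g := by
  refine hom_ext fun n => compι_injective S.mem_zero d _ ((ofRes S.j S.j_mem M).injective ?_)
  rw [stdTopEquiv_apply, GrMod.comp_apply, GrMod.comp_apply, stdTopEquiv_apply, stdF_map_stmul]

/-- The embedding of a module concentrated in degree `d` as the top of its proper standard module. -/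
noncomputable def topUnit {d : ℤ} (hN : conc 𝒯 d N) : N ⟶ (S.topF d).obj (S.std N) :=
  S.stdTopEquiv hN (S.std_upTo hN) (𝟙 _)

theorem topUnit_apply {d : ℤ} (hN : conc 𝒯 d N) (n : N) :
    ofRes S.j S.j_mem (S.std N) (toLin (compι S.mem_zero d (S.resT (S.std N)))
      (toLin (S.topUnit hN) n)) = S.stmul 1 n :=
  S.stdTopEquiv_apply hN _ _ n

/-- This map becomes the unit of the standardization adjunction, so its invertibility says that
standardization is fully faithful. -/
theorem isIso_topUnit {d : ℤ} (hN : conc 𝒯 d N) : IsIso (S.topUnit hN) := by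
  refine isIso_of_bijective _ ⟨fun n n' h => S.stmul_one_injective ?_, fun z => ?_⟩
  · change S.stmul 1 n = S.stmul 1 n'
    rw [← S.topUnit_apply hN, h, S.topUnit_apply hN]
  · have key : ∀ x : S.std N, ∃ n : N, S.stmul 1 n = proj (S.std N).isInternal d x := by
      intro x
      refine S.std_induction (p := fun x => ∃ n : N, S.stmul 1 n = proj (S.std N).isInternal d x) x
        ⟨0, by rw [stmul_zero, map_zero]⟩ (fun c n => ⟨_, (S.proj_stmul hN c n).symm⟩) ?_
      rintro x y ⟨n, hn⟩ ⟨n', hn'⟩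
      exact ⟨n + n', by rw [stmul_add, map_add, hn, hn']⟩
    obtain ⟨n, hn⟩ := key (ofRes S.j S.j_mem (S.std N) (toLin (compι S.mem_zero d _) z))
    refine ⟨n, compι_injective S.mem_zero d _ ((ofRes S.j S.j_mem (S.std N)).injective ?_)⟩
    rw [S.topUnit_apply hN, hn, proj_self]
    exact compι_mem S.mem_zero z

end Standard
end BorelData
end GradedAlg

/-! ### Proper costandard modules, by duality -/

namespace GradedAlg
open GrMod
namespace BorelData
variable {K : Type u} [Field K] {A B C T : Type u} [Ring A] [Ring B] [Ring C] [Ring T]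
    [Algebra K A] [Algebra K B] [Algebra K C] [Algebra K T] {𝒜 : ℤ → Submodule K A}
    {ℬ : ℤ → Submodule K B} {𝒞 : ℤ → Submodule K C} {𝒯 : ℤ → Submodule K T}
    [FiniteDimensional K A] [FiniteDimensional K B] [FiniteDimensional K C]
    [FiniteDimensional K T] (S : BorelData 𝒜 ℬ 𝒞 𝒯)

section Costandard

/-- The proper costandard module. -/
abbrev costd (N : GrMod 𝒯) : GrMod 𝒜 := (S.op.std N.dual).undual

/-- The functor of proper costandard modules. -/
abbrev costdF : GrMod 𝒯 ⥤ GrMod 𝒜 := (dualF 𝒯).rightOp ⋙ S.op.stdF.op ⋙ undualF 𝒜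

instance : PreservesFiniteLimits S.costdF :=
  have := preservesFiniteLimits_op S.op.stdF
  have : (dualF 𝒯).rightOp.IsEquivalence := (dualEquivalence 𝒯).rightOp.isEquivalence_functor
  inferInstance

instance : PreservesFiniteColimits S.costdF :=
  have := preservesFiniteColimits_op S.op.stdF
  have : (dualF 𝒯).rightOp.IsEquivalence := (dualEquivalence 𝒯).rightOp.isEquivalence_functor
  inferInstance

variable {N N' : GrMod 𝒯} {M M' : GrMod 𝒜}

theorem dual_support {R : Type u} [Ring R] [Algebra K R] [FiniteDimensional K R]
    {ℛ : ℤ → Submodule K R} {I : Set ℤ} {M : GrMod ℛ} (h : support ℛ I M) :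
    support (opGrading ℛ) I M.dual :=
  fun i hi => dual_gr_eq_bot_iff.2 (h i hi)

theorem undual_support {R : Type u} [Ring R] [Algebra K R] [FiniteDimensional K R]
    {ℛ : ℤ → Submodule K R} {I : Set ℤ} {X : GrMod (opGrading ℛ)}
    (h : support (opGrading ℛ) I X) : support ℛ I X.undual :=
  fun i hi => undual_gr_eq_bot_iff.2 (h i hi)

theorem costd_upTo {d : ℤ} (hN : conc 𝒯 d N) : upTo 𝒜 d (S.costd N) :=
  undual_support (S.op.std_upTo (dual_support hN))

/-- By transposition, a morphism into a proper costandard module is a morphism out of a proper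
standard module over the opposite algebra, which is generated by the elements 1 ⊗ φ. -/
theorem costd_hom_ext {f g : M ⟶ S.costd N}
    (h : ∀ m φ, (S.op.std N.dual).toUndual (toLin f m) (S.op.stmul 1 φ) =
      (S.op.std N.dual).toUndual (toLin g m) (S.op.stmul 1 φ)) : f = g := by
  refine (dualEquiv (S.op.std N.dual) M).symm.injective (S.op.std_hom_ext fun φ => ?_)
  exact M.toDual.injective (LinearMap.ext fun m => h m φ)

/-- The transpose as a bijection on morphisms. -/
noncomputable def dualHomEquiv {R : Type u} [Ring R] [Algebra K R] [FiniteDimensional K R]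
    {ℛ : ℤ → Submodule K R} (M N : GrMod ℛ) : (M ⟶ N) ≃ (N.dual ⟶ M.dual) :=
  ((evalIso N).homToEquiv).trans (dualEquiv N.dual M).symm

/-- Morphisms to a proper costandard module from a module bounded by its highest degree. -/
noncomputable def costdEquiv {d : ℤ} (hN : conc 𝒯 d N) (hM : upTo 𝒜 d M) :
    (S.resT M ⟶ N) ≃ (M ⟶ S.costd N) :=
  (dualHomEquiv (S.resT M) N).trans <|
    ((dualRestrictIso S.j S.j_mem S.op.j_mem M).homToEquiv).trans <|
      (S.op.stdEquiv (dual_support hN) (dual_support hM)).symm.trans (dualEquiv _ M)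

/-- Together with `costd_hom_ext`, this pairing formula characterizes the chain of transposes, so
naturality can be checked without unfolding it. -/
theorem costdEquiv_apply {d : ℤ} (hN : conc 𝒯 d N) (hM : upTo 𝒜 d M) (g : S.resT M ⟶ N) (m : M)
    (φ : N.dual) : (S.op.std N.dual).toUndual (toLin (S.costdEquiv hN hM g) m) (S.op.stmul 1 φ) =
      N.toDual φ (toLin g ((ofRes S.j S.j_mem M).symm m)) :=
  LinearMap.congr_fun (congrArg M.toDual (one_smul Aᵐᵒᵖ (ofRes S.op.j S.op.j_mem M.dual
    (toLin (dualHomEquiv (S.resT M) N g ≫ (dualRestrictIso S.j S.j_mem S.op.j_mem M).hom) φ)))) m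

/-- The adjunction bijection for proper costandard modules. -/
noncomputable def costdTopEquiv {d : ℤ} (hN : conc 𝒯 d N) (hM : upTo 𝒜 d M) :
    ((S.topF d).obj M ⟶ N) ≃ (M ⟶ S.costd N) :=
  (fromCompEquiv S.mem_zero hN (S.resT M)).symm.trans (S.costdEquiv hN hM)

theorem costdTopEquiv_apply {d : ℤ} (hN : conc 𝒯 d N) (hM : upTo 𝒜 d M)
    (g : (S.topF d).obj M ⟶ N) (m : M) (φ : N.dual) :
    (S.op.std N.dual).toUndual (toLin (S.costdTopEquiv hN hM g) m) (S.op.stmul 1 φ) =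
      N.toDual φ (toLin g (toLin (compπ S.mem_zero d (S.resT M))
        ((ofRes S.j S.j_mem M).symm m))) :=
  S.costdEquiv_apply hN hM _ m φ

theorem costdTopEquiv_naturality_left {d : ℤ} (hN : conc 𝒯 d N) (hM : upTo 𝒜 d M)
    (hM' : upTo 𝒜 d M') (f : M ⟶ M') (g : (S.topF d).obj M' ⟶ N) :
    S.costdTopEquiv hN hM ((S.topF d).map f ≫ g) = f ≫ S.costdTopEquiv hN hM' g := by
  refine S.costd_hom_ext fun m φ => ?_
  rw [costdTopEquiv_apply, GrMod.comp_apply, GrMod.comp_apply, costdTopEquiv_apply]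
  congr 2
  refine compι_injective S.mem_zero d _ ((ofRes S.j S.j_mem M').injective ?_)
  rw [topF_map_apply]
  exact toLin_proj f d m

theorem costdTopEquiv_naturality_right {d : ℤ} (hN : conc 𝒯 d N) (hN' : conc 𝒯 d N')
    (hM : upTo 𝒜 d M) (g : (S.topF d).obj M ⟶ N) (f : N ⟶ N') :
    S.costdTopEquiv hN' hM (g ≫ f) = S.costdTopEquiv hN hM g ≫ S.costdF.map f := by
  refine S.costd_hom_ext fun m φ => ?_
  rw [costdTopEquiv_apply, GrMod.comp_apply, GrMod.comp_apply]
  change _ = (S.op.std N.dual).toUndual (toLin (S.costdTopEquiv hN hM g) m)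
    (toLin (S.op.stdF.map (dualMap f)) (S.op.stmul 1 φ))
  rw [stdF_map_stmul, costdTopEquiv_apply, dualMap_apply]

end Costandard
end BorelData
end GradedAlg

/-! ### Models of Serre quotients, and exactness in Serre subcategories -/

namespace StdStrat

section Localization
variable {C D : Type*} [Category* C] [Abelian C] [Category* D] [Abelian D]
  {F G : D ⥤ C} {E : C ⥤ D} (P : ObjectProperty C) [P.IsSerreClass]

/-- An exact functor with a fully faithful left adjoint is a Serre quotient functor. -/
theorem isLocalization_of_leftAdjoint (adj : F ⊣ E) [F.Full] [F.Faithful] [PreservesFiniteLimits E]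
    [PreservesFiniteColimits E] (hP : P = E.kernel) : E.IsLocalization P.isoModSerre := by
  subst hP
  -- For exact `E`, the morphisms with kernel and cokernel in its kernel are those it inverts, and a
  -- functor with a fully faithful left adjoint is the localization at the morphisms it inverts.
  rw [Abelian.isoModSerre_kernel_eq_inverseImage_isomorphisms E]
  exact adj.isLocalization'

variable [E.IsLocalization P.isoModSerre]

/-- A left adjoint of a model of the quotient functor yields a left adjoint of the quotient
functor. -/
theorem exists_leftAdjoint (adj : F ⊣ E) [PreservesFiniteLimits F] [PreservesFiniteColimits F] :
    ∃ F' : P.isoModSerre.Localization ⥤ C, Nonempty (F' ⊣ P.isoModSerre.Q) ∧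
      PreservesFiniteLimits F' ∧ PreservesFiniteColimits F' ∧
      ∀ (X : C) (Y : D) (p : Y ⟶ E.obj X), IsProjectiveCover p →
        ∃ (Y' : P.isoModSerre.Localization) (p' : Y' ⟶ P.isoModSerre.Q.obj X),
          IsProjectiveCover p' ∧ Nonempty (F.obj Y ≅ F'.obj Y') := by
  let e := Localization.equivalenceFromModel E P.isoModSerre
  let i := Localization.compEquivalenceFromModelInverseIso E P.isoModSerre
  refine ⟨e.functor ⋙ F, ⟨(e.toAdjunction.comp adj).ofNatIsoRight i⟩, inferInstance, inferInstance,
    fun X Y p hp => ⟨e.inverse.obj Y, e.inverse.map p ≫ (i.app X).hom, (hp.map e.inverse).comp_iso _,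
      ⟨F.mapIso (e.counitIso.app Y).symm⟩⟩⟩

/-- A right adjoint of a model of the quotient functor yields a right adjoint of the quotient
functor. -/
theorem exists_rightAdjoint (adj : E ⊣ G) [PreservesFiniteLimits G] [PreservesFiniteColimits G] :
    ∃ G' : P.isoModSerre.Localization ⥤ C, Nonempty (P.isoModSerre.Q ⊣ G') ∧
      PreservesFiniteLimits G' ∧ PreservesFiniteColimits G' ∧
      ∀ (X : C) (Y : D) (p : E.obj X ⟶ Y), IsInjectiveHull p →
        ∃ (Y' : P.isoModSerre.Localization) (p' : P.isoModSerre.Q.obj X ⟶ Y'),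
          IsInjectiveHull p' ∧ Nonempty (G.obj Y ≅ G'.obj Y') := by
  let e := Localization.equivalenceFromModel E P.isoModSerre
  let i := Localization.compEquivalenceFromModelInverseIso E P.isoModSerre
  refine ⟨e.functor ⋙ G, ⟨(adj.comp e.symm.toAdjunction).ofNatIsoLeft i⟩, inferInstance,
    inferInstance,
    fun X Y p hp => ⟨e.inverse.obj Y, (i.symm.app X).hom ≫ e.inverse.map p,
      (hp.map e.inverse).iso_comp _, ⟨G.mapIso (e.counitIso.app Y).symm⟩⟩⟩

end Localization

section FullSubcategory
variable {C : Type*} [Category* C] [Abelian C] (P : ObjectProperty C) [P.IsSerreClass]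

theorem exact_ι : PreservesFiniteLimits P.ι ∧ PreservesFiniteColimits P.ι := by
  have := P.preservesMonomorphisms_ι_of_isNormalEpiCategory
  have := P.preservesEpimorphisms_ι_of_isNormalMonoCategory
  have hk := P.preservesKernels_ι
  have hc := P.preservesCokernels_ι
  exact ⟨Functor.preservesFiniteLimits_of_preservesKernels _,
    Functor.preservesFiniteColimits_of_preservesCokernels _⟩

instance : PreservesFiniteLimits P.ι := (exact_ι P).1

instance : PreservesFiniteColimits P.ι := (exact_ι P).2

/-- The inclusion of the full subcategory reflects limits and colimits, so exactness may be tested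
in the ambient category. -/
theorem exact_lift {D : Type*} [Category* D] [Abelian D] (F : D ⥤ C) (hF : ∀ X, P (F.obj X))
    [PreservesFiniteLimits F] [PreservesFiniteColimits F] :
    PreservesFiniteLimits (P.lift F hF) ∧ PreservesFiniteColimits (P.lift F hF) :=
  have : PreservesFiniteLimits (P.lift F hF ⋙ P.ι) := inferInstanceAs (PreservesFiniteLimits F)
  have : PreservesFiniteColimits (P.lift F hF ⋙ P.ι) := inferInstanceAs (PreservesFiniteColimits F)
  ⟨preservesFiniteLimits_of_reflects_of_preserves _ P.ι,
    preservesFiniteColimits_of_reflects_of_preserves _ P.ι⟩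

instance {D : Type*} [Category* D] [Abelian D] (F : D ⥤ C) (hF : ∀ X, P (F.obj X))
    [PreservesFiniteLimits F] [PreservesFiniteColimits F] : PreservesFiniteLimits (P.lift F hF) :=
  (exact_lift P F hF).1

instance {D : Type*} [Category* D] [Abelian D] (F : D ⥤ C) (hF : ∀ X, P (F.obj X))
    [PreservesFiniteLimits F] [PreservesFiniteColimits F] :
    PreservesFiniteColimits (P.lift F hF) :=
  (exact_lift P F hF).2

/-- The inclusion is fully faithful and preserves and reflects epimorphisms, so both lifting
problems and essentiality tests can be solved in the ambient category. -/
theorem IsProjectiveCover.homMk {X Y : P.FullSubcategory} {p : X.obj ⟶ Y.obj}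
    (hp : IsProjectiveCover p) : IsProjectiveCover (ObjectProperty.homMk p : X ⟶ Y) := by
  have := hp.1
  have := hp.2.1
  have h1 : Epi (ObjectProperty.homMk p : X ⟶ Y) :=
    P.ι.epi_of_epi_map (inferInstanceAs (Epi p))
  refine ⟨⟨fun {A B} f g hg => ?_⟩, h1, fun Z g hg => ?_⟩
  · have : Epi g.hom := inferInstanceAs (Epi (P.ι.map g))
    exact ⟨ObjectProperty.homMk (Projective.factorThru f.hom g.hom),
      P.ι.map_injective (Projective.factorThru_comp f.hom g.hom)⟩
  · have h2 : Epi (g.hom ≫ p) := inferInstanceAs (Epi (P.ι.map (g ≫ ObjectProperty.homMk p)))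
    exact P.ι.epi_of_epi_map (hp.2.2 g.hom h2)

theorem IsInjectiveHull.homMk {X Y : P.FullSubcategory} {p : X.obj ⟶ Y.obj}
    (hp : IsInjectiveHull p) : IsInjectiveHull (ObjectProperty.homMk p : X ⟶ Y) := by
  have := hp.1
  have := hp.2.1
  have h1 : Mono (ObjectProperty.homMk p : X ⟶ Y) :=
    P.ι.mono_of_mono_map (inferInstanceAs (Mono p))
  refine ⟨⟨fun {A B} f g hg => ?_⟩, h1, fun Z g hg => ?_⟩
  · have : Mono g.hom := inferInstanceAs (Mono (P.ι.map g))
    exact ⟨ObjectProperty.homMk (Injective.factorThru f.hom g.hom),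
      P.ι.map_injective (Injective.comp_factorThru f.hom g.hom)⟩
  · have h2 : Mono (p ≫ g.hom) :=
      inferInstanceAs (Mono (P.ι.map ((ObjectProperty.homMk p : X ⟶ Y) ≫ g)))
    exact P.ι.mono_of_mono_map (hp.2.2 g.hom h2)

end FullSubcategory
end StdStrat

/-! ### The layers as categories of T-modules concentrated in one degree -/

namespace GradedAlg
open GrMod
namespace BorelData
variable {K : Type u} [Field K] {A B C T : Type u} [Ring A] [Ring B] [Ring C] [Ring T]
    [Algebra K A] [Algebra K B] [Algebra K C] [Algebra K T] {𝒜 : ℤ → Submodule K A}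
    {ℬ : ℤ → Submodule K B} {𝒞 : ℤ → Submodule K C} {𝒯 : ℤ → Submodule K T}
    [FiniteDimensional K A] [FiniteDimensional K B] [FiniteDimensional K C]
    [FiniteDimensional K T] (S : BorelData 𝒜 ℬ 𝒞 𝒯)

section Layer
variable {d : ℤ} {Q : ObjectProperty (GrMod 𝒜)} (hQ : ∀ M, Q M ↔ upTo 𝒜 d M)

/-- The component of degree `d`, on the modules in degrees `≤ d`. -/
noncomputable abbrev layerTop (d : ℤ) (Q : ObjectProperty (GrMod 𝒜)) :
    Q.FullSubcategory ⥤ (conc 𝒯 d).FullSubcategory :=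
  (conc 𝒯 d).lift (Q.ι ⋙ S.topF d) (fun _ => comp_conc S.mem_zero d _)

/-- The standardization functor. -/
noncomputable abbrev layerStd : (conc 𝒯 d).FullSubcategory ⥤ Q.FullSubcategory :=
  Q.lift ((conc 𝒯 d).ι ⋙ S.stdF) (fun N => (hQ _).2 (S.std_upTo N.property))

/-- The costandardization functor. -/
noncomputable abbrev layerCostd : (conc 𝒯 d).FullSubcategory ⥤ Q.FullSubcategory :=
  Q.lift ((conc 𝒯 d).ι ⋙ S.costdF) (fun N => (hQ _).2 (S.costd_upTo N.property))

/-- The adjunction bijection for standardization. -/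
noncomputable def layerStdEquiv (N : (conc 𝒯 d).FullSubcategory) (M : Q.FullSubcategory) :
    ((S.layerStd hQ).obj N ⟶ M) ≃ (N ⟶ (S.layerTop d Q).obj M) :=
  (Q.fullyFaithfulι.homEquiv).trans ((S.stdTopEquiv N.property ((hQ _).1 M.property)).trans
    ((conc 𝒯 d).fullyFaithfulι.homEquiv (X := N) (Y := (S.layerTop d Q).obj M)).symm)

/-- The adjunction bijection for costandardization. -/
noncomputable def layerCostdEquiv (M : Q.FullSubcategory) (N : (conc 𝒯 d).FullSubcategory) :
    ((S.layerTop d Q).obj M ⟶ N) ≃ (M ⟶ (S.layerCostd hQ).obj N) :=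
  ((conc 𝒯 d).fullyFaithfulι.homEquiv (X := (S.layerTop d Q).obj M) (Y := N)).trans
    ((S.costdTopEquiv N.property ((hQ _).1 M.property)).trans
      (Q.fullyFaithfulι.homEquiv (X := M) (Y := (S.layerCostd hQ).obj N)).symm)

/-- Standardization is left adjoint to the component of degree `d`. -/
noncomputable def layerStdAdj : S.layerStd hQ ⊣ S.layerTop d Q :=
  Adjunction.mkOfHomEquiv
    { homEquiv := S.layerStdEquiv hQ
      homEquiv_naturality_left_symm := fun {N N' M} f g => by
        obtain ⟨g, rfl⟩ := (S.layerStdEquiv hQ N' M).surjective g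
        rw [Equiv.symm_apply_apply, Equiv.symm_apply_eq]
        exact (conc 𝒯 d).ι.map_injective (S.stdTopEquiv_naturality_left N.property N'.property
          ((hQ _).1 M.property) f.hom g.hom).symm
      homEquiv_naturality_right := fun {N M M'} f g => (conc 𝒯 d).ι.map_injective
        (S.stdTopEquiv_naturality N.property ((hQ _).1 M.property) ((hQ _).1 M'.property)
          f.hom g.hom) }

/-- Costandardization is right adjoint to the component of degree `d`. -/
noncomputable def layerCostdAdj : S.layerTop d Q ⊣ S.layerCostd hQ :=
  Adjunction.mkOfHomEquiv
    { homEquiv := S.layerCostdEquiv hQ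
      homEquiv_naturality_left_symm := fun {M M' N} f g => by
        obtain ⟨g, rfl⟩ := (S.layerCostdEquiv hQ M' N).surjective g
        rw [Equiv.symm_apply_apply, Equiv.symm_apply_eq]
        exact Q.ι.map_injective (S.costdTopEquiv_naturality_left N.property ((hQ _).1 M.property)
          ((hQ _).1 M'.property) f.hom g.hom).symm
      homEquiv_naturality_right := fun {M N N'} f g => Q.ι.map_injective
        (S.costdTopEquiv_naturality_right N.property N'.property ((hQ _).1 M.property)
          f.hom g.hom) }

theorem isIso_layerStdAdj_unit : IsIso (S.layerStdAdj hQ).unit := by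
  have (N : (conc 𝒯 d).FullSubcategory) : IsIso ((S.layerStdAdj hQ).unit.app N) := by
    have : IsIso ((conc 𝒯 d).ι.map ((S.layerStdAdj hQ).unit.app N)) :=
      S.isIso_topUnit N.property
    exact isIso_of_reflects_iso _ (conc 𝒯 d).ι
  exact NatIso.isIso_of_isIso_app _

theorem isZero_topF_iff {M : GrMod 𝒜} : IsZero ((S.topF d).obj M) ↔ M.gr d = ⊥ := by
  rw [isZero_iff, Submodule.eq_bot_iff]
  constructor
  · intro h m hm
    rw [← proj_self M.isInternal hm]
    have := congrArg (fun x => ofRes S.j S.j_mem M (toLin (compι S.mem_zero d (S.resT M)) x))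
      (h (toLin (compπ S.mem_zero d (S.resT M)) ((ofRes S.j S.j_mem M).symm m)))
    exact this.trans (by rw [map_zero, map_zero])
  · intro h m
    refine compι_injective S.mem_zero d _ ((ofRes S.j S.j_mem M).injective ?_)
    rw [map_zero, map_zero]
    exact h _ (compι_mem S.mem_zero m)

theorem upTo_sub_one_iff {M : GrMod 𝒜} (hM : upTo 𝒜 d M) : upTo 𝒜 (d - 1) M ↔ M.gr d = ⊥ := by
  refine ⟨fun h => h d (by simp), fun h i hi => ?_⟩
  simp only [Set.mem_Iic, not_le] at hi
  by_cases hd : i = d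
  · rw [hd, h]
  · exact hM i (by simp only [Set.mem_Iic, not_le]; omega)

variable {P : ObjectProperty (GrMod 𝒜)}

theorem isZero_ι_iff {E : Type*} [Category* E] [Abelian E] (R : ObjectProperty E) [R.IsSerreClass]
    (X : R.FullSubcategory) : IsZero X.obj ↔ IsZero X := by
  rw [IsZero.iff_id_eq_zero, IsZero.iff_id_eq_zero]
  exact ⟨fun h => R.ι.map_injective h, fun h => congrArg R.ι.map h⟩

/-- A module in degrees ≤ d has zero component in degree `d` exactly when it lies in degrees ≤ d -
1. -/
theorem inverseImage_eq_kernel [Q.IsSerreClass] (hQ : ∀ M, Q M ↔ upTo 𝒜 d M)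
    (hP : ∀ M, P M ↔ upTo 𝒜 (d - 1) M) :
    P.inverseImage Q.ι = (S.layerTop d Q).kernel := by
  ext M
  change P M.obj ↔ IsZero _
  rw [hP, upTo_sub_one_iff ((hQ _).1 M.property), ← S.isZero_topF_iff, ← isZero_ι_iff]
  rfl

/-- The top component functor is exact, has the required kernel, and its left adjoint is fully
faithful because the unit is invertible. So T-modules in degree `d` are a model of the layer. -/
theorem isLocalization_layerTop [Q.IsSerreClass] [P.IsSerreClass]
    (hQ : ∀ M, Q M ↔ upTo 𝒜 d M)
    (hP : ∀ M, P M ↔ upTo 𝒜 (d - 1) M) :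
    (S.layerTop d Q).IsLocalization (P.inverseImage Q.ι).isoModSerre := by
  have := S.isIso_layerStdAdj_unit hQ
  have := (S.layerStdAdj hQ).fullyFaithfulLOfIsIsoUnit
  have := this.full
  have := (S.layerStdAdj hQ).fullyFaithfulLOfIsIsoUnit.faithful
  exact isLocalization_of_leftAdjoint _ (S.layerStdAdj hQ) (S.inverseImage_eq_kernel hQ hP)

end Layer
end BorelData
end GradedAlg

/-! ### Heads of standard modules and the classification of simple modules -/

namespace GradedAlg
open GrMod
namespace BorelData
variable {K : Type u} [Field K] {A B C T : Type u} [Ring A] [Ring B] [Ring C] [Ring T]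
    [Algebra K A] [Algebra K B] [Algebra K C] [Algebra K T] {𝒜 : ℤ → Submodule K A}
    {ℬ : ℤ → Submodule K B} {𝒞 : ℤ → Submodule K C} {𝒯 : ℤ → Submodule K T}
    [FiniteDimensional K A] [FiniteDimensional K B] [FiniteDimensional K C]
    [FiniteDimensional K T] (S : BorelData 𝒜 ℬ 𝒞 𝒯)

section Head
variable {d : ℤ} {N : GrMod 𝒯} {M : GrMod 𝒜}

theorem std_hom_eq_zero (hN : conc 𝒯 d N) (hM : upTo 𝒜 d M) (h0 : IsZero ((S.topF d).obj M))
    (f : S.std N ⟶ M) : f = 0 :=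
  (S.stdTopEquiv hN hM).injective (h0.eq_of_tgt _ _)

theorem stdTopEquiv_eq (hN : conc 𝒯 d N) (hM : upTo 𝒜 d M) (f : S.std N ⟶ M) :
    S.stdTopEquiv hN hM f = S.topUnit hN ≫ (S.topF d).map f := by
  rw [topUnit, ← stdTopEquiv_naturality, Category.id_comp]

theorem stdTopEquiv_eq_zero_iff (hN : conc 𝒯 d N) (hM : upTo 𝒜 d M) (f : S.std N ⟶ M) :
    S.stdTopEquiv hN hM f = 0 ↔ f = 0 := by
  constructor
  · intro h
    refine (S.stdTopEquiv hN hM).injective (h.trans ?_)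
    rw [stdTopEquiv_eq, Functor.map_zero, comp_zero]
  · rintro rfl
    rw [stdTopEquiv_eq, Functor.map_zero, comp_zero]

theorem not_isZero_std [Simple N] (hN : conc 𝒯 d N) : ¬ IsZero (S.std N) := by
  intro h
  have := S.isIso_topUnit hN
  exact Simple.not_isZero N (((S.topF d).map_isZero h).of_iso (asIso (S.topUnit hN)))

/-- The top of a simple quotient of a proper standard module. -/
theorem isIso_stdTopEquiv [Simple N] (hN : conc 𝒯 d N) [Simple M] (hM : upTo 𝒜 d M)
    {q : S.std N ⟶ M} (hq : q ≠ 0) : IsIso (S.stdTopEquiv hN hM q) := by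
  have := S.isIso_topUnit hN
  have := epi_of_ne_zero hq
  have h0 : S.stdTopEquiv hN hM q ≠ 0 := fun h => hq ((S.stdTopEquiv_eq_zero_iff hN hM q).1 h)
  -- Injectivity comes from simplicity of `N`. Surjectivity comes from exactness of the top
  -- component, since `q` is epi and the unit is invertible.
  have h1 : Mono (S.stdTopEquiv hN hM q) := mono_of_nonzero_from_simple h0
  have h2 : Epi (S.stdTopEquiv hN hM q) := by
    rw [stdTopEquiv_eq]
    infer_instance
  exact isIso_of_mono_of_epi _

theorem upTo_of_std [Simple M] (hN : conc 𝒯 d N) {q : S.std N ⟶ M} (hq : q ≠ 0) : upTo 𝒜 d M :=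
  have := epi_of_ne_zero hq
  support_of_epi q (S.std_upTo hN)

/-- Proper standardization preserves heads. -/
theorem isEssentialEpi_std {N' : GrMod 𝒯} [Simple N] [Simple M] {p : N' ⟶ N}
    (hp : IsEssentialEpi p) (hN' : conc 𝒯 d N') (hN : conc 𝒯 d N) {q : S.std N ⟶ M}
    (hq : q ≠ 0) : IsEssentialEpi (S.stdF.map p ≫ q) := by
  have hM := S.upTo_of_std hN hq
  have := hp.1
  have := epi_of_ne_zero hq
  have := S.isIso_topUnit hN'
  have := S.isIso_stdTopEquiv hN hM hq
  refine ⟨inferInstance, fun Y g hg => ?_⟩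
  -- On top components the target map is `p` up to isomorphism, so essentiality of `p` forces `g` to
  -- be surjective in degree `d`.
  have h1 : Epi ((S.topF d).map g ≫ (S.topF d).map (S.stdF.map p ≫ q)) := by
    rw [← Functor.map_comp]
    infer_instance
  have h2 : (S.topF d).map (S.stdF.map p ≫ q) =
      inv (S.topUnit hN') ≫ p ≫ S.stdTopEquiv hN hM q := by
    rw [← S.stdTopEquiv_naturality_left hN' hN, IsIso.eq_inv_comp, stdTopEquiv_eq]
  have h3 : Epi (((S.topF d).map g ≫ inv (S.topUnit hN')) ≫ p) := by
    have : ((S.topF d).map g ≫ inv (S.topUnit hN')) ≫ p =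
        ((S.topF d).map g ≫ (S.topF d).map (S.stdF.map p ≫ q)) ≫
          inv (S.stdTopEquiv hN hM q) := by
      rw [h2]
      simp only [Category.assoc, IsIso.hom_inv_id, Category.comp_id]
    rw [this]
    infer_instance
  have h4 := hp.2 _ h3
  have h5 : Epi ((S.topF d).map g) := by
    have : (S.topF d).map g = ((S.topF d).map g ≫ inv (S.topUnit hN')) ≫ S.topUnit hN' := by
      simp only [Category.assoc, IsIso.inv_hom_id, Category.comp_id]
    rw [this]
    infer_instance
  -- The cokernel of `g` now vanishes in degree `d`, whereas the proper standard module is generated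
  -- in that degree; hence the projection onto the cokernel is zero.
  have h6 : (S.topF d).map (cokernel.π g) = 0 := by
    rw [← cancel_epi ((S.topF d).map g), ← Functor.map_comp, cokernel.condition,
      Functor.map_zero, comp_zero]
  have h7 : IsZero ((S.topF d).obj (cokernel g)) := by
    have : Epi (0 : (S.topF d).obj (S.std N') ⟶ (S.topF d).obj (cokernel g)) := by
      rw [← h6]
      infer_instance
    exact IsZero.of_epi_zero ((S.topF d).obj (S.std N')) _
  have h8 := S.std_hom_eq_zero hN' (support_of_epi (cokernel.π g) (S.std_upTo hN')) h7
    (cokernel.π g)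
  exact Preadditive.epi_of_cokernel_zero h8

end Head

/-- The simple `A`-modules `L(λ)`, indexed by labels for the simple `T`-modules, together with
nonzero morphisms from the proper standard modules. -/
structure Labelling (Λ : Type w) where
  rep : Λ → GrMod 𝒯
  deg : Λ → ℤ
  L : Λ → GrMod 𝒜
  q : ∀ l, S.std (rep l) ⟶ L l
  simple_rep : ∀ l, Simple (rep l)
  simple_L : ∀ l, Simple (L l)
  conc_rep : ∀ l, conc 𝒯 (deg l) (rep l)
  q_ne_zero : ∀ l, q l ≠ 0
  exists_iso : ∀ X : GrMod 𝒯, Simple X → ∃ l, Nonempty (X ≅ rep l)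
  eq_of_iso : ∀ l l', Nonempty (rep l ≅ rep l') → l = l'

namespace Labelling
variable {S} {Λ : Type w} (W : S.Labelling Λ)
attribute [instance] simple_rep simple_L

theorem upTo_L (l : Λ) : upTo 𝒜 (W.deg l) (W.L l) := S.upTo_of_std (W.conc_rep l) (W.q_ne_zero l)

/-- The top component of `L(λ)` is `λ`. -/
noncomputable def topIso (l : Λ) : W.rep l ≅ (S.topF (W.deg l)).obj (W.L l) :=
  have := S.isIso_stdTopEquiv (W.conc_rep l) (W.upTo_L l) (W.q_ne_zero l)
  asIso (S.stdTopEquiv (W.conc_rep l) (W.upTo_L l) (W.q l))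

theorem L_gr_deg (l : Λ) : (W.L l).gr (W.deg l) ≠ ⊥ := by
  rw [ne_eq, ← S.isZero_topF_iff]
  exact fun h => Simple.not_isZero _ (h.of_iso (W.topIso l))

theorem isEssentialEpi_q (l : Λ) : IsEssentialEpi (W.q l) := by
  have := S.isEssentialEpi_std (isEssentialEpi_id (W.rep l)) (W.conc_rep l) (W.conc_rep l)
    (W.q_ne_zero l)
  rwa [CategoryTheory.Functor.map_id, Category.id_comp] at this

/-- The highest degree of `L(λ)` is the degree of λ, and its component there is λ itself. -/
theorem eq_of_L_iso {l l' : Λ} (e : W.L l ≅ W.L l') : l = l' := by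
  have hd : ∀ {l l'} (e : W.L l ≅ W.L l'), W.deg l ≤ W.deg l' := by
    intro l l' e
    by_contra h
    exact W.L_gr_deg l (support_of_mono e.hom (W.upTo_L l') _ (by simpa using h))
  have h := le_antisymm (hd e) (hd e.symm)
  exact W.eq_of_iso _ _ ⟨W.topIso l ≪≫ (S.topF (W.deg l)).mapIso e ≪≫
    eqToIso (by rw [h]) ≪≫ (W.topIso l').symm⟩

theorem exists_top_degree {R : Type u} [Ring R] [Algebra K R] {ℛ : ℤ → Submodule K R}
    [FiniteDimensional K R] {M : GrMod ℛ} (h : ¬ IsZero M) : ∃ d, upTo ℛ d M ∧ M.gr d ≠ ⊥ := by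
  have hne : (finite_support M.isInternal).toFinset.Nonempty := by
    by_contra h0
    rw [Finset.not_nonempty_iff_eq_empty, Finset.eq_empty_iff_forall_notMem] at h0
    exact h ((isZero_iff_gr M).2 fun i => by simpa using h0 i)
  refine ⟨_, fun i hi => ?_, by simpa using Finset.max'_mem _ hne⟩
  by_contra h0
  exact hi (Finset.le_max' _ i (by simpa using h0))

theorem deg_eq_of_conc (l : Λ) {e : ℤ} (h : conc 𝒯 e (W.rep l)) : W.deg l = e := by
  by_contra hne
  refine Simple.not_isZero (W.rep l) ((isZero_iff_gr _).2 fun i => ?_)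
  by_cases hi : i = e
  · exact W.conc_rep l i (by rw [hi]; exact fun h => hne h.symm)
  · exact h i hi

/-- A module bounded by a degree in which it does not vanish receives a nonzero morphism from a
proper standard module. -/
theorem exists_std_hom {d : ℤ} {M : GrMod 𝒜} (hM : upTo 𝒜 d M) (h0 : M.gr d ≠ ⊥) :
    ∃ l, W.deg l = d ∧ ∃ f : S.std (W.rep l) ⟶ M, f ≠ 0 := by
  -- The adjunction converts the inclusion of a simple T-submodule of the top component into the
  -- desired morphism.
  rw [ne_eq, ← S.isZero_topF_iff] at h0
  obtain ⟨V, i, _, _⟩ := exists_mono_of_not_isZero h0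
  obtain ⟨l, ⟨e⟩⟩ := W.exists_iso V inferInstance
  have hV : conc 𝒯 d V := support_of_mono i (comp_conc _ _ _)
  have hl : conc 𝒯 d (W.rep l) := support_of_mono e.inv hV
  have hd := W.deg_eq_of_conc l hl
  refine ⟨l, hd, (S.stdTopEquiv hl hM).symm (e.inv ≫ i), fun h => ?_⟩
  rw [← S.stdTopEquiv_eq_zero_iff hl hM, Equiv.apply_symm_apply] at h
  have : i = 0 := by rw [← cancel_epi e.inv, h, comp_zero]
  subst this
  exact Simple.not_isZero V (IsZero.of_mono_zero V ((S.topF d).obj M))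

/-- The highest nonzero component of `V` gives a nonzero morphism from some proper standard module
to `V`, and that module has only one simple quotient. -/
theorem existsUnique_iso (V : GrMod 𝒜) [Simple V] : ∃! l, Nonempty (V ≅ W.L l) := by
  obtain ⟨d, hd, h0⟩ := exists_top_degree (Simple.not_isZero V)
  obtain ⟨l, rfl, f, hf⟩ := W.exists_std_hom hd h0
  obtain ⟨e, -⟩ := (W.isEssentialEpi_q l).exists_iso hf
  exact ⟨l, ⟨e.symm⟩, fun l' ⟨e'⟩ => W.eq_of_L_iso (e'.symm ≪≫ e.symm)⟩

/-- On the top component, a simple T-module, `f` is a scalar `c`. Then `f - c` kills the nonzero top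
component, so it is not invertible and must vanish by Schur's lemma. -/
theorem absolutelySimple (hT : ∀ (X : GrMod 𝒯) [Simple X] (f : X ⟶ X), ∃ c : K, f = c • 𝟙 X)
    (l : Λ) (f : W.L l ⟶ W.L l) : ∃ c : K, f = c • 𝟙 (W.L l) := by
  have : Simple ((S.topF (W.deg l)).obj (W.L l)) := Simple.of_iso (W.topIso l).symm
  obtain ⟨c, hc⟩ := hT _ ((S.topF (W.deg l)).map f)
  refine ⟨c, ?_⟩
  by_contra h
  have h1 : f - c • 𝟙 (W.L l) ≠ 0 := fun h' => h (sub_eq_zero.1 h')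
  have := isIso_of_hom_simple h1
  have h2 : (S.topF (W.deg l)).map (f - c • 𝟙 (W.L l)) = 0 := by
    rw [Functor.map_sub, hc, sub_eq_zero]
    refine hom_ext fun m => compι_injective S.mem_zero _ _ ?_
    refine (ofRes S.j S.j_mem (W.L l)).injective ?_
    rw [S.topF_map_apply]
    rfl
  have h3 : Epi (0 : (S.topF (W.deg l)).obj (W.L l) ⟶ (S.topF (W.deg l)).obj (W.L l)) := by
    rw [← h2]
    infer_instance
  exact Simple.not_isZero ((S.topF (W.deg l)).obj (W.L l))
    (IsZero.of_epi_zero ((S.topF (W.deg l)).obj (W.L l)) _)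

/-- The degree bound defines a Serre class containing the generators. Conversely, a simple submodule
`L(λ)` of a bounded module has deg λ ≤ d because `L(λ)` is nonzero in degree deg λ; the quotient is
treated by induction on the dimension. -/
theorem below_iff (d : ℤ) (M : GrMod 𝒜) : below W.L W.deg d M ↔ upTo 𝒜 d M := by
  constructor
  · refine fun h => h (upTo 𝒜 d) inferInstance ?_
    rintro X ⟨l, hl, ⟨e⟩⟩
    exact support_of_mono e.hom fun i hi => W.upTo_L l i fun h => hi (le_trans h hl)
  · induction hn : M.dim using Nat.strong_induction_on generalizing M with
    | _ n ih =>
    intro hM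
    by_cases h0 : IsZero M
    · exact ObjectProperty.prop_of_isZero _ h0
    obtain ⟨V, i, _, _⟩ := exists_mono_of_not_isZero h0
    have hE : (ShortComplex.mk i (cokernel.π i) (cokernel.condition i)).ShortExact :=
      { exact := ShortComplex.exact_of_g_is_cokernel _ (cokernelIsCokernel i) }
    have hdim := dim_eq_of_shortExact hE
    have hV : V.dim ≠ 0 := fun h => Simple.not_isZero V (dim_eq_zero_iff.1 h)
    refine ObjectProperty.prop_X₂_of_shortExact _ hE ?_ (ih _ ?_ (cokernel i) rfl
      (support_of_epi (cokernel.π i) hM))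
    · obtain ⟨l, ⟨e⟩, -⟩ := W.existsUnique_iso V
      refine le_serreSpan _ _ ⟨l, ?_, ⟨e⟩⟩
      by_contra h
      exact W.L_gr_deg l (support_of_mono (e.inv ≫ i) hM _ (by simpa using h))
    · dsimp only at hdim
      omega

theorem strictlyBelow_iff (d : ℤ) (M : GrMod 𝒜) :
    strictlyBelow W.L W.deg d M ↔ upTo 𝒜 (d - 1) M := by
  rw [← W.below_iff]
  simp only [strictlyBelow, below, Int.le_sub_one_iff]

/-- Induction on the dimension: a nonzero morphism either is nonzero on a chosen simple submodule,
which determines its label, or factors through the quotient. -/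
theorem finite_hom (M : GrMod 𝒯) : {l | ∃ f : M ⟶ W.rep l, f ≠ 0}.Finite := by
  induction hn : M.dim using Nat.strong_induction_on generalizing M with
  | _ n ih =>
  by_cases h0 : IsZero M
  · convert Set.finite_empty
    refine Set.eq_empty_of_forall_notMem ?_
    rintro l ⟨f, hf⟩
    exact hf (h0.eq_of_src _ _)
  obtain ⟨V, i, _, _⟩ := exists_mono_of_not_isZero h0
  have hE : (ShortComplex.mk i (cokernel.π i) (cokernel.condition i)).ShortExact :=
    { exact := ShortComplex.exact_of_g_is_cokernel _ (cokernelIsCokernel i) }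
  have hdim := dim_eq_of_shortExact hE
  have hV : V.dim ≠ 0 := fun h => Simple.not_isZero V (dim_eq_zero_iff.1 h)
  obtain ⟨l₀, ⟨e₀⟩⟩ := W.exists_iso V inferInstance
  have h1 := ih (cokernel i).dim (by dsimp only at hdim; omega) (cokernel i) rfl
  refine (h1.insert l₀).subset ?_
  rintro l ⟨f, hf⟩
  by_cases h : i ≫ f = 0
  · refine Or.inr ⟨cokernel.desc i f h, fun h' => hf ?_⟩
    rw [← cokernel.π_desc i f h, h', comp_zero]
  · have := isIso_of_hom_simple h
    exact Or.inl (W.eq_of_iso _ _ ⟨(asIso (i ≫ f)).symm ≪≫ e₀⟩)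

end Labelling

section Shift

/-- The regular module of an algebra concentrated in degree zero, placed in degree `d`. -/
def regular (S : BorelData 𝒜 ℬ 𝒞 𝒯) (d : ℤ) : GrMod 𝒯 where
  carrier := T
  gr i := if i = d then ⊤ else ⊥
  isInternal := isInternal_of_proj (fun i => if i = d then LinearMap.id else 0)
    (by
      intro i x hx
      by_cases h : i = d
      · simp [h]
      · simpa [h, eq_comm] using hx)
    (by
      intro i j hij x hx
      by_cases h : j = d
      · subst h; simp [hij]
      · rw [if_neg h, Submodule.mem_bot] at hx
        simp [hx])
    (fun x => Submodule.mem_iSup_of_mem d (by simp))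
  smul_mem {i j a m} ha hm := by
    by_cases hi : i = 0
    · subst hi
      by_cases h : j = d
      · simp [h]
      · rw [if_neg h, Submodule.mem_bot] at hm
        simp [hm]
    · rw [S.T_deg i hi, Submodule.mem_bot] at ha
      rw [ha, zero_smul]
      exact Submodule.zero_mem _

theorem regular_gr_of_ne (S : BorelData 𝒜 ℬ 𝒞 𝒯) {i d : ℤ} (h : i ≠ d) :
    (S.regular d).gr i = ⊥ := if_neg h

/-- The morphism from the regular module given by an element of degree `d`. -/
def regularHom (S : BorelData 𝒜 ℬ 𝒞 𝒯) {d : ℤ} {N : GrMod 𝒯} (n : N) (hn : n ∈ N.gr d) :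
    S.regular d ⟶ N :=
  ofLin (M := S.regular d) (LinearMap.toSpanSingleton T N n) (fun i t ht => by
    by_cases h : i = d
    · subst h
      have := N.smul_mem (S.mem_zero t) hn
      rwa [zero_add] at this
    · rw [S.regular_gr_of_ne h, Submodule.mem_bot] at ht
      rw [ht]
      change (0 : T) • n ∈ N.gr i
      rw [zero_smul]
      exact Submodule.zero_mem _)

theorem regularHom_one {d : ℤ} {N : GrMod 𝒯} (n : N) (hn : n ∈ N.gr d) :
    toLin (S.regularHom n hn) (1 : T) = n := one_smul T n

theorem Labelling.finite_fiber {S : BorelData 𝒜 ℬ 𝒞 𝒯} {Λ : Type w} (W : S.Labelling Λ) (d : ℤ) :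
    (W.deg ⁻¹' {d}).Finite := by
  refine (W.finite_hom (S.regular d)).subset ?_
  rintro l rfl
  have h : ∃ n : W.rep l, n ≠ 0 := by
    by_contra! h
    exact Simple.not_isZero _ ((isZero_iff _).2 h)
  obtain ⟨n, hn⟩ := h
  refine ⟨S.regularHom n (conc_mem_gr (W.conc_rep l) n), fun h0 => hn ?_⟩
  rw [← S.regularHom_one n (conc_mem_gr (W.conc_rep l) n), h0]
  rfl

end Shift
end BorelData
end GradedAlg

/-! ### Projectivity over the lower Borel subalgebra and splitting of the top -/

namespace GradedAlg
open GrMod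

/-- The component of `P` in degree `d` already maps onto `V`, so by essentiality it is all of `P`.
-/
theorem GrMod.conc_of_isEssentialEpi {K : Type u} [Field K] {T : Type u} [Ring T] [Algebra K T]
    {𝒯 : ℤ → Submodule K T} [FiniteDimensional K T] (h : ∀ t, t ∈ 𝒯 0) {d : ℤ} {P V : GrMod 𝒯}
    {p : P ⟶ V} (hp : IsEssentialEpi p) (hV : conc 𝒯 d V) : conc 𝒯 d P := by
  have := hp.1
  have h1 : Epi (compι h d P ≫ p) := by
    refine epi_of_surjective _ fun v => ?_
    obtain ⟨m, rfl⟩ := surjective_of_epi p v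
    refine ⟨toLin (compπ h d P) m, ?_⟩
    rw [GrMod.comp_apply, compι_compπ_apply, toLin_proj, proj_self _ (conc_mem_gr hV _)]
  have := hp.2 _ h1
  exact support_of_epi (compι h d P) (comp_conc h d P)

theorem GrMod.projective_of_dual {K : Type u} [Field K] {R : Type u} [Ring R] [Algebra K R]
    {ℛ : ℤ → Submodule K R} [FiniteDimensional K R] (M : GrMod ℛ) :
    Injective M.dual ↔ Projective M :=
  ((dualEquivalence ℛ).map_injective_iff (.op M)).trans Injective.projective_iff_injective_op.symm

namespace BorelData
variable {K : Type u} [Field K] {A B C T : Type u} [Ring A] [Ring B] [Ring C] [Ring T]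
    [Algebra K A] [Algebra K B] [Algebra K C] [Algebra K T] {𝒜 : ℤ → Submodule K A}
    {ℬ : ℤ → Submodule K B} {𝒞 : ℤ → Submodule K C} {𝒯 : ℤ → Submodule K T}
    [FiniteDimensional K A] [FiniteDimensional K B] [FiniteDimensional K C]
    [FiniteDimensional K T] (S : BorelData 𝒜 ℬ 𝒞 𝒯)

/-- The restriction of `A`-modules to the lower Borel subalgebra. -/
abbrev resC : GrMod 𝒜 ⥤ GrMod 𝒞 := res S.ιC S.ιC_mem

/-- The dual of `P` is injective over Aᵒᵖ. Restriction to Cᵒᵖ is right adjoint to induction, which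
is exact because Aᵒᵖ is free over Cᵒᵖ, so it preserves injectives; dualizing back gives the claim.
-/
theorem projective_resC (P : GrMod 𝒜) [Projective P] : Projective (S.resC.obj P) := by
  have h1 : Injective P.dual := (projective_of_dual P).2 inferInstance
  have := ind_exact S.op.ιB S.op.gradingA S.op.gradingB S.op.ιB_mem
    (S.op.ιC.toLinearMap ∘ₗ S.op.x) S.op.bijective_left
  have h2 := Injective.injective_of_adjoint
    (indAdj S.op.ιB S.op.gradingA S.op.gradingB S.op.ιB_mem) P.dual
  exact (projective_of_dual _).1
    (Injective.of_iso (dualRestrictIso S.ιC S.ιC_mem S.op.ιB_mem P).symm h2)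

section Top
variable {d : ℤ} {M : GrMod 𝒜}

/-- An element of C of negative degree could reach degree `d` only from above, where `M` vanishes.
Hence projecting to the top component is C-linear, with C acting there through T. -/
theorem proj_ιC_smul (hM : upTo 𝒜 d M) (c : C) (m : M) :
    proj M.isInternal d (S.ιC c • m) = S.j (S.pC c) • proj M.isInternal d m := by
  refine ext_of_isInternal S.gradingC.isInternal (f := fun c => proj M.isInternal d (S.ιC c • m))
    (g := fun c => S.j (S.pC c) • proj M.isInternal d m)
    (fun x y => by rw [map_add, add_smul, map_add])
    (fun x y => by rw [map_add, map_add, add_smul]) (fun k c hc => ?_) c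
  rcases lt_trichotomy k 0 with h | h | h
  · have h1 := S.pC_mem k c hc
    rw [S.T_deg k h.ne, Submodule.mem_bot] at h1
    rw [h1, map_zero, zero_smul,
      proj_smul_of_mem (M := M) (S.ιC_mem k c hc) (show k + (d - k) = d by omega),
      proj_eq_zero_of_gr (hM (d - k) (by simpa using h)), smul_zero]
  · subst h
    have h1 : S.ιC c = S.j (S.pC c) := by rw [← S.ιC_jC, S.C_zero c hc]
    rw [proj_smul_of_mem (M := M) (S.ιC_mem 0 c hc) (zero_add d), h1]
  · rw [S.C_deg k h, Submodule.mem_bot] at hc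
    rw [hc, map_zero, map_zero, map_zero, zero_smul, zero_smul, map_zero]

/-- The projection of a module onto its top component, as a morphism over the lower Borel
subalgebra. -/
noncomputable def topProj (hM : upTo 𝒜 d M) :
    S.resC.obj M ⟶ (res S.pC S.pC_mem).obj ((S.topF d).obj M) :=
  ofK (M := S.resC.obj M) (N := (res S.pC S.pC_mem).obj ((S.topF d).obj M))
    ((ofRes S.pC S.pC_mem ((S.topF d).obj M)).symm.toLinearMap ∘ₗ
      (toLin (compπ S.mem_zero d (S.resT M))).restrictScalars K ∘ₗ
      (ofRes S.j S.j_mem M).symm.toLinearMap ∘ₗ (ofRes S.ιC S.ιC_mem M).toLinearMap)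
    (fun c m => (ofRes S.pC S.pC_mem ((S.topF d).obj M)).injective
      (compι_injective S.mem_zero d _ ((ofRes S.j S.j_mem M).injective
        (S.proj_ιC_smul hM c (ofRes S.ιC S.ιC_mem M m)))))
    (fun _ _ hm => toLin_mem (compπ S.mem_zero d (S.resT M)) hm)

theorem topProj_apply (hM : upTo 𝒜 d M) (m : S.resC.obj M) :
    ofRes S.j S.j_mem M (toLin (compι S.mem_zero d (S.resT M))
      (ofRes S.pC S.pC_mem ((S.topF d).obj M) (toLin (S.topProj hM) m))) =
      proj M.isInternal d (ofRes S.ιC S.ιC_mem M m) := rfl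

theorem topProj_surjective (hM : upTo 𝒜 d M) : Function.Surjective (toLin (S.topProj hM)) := by
  intro x
  refine ⟨(ofRes S.ιC S.ιC_mem M).symm (ofRes S.j S.j_mem M (toLin (compι S.mem_zero d (S.resT M))
    (ofRes S.pC S.pC_mem ((S.topF d).obj M) x))), ?_⟩
  refine (ofRes S.pC S.pC_mem ((S.topF d).obj M)).injective
      (compι_injective S.mem_zero d _ ((ofRes S.j S.j_mem M).injective ?_))
  rw [topProj_apply, LinearEquiv.apply_symm_apply]
  refine proj_self M.isInternal ?_
  exact compι_mem S.mem_zero (ofRes S.pC S.pC_mem ((S.topF d).obj M) x)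

theorem topProj_naturality {M' : GrMod 𝒜} (hM : upTo 𝒜 d M) (hM' : upTo 𝒜 d M') (f : M ⟶ M') :
    S.resC.map f ≫ S.topProj hM' = S.topProj hM ≫ (res S.pC S.pC_mem).map ((S.topF d).map f) := by
  refine hom_ext fun m => (ofRes S.pC S.pC_mem ((S.topF d).obj M')).injective
      (compι_injective S.mem_zero d _ ((ofRes S.j S.j_mem M').injective ?_))
  rw [GrMod.comp_apply, GrMod.comp_apply, topProj_apply, res_map_apply, res_map_apply,
    topF_map_apply, topProj_apply, toLin_proj]

/-- The morphism from the proper standard module of the top component. -/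
noncomputable def fromTop (hM : upTo 𝒜 d M) : S.std ((S.topF d).obj M) ⟶ M :=
  (S.stdTopEquiv (comp_conc S.mem_zero d _) hM).symm (𝟙 _)

/-- Over C, the projective module `M` maps to its top component, which is also the top of the proper
standard module; this lifts to a C-linear map `s` from `M` to the proper standard module. The
composite of `fromTop` and `s` is the identity on the top, which generates over C. -/
theorem exists_retraction_fromTop (hM : upTo 𝒜 d M) [Projective (S.resC.obj M)] :
    ∃ s, S.resC.map (S.fromTop hM) ≫ s = 𝟙 (S.resC.obj (S.std ((S.topF d).obj M))) := by
  set N := (S.topF d).obj M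
  have hN : conc 𝒯 d N := comp_conc S.mem_zero d _
  have hs := S.std_upTo hN
  have := epi_of_surjective _ (S.topProj_surjective hs)
  have := S.isIso_topUnit hN
  let s := Projective.factorThru (S.topProj hM ≫ (res S.pC S.pC_mem).map (S.topUnit hN))
    (S.topProj hs)
  -- The map induced by `fromTop` on top components is inverse to the unit, so the composite is the
  -- identity after projection to the top.
  have hu : (S.resC.map (S.fromTop hM) ≫ s) ≫ S.topProj hs = S.topProj hs := by
    have h1 : S.topUnit hN ≫ (S.topF d).map (S.fromTop hM) = 𝟙 _ := by
      rw [← S.stdTopEquiv_eq hN hM]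
      exact Equiv.apply_symm_apply _ _
    have h2 : (S.topF d).map (S.fromTop hM) ≫ S.topUnit hN = 𝟙 _ := by
      rw [← cancel_epi (S.topUnit hN), ← Category.assoc, h1, Category.id_comp, Category.comp_id]
    rw [Category.assoc, Projective.factorThru_comp, ← Category.assoc,
      S.topProj_naturality hs hM, Category.assoc, ← Functor.map_comp, h2,
      CategoryTheory.Functor.map_id, Category.comp_id]
  refine ⟨s, hom_ext fun x => ?_⟩
  set u := S.resC.map (S.fromTop hM) ≫ s
  -- The generators 1 ⊗ n and their images are both homogeneous of degree `d`, so agreement after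
  -- projection to degree `d` is equality.
  have key : ∀ n : N, toLin u ((ofRes S.ιC S.ιC_mem _).symm (S.stmul 1 n)) =
      (ofRes S.ιC S.ιC_mem _).symm (S.stmul 1 n) := by
    intro n
    have hn : (ofRes S.ιC S.ιC_mem (S.std N)).symm (S.stmul 1 n) ∈ (S.resC.obj (S.std N)).gr d :=
      S.stmul_mem (zero_add d) S.gradingA.one_mem (conc_mem_gr hN n)
    have h1 := congr_toLin hu ((ofRes S.ιC S.ιC_mem _).symm (S.stmul 1 n))
    have h2 := congrArg (fun x => ofRes S.j S.j_mem (S.std N) (toLin (compι S.mem_zero d _)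
      (ofRes S.pC S.pC_mem ((S.topF d).obj (S.std N)) x))) h1
    have h3 : proj (S.resC.obj (S.std N)).isInternal d
        (toLin u ((ofRes S.ιC S.ιC_mem _).symm (S.stmul 1 n))) =
        proj (S.resC.obj (S.std N)).isInternal d
          ((ofRes S.ιC S.ιC_mem _).symm (S.stmul 1 n)) := h2
    rwa [proj_self _ (toLin_mem u hn), proj_self _ hn] at h3
  refine S.std_induction (N := N) (p := fun y => toLin u ((ofRes S.ιC S.ιC_mem _).symm y) =
    (ofRes S.ιC S.ιC_mem _).symm y) (ofRes S.ιC S.ιC_mem _ x) ?_ ?_ ?_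
  · rw [map_zero, map_zero]
  · intro c n
    rw [S.stmul_eq_smul]
    have h1 : (ofRes S.ιC S.ιC_mem (S.std N)).symm (S.ιC c • S.stmul 1 n) =
      c • (ofRes S.ιC S.ιC_mem (S.std N)).symm (S.stmul 1 n) := rfl
    rw [h1, map_smul (toLin u), key]
  · intro y y' hy hy'
    rw [map_add, map_add, hy, hy']

theorem mono_fromTop (hM : upTo 𝒜 d M) [Projective (S.resC.obj M)] : Mono (S.fromTop hM) := by
  obtain ⟨s, hs⟩ := S.exists_retraction_fromTop hM
  have : Mono (S.resC.map (S.fromTop hM)) := by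
    have : Mono (S.resC.map (S.fromTop hM) ≫ s) := by rw [hs]; infer_instance
    exact mono_of_mono _ s
  exact mono_of_injective _ (injective_of_mono (S.resC.map (S.fromTop hM)))

theorem shortExact_fromTop (hM : upTo 𝒜 d M) [Projective (S.resC.obj M)] :
    (ShortComplex.mk (S.fromTop hM) (cokernel.π _) (cokernel.condition _)).ShortExact :=
  have := S.mono_fromTop hM
  { exact := ShortComplex.exact_of_g_is_cokernel _ (cokernelIsCokernel _) }

theorem projective_resC_std_top (hM : upTo 𝒜 d M) [Projective (S.resC.obj M)] :
    Projective (S.resC.obj (S.std ((S.topF d).obj M))) := by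
  obtain ⟨s, hs⟩ := S.exists_retraction_fromTop hM
  exact (Retract.mk (S.resC.map (S.fromTop hM)) s hs).projective

theorem projective_resC_cokernel (hM : upTo 𝒜 d M) [Projective (S.resC.obj M)] :
    Projective (S.resC.obj (cokernel (S.fromTop hM))) := by
  obtain ⟨s, hs⟩ := S.exists_retraction_fromTop hM
  have hE := (S.shortExact_fromTop hM).map_of_exact S.resC
  let sp := ShortComplex.Splitting.ofExactOfRetraction _ hE.exact s hs hE.epi_g
  exact (Retract.mk sp.s _ sp.s_g).projective (p := ‹Projective (S.resC.obj M)›)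

/-- A T-linear lifting problem is inflated along C → T and precomposed with the projection of the
proper standard module to its top. A C-linear solution, restricted to the elements 1 ⊗ n, is
T-linear and solves the original problem. -/
theorem projective_of_projective_resC_std {N : GrMod 𝒯} [Projective (S.resC.obj (S.std N))]
    (hN : conc 𝒯 d N) : Projective N := by
  have := S.isIso_topUnit hN
  refine ⟨fun {E X} f e he => ?_⟩
  have : Epi ((res S.pC S.pC_mem).map e) := epi_of_surjective _ (surjective_of_epi e)
  let r : S.resC.obj (S.std N) ⟶ (res S.pC S.pC_mem).obj X :=
    S.topProj (S.std_upTo hN) ≫ (res S.pC S.pC_mem).map (inv (S.topUnit hN) ≫ f)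
  let g := Projective.factorThru r ((res S.pC S.pC_mem).map e)
  have hg : g ≫ (res S.pC S.pC_mem).map e = r := Projective.factorThru_comp _ _
  refine ⟨ofK
    { toFun := fun n => ofRes S.pC S.pC_mem E (toLin g
        ((ofRes S.ιC S.ιC_mem (S.std N)).symm (S.stmul 1 n)))
      map_add' := fun n n' => by rw [stmul_add, map_add, map_add, map_add]
      map_smul' := fun c n => by
        rw [stmul_smulK, map_smul, toLin_smulK, map_smul]
        rfl }
    (fun t n => ?_)
    (fun i n hn => toLin_mem g (S.stmul_mem (zero_add i) S.gradingA.one_mem hn)),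
    hom_ext fun n => ?_⟩
  · have h1 : (ofRes S.ιC S.ιC_mem (S.std N)).symm (S.stmul 1 (t • n)) =
        S.jC t • (ofRes S.ιC S.ιC_mem (S.std N)).symm (S.stmul 1 n) := by
      refine (ofRes S.ιC S.ιC_mem (S.std N)).injective ?_
      rw [ofRes_smul, S.ιC_jC, LinearEquiv.apply_symm_apply, LinearEquiv.apply_symm_apply,
        smul_stmul, ← S.stmul_j, mul_one, one_mul]
    change ofRes S.pC S.pC_mem E (toLin g
      ((ofRes S.ιC S.ιC_mem (S.std N)).symm (S.stmul 1 (t • n)))) = _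
    rw [h1, map_smul (toLin g), ofRes_smul, S.pC_jC]
    rfl
  · have h1 := congrArg (ofRes S.pC S.pC_mem X)
      (congr_toLin hg ((ofRes S.ιC S.ιC_mem (S.std N)).symm (S.stmul 1 n)))
    refine h1.trans ?_
    have h2 : ofRes S.pC S.pC_mem _ (toLin (S.topProj (S.std_upTo hN))
        ((ofRes S.ιC S.ιC_mem (S.std N)).symm (S.stmul 1 n))) = toLin (S.topUnit hN) n := by
      refine compι_injective S.mem_zero d _ ((ofRes S.j S.j_mem (S.std N)).injective ?_)
      rw [topProj_apply, topUnit_apply, LinearEquiv.apply_symm_apply]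
      exact proj_self _ (S.stmul_mem (zero_add d) S.gradingA.one_mem (conc_mem_gr hN n))
    rw [GrMod.comp_apply, res_map_apply, h2, ← GrMod.comp_apply, IsIso.hom_inv_id_assoc]

end Top
end BorelData
end GradedAlg

/-! ### Truncation of C-projective modules and standard filtrations -/

namespace GradedAlg
open GrMod
namespace BorelData
variable {K : Type u} [Field K] {A B C T : Type u} [Ring A] [Ring B] [Ring C] [Ring T]
    [Algebra K A] [Algebra K B] [Algebra K C] [Algebra K T] {𝒜 : ℤ → Submodule K A}
    {ℬ : ℤ → Submodule K B} {𝒞 : ℤ → Submodule K C} {𝒯 : ℤ → Submodule K T}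
    [FiniteDimensional K A] [FiniteDimensional K B] [FiniteDimensional K C]
    [FiniteDimensional K T] (S : BorelData 𝒜 ℬ 𝒞 𝒯)

/-- The standard modules of the simple modules in degrees `> d`. -/
def standards (d : ℤ) : ObjectProperty (GrMod 𝒜) := fun X =>
  ∃ (e : ℤ) (V P : GrMod 𝒯) (p : P ⟶ V), d < e ∧ Simple V ∧ conc 𝒯 e V ∧ IsProjectiveCover p ∧
    Nonempty (X ≅ S.std P)

/-- The projective cover of a simple quotient of `N` splits off as a direct summand, leaving a
smaller projective kernel. Standardization is exact, so induction on the dimension applies. -/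
theorem isFilteredBy_std {d e : ℤ} (hde : d < e) (N : GrMod 𝒯) [Projective N]
    (hN : conc 𝒯 e N) : IsFilteredBy (S.standards d) (S.std N) := by
  induction hn : N.dim using Nat.strong_induction_on generalizing N with
  | _ n ih =>
  by_cases h0 : IsZero N
  · exact .zero _ (S.stdF.map_isZero h0)
  obtain ⟨V, f, _, _⟩ := exists_epi_of_not_isZero h0
  have hV : conc 𝒯 e V := support_of_epi f hN
  have := enoughProjectives S.gradingT
  obtain ⟨P, p, hp⟩ := exists_projectiveCover V
  have := hp.1
  have := hp.2.1
  let g := Projective.factorThru f p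
  have hg : g ≫ p = f := Projective.factorThru_comp f p
  have : Epi g := hp.2.2 g (by rw [hg]; infer_instance)
  let s := Projective.factorThru (𝟙 P) g
  have hs : s ≫ g = 𝟙 P := Projective.factorThru_comp _ _
  have hE : (ShortComplex.mk (kernel.ι g) g (kernel.condition g)).ShortExact :=
    { exact := ShortComplex.exact_of_f_is_kernel _ (kernelIsKernel g) }
  have hP0 : P.dim ≠ 0 := fun h => Simple.not_isZero V (IsZero.of_epi p (dim_eq_zero_iff.1 h))
  have hdim : N.dim = (kernel g).dim + P.dim := dim_eq_of_shortExact hE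
  let sp := ShortComplex.Splitting.ofExactOfSection _ hE.exact s hs hE.mono_f
  have : Projective (kernel g) :=
    (Retract.mk (kernel.ι g) sp.r sp.f_r).projective (p := ‹Projective N›)
  exact .ext _ (hE.map_of_exact S.stdF)
    (ih _ (by omega) (kernel g) (support_of_mono (kernel.ι g) hN) rfl)
    ⟨e, V, P, p, hde, inferInstance, hV, hp, ⟨Iso.refl _⟩⟩

theorem std_hom_eq_zero_of_lt {d e : ℤ} (hde : d < e) {N : GrMod 𝒯} (hN : conc 𝒯 e N)
    {X : GrMod 𝒜} (hX : upTo 𝒜 d X) (f : S.std N ⟶ X) : f = 0 := by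
  refine S.std_hom_ext fun n => ?_
  have h := toLin_mem f (S.stmul_mem (zero_add e) S.gradingA.one_mem (conc_mem_gr hN n))
  rw [hX e (by simpa using hde), Submodule.mem_bot] at h
  rw [h]
  rfl

/-- The short exact sequence of kernels of a composition of epimorphisms. -/
theorem shortExact_kernel_comp {R : Type u} [Ring R] [Algebra K R] {ℛ : ℤ → Submodule K R}
    [FiniteDimensional K R] {N M Q Z : GrMod ℛ} {i : N ⟶ M} {π : M ⟶ Q} (w : i ≫ π = 0)
    (h : (ShortComplex.mk i π w).ShortExact) (r : Q ⟶ Z) :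
    ∃ (a : N ⟶ kernel (π ≫ r)) (b : kernel (π ≫ r) ⟶ kernel r) (w : a ≫ b = 0),
      (ShortComplex.mk a b w).ShortExact := by
  have hi : Mono i := h.mono_f
  have hπ : Epi π := h.epi_g
  let a : N ⟶ kernel (π ≫ r) := kernel.lift _ i (by rw [← Category.assoc, w, zero_comp])
  let b : kernel (π ≫ r) ⟶ kernel r :=
    kernel.lift _ (kernel.ι (π ≫ r) ≫ π) (by rw [Category.assoc, kernel.condition])
  have ha : a ≫ kernel.ι (π ≫ r) = i := kernel.lift_ι _ _ _
  have hb : b ≫ kernel.ι r = kernel.ι (π ≫ r) ≫ π := kernel.lift_ι _ _ _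
  have hk : ∀ {X Y : GrMod ℛ} (f : X ⟶ Y) (x : X), toLin f x = 0 →
      ∃ z, toLin (kernel.ι f) z = x := fun f x hx =>
    exists_of_exact (ShortComplex.exact_of_f_is_kernel
      (ShortComplex.mk (kernel.ι f) f (kernel.condition f)) (kernelIsKernel f)) x hx
  have ab : a ≫ b = 0 := by
    rw [← cancel_mono (kernel.ι r), Category.assoc, hb, ← Category.assoc, ha, w, zero_comp]
  refine ⟨a, b, ab, ?_⟩
  have hma : Mono a := by
    have : Mono (a ≫ kernel.ι (π ≫ r)) := by rw [ha]; infer_instance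
    exact mono_of_mono a (kernel.ι (π ≫ r))
  have heb : Epi b := by
    refine epi_of_surjective _ fun z => ?_
    obtain ⟨m, hm⟩ := surjective_of_epi π (toLin (kernel.ι r) z)
    obtain ⟨y, rfl⟩ := hk (π ≫ r) m (by
      rw [GrMod.comp_apply, hm, ← GrMod.comp_apply, kernel.condition]
      rfl)
    refine ⟨y, injective_of_mono (kernel.ι r) ?_⟩
    rw [← GrMod.comp_apply, hb, GrMod.comp_apply, hm]
  refine { exact := shortComplex_exact fun x hx => ?_ }
  have h1 : toLin π (toLin (kernel.ι (π ≫ r)) x) = 0 := by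
    rw [← GrMod.comp_apply, ← hb, GrMod.comp_apply]
    exact (congrArg _ hx).trans (map_zero _)
  obtain ⟨n, hn⟩ := exists_of_exact h.exact _ h1
  refine ⟨n, injective_of_mono (kernel.ι (π ≫ r)) ?_⟩
  rw [← GrMod.comp_apply]
  exact (congr_toLin ha n).trans hn

/-- A module which is projective over the lower Borel subalgebra has a largest quotient in degrees
`≤ d`, with kernel filtered by standard modules. -/
theorem exists_truncation (d : ℤ) (M : GrMod 𝒜) [Projective (S.resC.obj M)] :
    ∃ (M' : GrMod 𝒜) (r : M ⟶ M'), Epi r ∧ upTo 𝒜 d M' ∧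
      IsFilteredBy (S.standards d) (kernel r) ∧
      ∀ (X : GrMod 𝒜), upTo 𝒜 d X → ∀ f : M ⟶ X, ∃ g : M' ⟶ X, r ≫ g = f := by
  induction hn : M.dim using Nat.strong_induction_on generalizing M with
  | _ n ih =>
  by_cases hd : upTo 𝒜 d M
  · exact ⟨M, 𝟙 M, inferInstance, hd, .zero _ (isZero_kernel_of_mono _),
      fun X _ f => ⟨f, Category.id_comp f⟩⟩
  have h0 : ¬ IsZero M := fun h => hd fun i _ => (isZero_iff_gr M).1 h i
  -- The highest degree `e` of `M` exceeds `d`. The submodule generated by the component `M_e` is a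
  -- proper standard module of a projective T-module, and the quotient by it is smaller and again
  -- C-projective.
  obtain ⟨e, he, hne⟩ := Labelling.exists_top_degree h0
  have hde : d < e := by
    by_contra hle
    exact hd fun i hi => he i (by simp only [Set.mem_Iic] at hi ⊢; omega)
  have hE := S.shortExact_fromTop he
  have hN : conc 𝒯 e ((S.topF e).obj M) := comp_conc S.mem_zero e _
  have hp1 := S.projective_resC_std_top he
  have hp2 := S.projective_resC_cokernel he
  have hp3 : Projective ((S.topF e).obj M) := S.projective_of_projective_resC_std hN
  have hdim : M.dim = (S.std ((S.topF e).obj M)).dim + (cokernel (S.fromTop he)).dim :=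
    dim_eq_of_shortExact hE
  have hN0 : (S.std ((S.topF e).obj M)).dim ≠ 0 := by
    intro h
    have := S.isIso_topUnit hN
    exact hne (S.isZero_topF_iff.1
      (((S.topF e).map_isZero (dim_eq_zero_iff.1 h)).of_iso (asIso (S.topUnit hN))))
  obtain ⟨M', r, hr, hM', hf, hfac⟩ := ih _ (by omega) (cokernel (S.fromTop he)) rfl
  refine ⟨M', cokernel.π _ ≫ r, inferInstance, hM', ?_, fun X hX f => ?_⟩
  · obtain ⟨a, b, w, hab⟩ := shortExact_kernel_comp _ hE r
    exact hf.extension _ hab (S.isFilteredBy_std hde _ hN) (Iso.refl _)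
  -- The removed submodule is generated in degree `e > d`, so it dies in any module in degrees ≤ d;
  -- the universal property passes to the cokernel.
  · have hz := S.std_hom_eq_zero_of_lt hde hN hX (S.fromTop he ≫ f)
    obtain ⟨g, hg⟩ := hfac X hX (cokernel.desc _ f hz)
    exact ⟨g, by rw [Category.assoc, hg, cokernel.π_desc]⟩

namespace Labelling
variable {S} {Λ : Type w} (W : S.Labelling Λ)

/-- The projective cover of `L(λ)` surjects onto the standard module of `λ`, with kernel filtered
by standard modules of higher degree. -/
theorem exists_standardFiltration (l : Λ) {P : GrMod 𝒯} {p : P ⟶ W.rep l}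
    (hp : IsProjectiveCover p) : ∃ (R : GrMod 𝒜) (r : R ⟶ W.L l) (q : R ⟶ S.std P),
      IsProjectiveCover r ∧ Epi q ∧ IsFilteredBy (S.standards (W.deg l)) (kernel q) := by
  have := enoughProjectives S.gradingA
  obtain ⟨R, r, hr⟩ := exists_projectiveCover (W.L l)
  have hP : conc 𝒯 (W.deg l) P := conc_of_isEssentialEpi S.mem_zero hp.2 (W.conc_rep l)
  let t := S.stdF.map p ≫ W.q l
  have ht : IsEssentialEpi t :=
    S.isEssentialEpi_std hp.2 hP (W.conc_rep l) (W.q_ne_zero l)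
  have := hp.1
  have := hr.1
  have := hr.2.1
  have := ht.1
  let q : R ⟶ S.std P := Projective.factorThru r t
  have hq : q ≫ t = r := Projective.factorThru_comp r t
  have : Epi q := ht.2 q (by rw [hq]; infer_instance)
  have := S.projective_resC R
  obtain ⟨M', c, hc, hM', hf, hfac⟩ := S.exists_truncation (W.deg l) R
  obtain ⟨g, hg⟩ := hfac _ (S.std_upTo hP) q
  have : Epi g := by
    have : Epi (c ≫ g) := by rw [hg]; infer_instance
    exact epi_of_epi c g
  -- Both modules lie in degrees ≤ deg λ. Projectivity of `P` over T lifts the unit through the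
  -- surjection of top components, and the adjunction turns the lift into a section of `g`.
  let s := (S.stdTopEquiv hP hM').symm
    (Projective.factorThru (S.topUnit hP) ((S.topF (W.deg l)).map g))
  have hs : s ≫ g = 𝟙 _ := by
    refine (S.stdTopEquiv hP (S.std_upTo hP)).injective ?_
    rw [S.stdTopEquiv_naturality hP hM', Equiv.apply_symm_apply, Projective.factorThru_comp]
    rfl
  -- The map from the truncation `M'` to `L(λ)` inherits essentiality from the projective cover. So
  -- the section `s` is epi, hence invertible, and the truncation is the standard module.
  have h1 : IsEssentialEpi (c ≫ g ≫ t) := by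
    rw [← Category.assoc, hg, hq]
    exact hr.2
  have h2 : Epi s := h1.of_comp.2 s (by
    rw [← Category.assoc, hs, Category.id_comp]
    infer_instance)
  have h3 : Mono s := by
    have : Mono (s ≫ g) := by rw [hs]; infer_instance
    exact mono_of_mono s g
  have h4 : IsIso s := isIso_of_mono_of_epi s
  have h5 : IsIso g := by
    have : g = inv s := IsIso.eq_inv_of_hom_inv_id hs
    rw [this]
    infer_instance
  refine ⟨R, r, q, hr, inferInstance, hf.of_iso ?_⟩
  exact (kernelCompMono c g).symm ≪≫ kernelIsoOfEq hg

end Labelling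
end BorelData
end GradedAlg

/-! ### The standardly stratified structure and its dual -/

namespace GradedAlg
open GrMod
namespace BorelData
variable {K : Type u} [Field K] {A B C T : Type u} [Ring A] [Ring B] [Ring C] [Ring T]
    [Algebra K A] [Algebra K B] [Algebra K C] [Algebra K T] {𝒜 : ℤ → Submodule K A}
    {ℬ : ℤ → Submodule K B} {𝒞 : ℤ → Submodule K C} {𝒯 : ℤ → Submodule K T}
    [FiniteDimensional K A] [FiniteDimensional K B] [FiniteDimensional K C]
    [FiniteDimensional K T] {S : BorelData 𝒜 ℬ 𝒞 𝒯}

namespace Labelling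
variable {Λ : Type w} (W : S.Labelling Λ)

theorem exists_iso_of_standards {PT : Λ → GrMod 𝒯} {p : ∀ l, PT l ⟶ W.rep l}
    (hp : ∀ l, IsProjectiveCover (p l)) {d : ℤ} {X : GrMod 𝒜} (h : S.standards d X) :
    ∃ m, d < W.deg m ∧ Nonempty (X ≅ S.std (PT m)) := by
  obtain ⟨e, V, P, f, hde, hV, hVe, hf, ⟨i⟩⟩ := h
  obtain ⟨m, ⟨j⟩⟩ := W.exists_iso V hV
  obtain ⟨k⟩ := hf.nonempty_iso (hp m) j
  refine ⟨m, ?_, ⟨i ≪≫ S.stdF.mapIso k⟩⟩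
  rwa [W.deg_eq_of_conc m (support_of_mono j.inv hVe)]

/-- The dual labelling, of the simple modules over the opposite algebra. -/
noncomputable def op : S.op.Labelling Λ where
  rep l := (W.rep l).dual
  deg := W.deg
  L l := (W.L l).dual
  -- The projection of `L(λ)` onto its top component λ corresponds by adjunction to a nonzero
  -- morphism into the proper costandard module; its transpose plays the role of the head map over
  -- the opposite algebra.
  q l := (dualEquiv (S.op.std (W.rep l).dual) (W.L l)).symm
    (S.costdTopEquiv (W.conc_rep l) (W.upTo_L l) (W.topIso l).inv)
  simple_rep l := inferInstance
  simple_L l := inferInstance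
  conc_rep l := dual_support (W.conc_rep l)
  q_ne_zero l h := by
    have h1 : S.costdTopEquiv (W.conc_rep l) (W.upTo_L l) (W.topIso l).inv = 0 :=
      (dualEquiv (S.op.std (W.rep l).dual) (W.L l)).symm.injective (h.trans rfl)
    have h2 : S.costdTopEquiv (W.conc_rep l) (W.upTo_L l) 0 = 0 := by
      have := S.costdTopEquiv_naturality_left (W.conc_rep l) (W.upTo_L l) (W.upTo_L l) 0 0
      rwa [comp_zero, zero_comp] at this
    have h3 := (S.costdTopEquiv (W.conc_rep l) (W.upTo_L l)).injective (h1.trans h2.symm)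
    refine Simple.not_isZero (W.rep l) ((IsZero.iff_id_eq_zero _).2 ?_)
    rw [← (W.topIso l).hom_inv_id, h3, comp_zero]
  exists_iso X _ := by
    obtain ⟨l, ⟨e⟩⟩ := W.exists_iso X.undual inferInstance
    exact ⟨l, ⟨evalIso' X ≪≫ (dualF 𝒯).mapIso e.symm.op⟩⟩
  eq_of_iso l l' := fun ⟨e⟩ => W.eq_of_iso l l'
    ⟨evalIso (W.rep l) ≪≫ (undualF 𝒯).mapIso e.symm.op ≪≫ (evalIso (W.rep l')).symm⟩

/-- The category of graded modules is standardly stratified. -/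
theorem isStandardlyStratified
    (hT : ∀ (X : GrMod 𝒯) [Simple X] (f : X ⟶ X), ∃ c : K, f = c • 𝟙 X) {PT : Λ → GrMod 𝒯}
    {p : ∀ l, PT l ⟶ W.rep l} (hp : ∀ l, IsProjectiveCover (p l)) :
    IsStandardlyStratified K W.L W.deg (fun l => S.std (PT l)) where
  noetherian _ := inferInstance
  artinian _ := inferInstance
  enoughProjectives := GrMod.enoughProjectives S.gradingA
  simple := W.simple_L
  existsUnique_iso V _ := W.existsUnique_iso V
  absolutelySimple := W.absolutelySimple hT
  intervalFinite := Set.finite_Icc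
  finiteFibers := W.finite_fiber
  standardization ξ := by
    have hQ := W.below_iff ξ
    have := S.isLocalization_layerTop hQ (W.strictlyBelow_iff ξ)
    obtain ⟨F, h1, h2, h3, h4⟩ := exists_leftAdjoint
      ((strictlyBelow W.L W.deg ξ).inverseImage (below W.L W.deg ξ).ι) (S.layerStdAdj hQ)
    refine ⟨F, h1, h2, h3, fun l h => ?_⟩
    subst h
    have hP : conc 𝒯 (W.deg l) (PT l) :=
      conc_of_isEssentialEpi S.mem_zero (hp l).2 (W.conc_rep l)
    -- In the model of the layer, the image of `L(λ)` is its top component λ, so its projective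
    -- cover is the one over T.
    have hc : IsProjectiveCover (p l ≫ (W.topIso l).hom) := (hp l).comp_iso _
    obtain ⟨Y, y, hy, ⟨e⟩⟩ := h4 (simpleBelow l rfl) ⟨PT l, hP⟩ _
      (IsProjectiveCover.homMk (conc 𝒯 (W.deg l)) (X := ⟨PT l, hP⟩)
        (Y := (S.layerTop (W.deg l) _).obj (simpleBelow l rfl)) hc)
    exact ⟨Y, y, hy, ⟨(below W.L W.deg (W.deg l)).ι.mapIso e⟩⟩
  standardFiltration l := by
    obtain ⟨R, r, q, hr, hq, hf⟩ := W.exists_standardFiltration l (hp l)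
    exact ⟨R, r, q, hr, hq, hf.mono fun X hX => W.exists_iso_of_standards hp hX⟩

/-- The costandard objects of the category of graded modules. -/
theorem isCostandard {IT : Λ → GrMod 𝒯} {i : ∀ l, W.rep l ⟶ IT l}
    (hi : ∀ l, IsInjectiveHull (i l)) :
    IsCostandard W.L W.deg (fun l => S.costd (IT l)) where
  costandardization ξ := by
    have hQ := W.below_iff ξ
    have := S.isLocalization_layerTop hQ (W.strictlyBelow_iff ξ)
    obtain ⟨F, h1, h2, h3, h4⟩ := exists_rightAdjoint
      ((strictlyBelow W.L W.deg ξ).inverseImage (below W.L W.deg ξ).ι) (S.layerCostdAdj hQ)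
    refine ⟨F, h1, h2, h3, fun l h => ?_⟩
    subst h
    -- The dual of the injective hull is a projective cover over Tᵒᵖ, and such a cover stays in the
    -- degree of the simple module.
    have hI : conc 𝒯 (W.deg l) (IT l) := fun n hn => dual_gr_eq_bot_iff.1
      (conc_of_isEssentialEpi S.op.mem_zero ((hi l).op.map (dualF 𝒯)).2
        (dual_support (W.conc_rep l)) n hn)
    have hc : IsInjectiveHull ((W.topIso l).inv ≫ i l) := (hi l).iso_comp (W.topIso l).symm
    obtain ⟨Y, y, hy, ⟨e⟩⟩ := h4 (simpleBelow l rfl) ⟨IT l, hI⟩ _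
      (IsInjectiveHull.homMk (conc 𝒯 (W.deg l)) (Y := ⟨IT l, hI⟩)
        (X := (S.layerTop (W.deg l) _).obj (simpleBelow l rfl)) hc)
    exact ⟨Y, y, hy, ⟨(below W.L W.deg (W.deg l)).ι.mapIso e⟩⟩
  costandardFiltration l := by
    -- The dual injective hulls serve as projective covers for the dual labelling; dualizing the
    -- resulting standard filtration over Aᵒᵖ gives the costandard filtration.
    have hp (m : Λ) : IsProjectiveCover ((dualF 𝒯).map (i m).op) := (hi m).op.map (dualF 𝒯)
    obtain ⟨R, r, q, hr, hq, hf⟩ := W.op.exists_standardFiltration l (hp l)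
    have h1 := (hr.op.map (undualF 𝒜)).iso_comp (evalIso (W.L l))
    refine ⟨R.undual, _, (undualF 𝒜).map q.op, h1,
      (undualF 𝒜).map_mono q.op, ?_⟩
    have h2 := hf.map_op (undualF 𝒜)
      (Q := fun X => ∃ m, W.deg l < W.deg m ∧ Nonempty (X ≅ S.costd (IT m))) fun Y hY => by
        obtain ⟨m, hm, ⟨e⟩⟩ := W.op.exists_iso_of_standards (PT := fun m => (IT m).dual) hp hY
        exact ⟨m, hm, ⟨(undualF 𝒜).mapIso e.symm.op⟩⟩
    exact h2.of_iso ((undualF 𝒜).mapIso (cokernelOpOp q).symm ≪≫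
      PreservesCokernel.iso (undualF 𝒜) q.op)

end Labelling
end BorelData
end GradedAlg

/-! ### From a triangular decomposition to Borel data -/

namespace GradedAlg
open GrMod

/-- This allows a tensor product with T to be replaced by the Borel subalgebra it maps onto, without
first knowing that this map is injective. -/
theorem bijective_of_comp_of_surjective {α β γ : Type*} {f : β → γ} {g : α → γ} (h : α → β)
    (hh : Function.Surjective h) (hg : Function.Bijective g) (hfg : ∀ x, f (h x) = g x) :
    Function.Bijective f := by
  refine ⟨fun a b hab => ?_, fun c => ?_⟩
  · obtain ⟨a, rfl⟩ := hh a
    obtain ⟨b, rfl⟩ := hh b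
    rw [hfg, hfg] at hab
    rw [hg.1 hab]
  · obtain ⟨a, rfl⟩ := hg.2 c
    exact ⟨h a, hfg a⟩

theorem exists_irr_iso {C : Type u} [Category.{v} C] [HasZeroMorphisms C] (X : C) [hX : Simple X] :
    ∃ l : Irr C, Nonempty (X ≅ l.rep) := by
  have h : IsIsomorphic (Irr.rep (Quotient.mk _ ⟨X, hX⟩)) X := Quotient.mk_out
    (s := (isIsomorphicSetoid C).comap (Subtype.val : {S : C // Simple S} → C)) ⟨X, hX⟩
  exact ⟨Quotient.mk _ ⟨X, hX⟩, h.map Iso.symm⟩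

theorem irr_eq_of_iso {C : Type u} [Category.{v} C] [HasZeroMorphisms C] {l l' : Irr C}
    (h : Nonempty (l.rep ≅ l'.rep)) : l = l' :=
  Quotient.out_equiv_out.1 h

/-- A simple graded module over an algebra concentrated in degree zero is simple. -/
theorem isSimpleModule_of_simple {K : Type u} [Field K] {T : Type u} [Ring T] [Algebra K T]
    {𝒯 : ℤ → Submodule K T} [FiniteDimensional K T] {d : ℤ} (X : GrMod 𝒯) [Simple X]
    (hX : conc 𝒯 d X) : IsSimpleModule T X := by
  have hn : ∃ x : X, x ≠ 0 := by
    by_contra! h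
    exact Simple.not_isZero X ((isZero_iff _).2 h)
  obtain ⟨x, hx⟩ := hn
  refine { exists_pair_ne := ⟨⊥, ⊤, fun h => hx ?_⟩, eq_bot_or_eq_top := fun N => ?_ }
  · exact (Submodule.mem_bot T).1 (h ▸ Submodule.mem_top)
  -- As `X` lives in a single degree, every submodule is homogeneous, so graded simplicity rules out
  -- all proper nonzero submodules.
  have hN : ∀ i, ∀ x ∈ N, proj X.isInternal i x ∈ N := by
    intro i x hx
    by_cases h : i = d
    · subst h
      rwa [proj_self _ (conc_mem_gr hX x)]
    · rw [proj_of_ne _ h (conc_mem_gr hX x)]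
      exact N.zero_mem
  have hm : Mono (X.subι N hN) := mono_of_injective _ Subtype.val_injective
  by_cases h0 : X.subι N hN = 0
  · refine Or.inl ((Submodule.eq_bot_iff N).2 fun x hx => ?_)
    exact congr_toLin h0 (⟨x, hx⟩ : N)
  · have := isIso_of_mono_of_nonzero h0
    refine Or.inr ((Submodule.eq_top_iff').2 fun x => ?_)
    obtain ⟨y, rfl⟩ := (bijective_of_isIso (X.subι N hN)).2 x
    exact y.2

section Borel
variable {K : Type u} [Field K] {A : Type u} [Ring A] [Algebra K A] {𝒜 : ℤ → Submodule K A}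
  [GradedAlgebra 𝒜] {P T : Subalgebra K A}

theorem borel_decompose_eq_zero (h : IsHalf 𝒜 P T) {i : ℤ}
    (hP : ∀ a ∈ P, (DirectSum.decompose 𝒜 a i : A) = 0) {b : A} (hb : b ∈ borel h) :
    (DirectSum.decompose 𝒜 b i : A) = 0 := by
  refine Submodule.mul_induction_on (M := Subalgebra.toSubmodule P)
    (N := Subalgebra.toSubmodule T) (r := b)
    (C := fun b => (DirectSum.decompose 𝒜 b i : A) = 0) hb ?_ ?_
  · intro a ha t ht
    rw [decompose_mul_T h ht, hP a ha, zero_mul]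
  · intro x y hx hy
    rw [DirectSum.decompose_add, DirectSum.add_apply, Submodule.coe_add, hx, hy, add_zero]

theorem T_le_borel (h : IsHalf 𝒜 P T) : T ≤ borel h := fun t ht => by
  have := Submodule.mul_mem_mul ((Subalgebra.mem_toSubmodule P).2 P.one_mem)
    ((Subalgebra.mem_toSubmodule T).2 ht)
  rwa [one_mul] at this

theorem half_le_borel (h : IsHalf 𝒜 P T) : P ≤ borel h := fun t ht => by
  have := Submodule.mul_mem_mul ((Subalgebra.mem_toSubmodule P).2 ht)
    ((Subalgebra.mem_toSubmodule T).2 T.one_mem)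
  rwa [mul_one] at this

/-- The multiplication map `P ⊗ T → P T`. -/
def borelMul (h : IsHalf 𝒜 P T) : P ⊗[K] T →ₗ[K] borel h :=
  LinearMap.mul' K (borel h) ∘ₗ TensorProduct.map
    (Subalgebra.inclusion (half_le_borel h)).toLinearMap
    (Subalgebra.inclusion (T_le_borel h)).toLinearMap

/-- The multiplication map `T ⊗ P → P T`. -/
def borelMul' (h : IsHalf 𝒜 P T) : T ⊗[K] P →ₗ[K] borel h :=
  LinearMap.mul' K (borel h) ∘ₗ TensorProduct.map
    (Subalgebra.inclusion (T_le_borel h)).toLinearMap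
    (Subalgebra.inclusion (half_le_borel h)).toLinearMap

theorem borelMul_surjective (h : IsHalf 𝒜 P T) : Function.Surjective (borelMul h) := by
  have key : ∀ b ∈ Subalgebra.toSubmodule P * Subalgebra.toSubmodule T,
      ∃ w, (borelMul h w : A) = b := by
    intro b hb
    refine Submodule.mul_induction_on hb
      (fun a ha t ht => ⟨(⟨a, ha⟩ : P) ⊗ₜ[K] (⟨t, ht⟩ : T), rfl⟩) ?_
    rintro _ _ ⟨x, rfl⟩ ⟨y, rfl⟩
    exact ⟨x + y, by rw [map_add]; rfl⟩
  exact fun b => (key b b.2).imp fun w hw => Subtype.ext hw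

theorem borelMul'_surjective (h : IsHalf 𝒜 P T) : Function.Surjective (borelMul' h) := by
  have key : ∀ b ∈ Subalgebra.toSubmodule T * Subalgebra.toSubmodule P,
      ∃ w, (borelMul' h w : A) = b := by
    intro b hb
    refine Submodule.mul_induction_on hb
      (fun a ha t ht => ⟨(⟨a, ha⟩ : T) ⊗ₜ[K] (⟨t, ht⟩ : P), rfl⟩) ?_
    rintro _ _ ⟨x, rfl⟩ ⟨y, rfl⟩
    exact ⟨x + y, by rw [map_add]; rfl⟩
  exact fun b => (key b (h.comm ▸ b.2)).imp fun w hw => Subtype.ext hw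

theorem subGrading_eq_bot {S : Subalgebra K A} {i : ℤ}
    (h : ∀ a ∈ S, (DirectSum.decompose 𝒜 a i : A) = 0) : subGrading 𝒜 S i = ⊥ :=
  (Submodule.eq_bot_iff _).2 fun x hx => Subtype.ext
    ((DirectSum.decompose_of_mem_same 𝒜 hx).symm.trans (h x x.2))

end Borel

namespace TriangularDecomposition
variable {K : Type u} [Field K] {A : Type u} [Ring A] [Algebra K A] {𝒜 : ℤ → Submodule K A}
  [GradedAlgebra 𝒜] (D : TriangularDecomposition 𝒜)

/-- The Borel subalgebras of a triangular decomposition. -/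
noncomputable def borelData : BorelData 𝒜 (subGrading 𝒜 (borel D.isHalf_pos))
    (subGrading 𝒜 (borel D.isHalf_neg)) (subGrading 𝒜 D.T) where
  gradingA := IsGrading.of 𝒜
  gradingB := isGrading_sub _ (borel_decompose_mem D.isHalf_pos)
  gradingC := isGrading_sub _ (borel_decompose_mem D.isHalf_neg)
  gradingT := isGrading_sub _ fun a ha i => by
    by_cases h : i = 0
    · rw [h, DirectSum.decompose_of_mem_same 𝒜 (D.T_le ha)]
      exact ha
    · rw [DirectSum.decompose_of_mem_ne 𝒜 (D.T_le ha) (Ne.symm h)]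
      exact D.T.zero_mem
  ιB := (borel D.isHalf_pos).val
  ιC := (borel D.isHalf_neg).val
  j := D.T.val
  jB := Subalgebra.inclusion (T_le_borel D.isHalf_pos)
  jC := Subalgebra.inclusion (T_le_borel D.isHalf_neg)
  pB := borelProj D.isHalf_pos
  pC := borelProj D.isHalf_neg
  ιB_mem _ _ h := h
  ιC_mem _ _ h := h
  j_mem _ _ h := h
  pB_mem := borelProj_mem D.isHalf_pos
  pC_mem := borelProj_mem D.isHalf_neg
  ιB_jB _ := rfl
  ιC_jC _ := rfl
  pB_jB t := Subtype.ext (DirectSum.decompose_of_mem_same 𝒜 (D.T_le t.2))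
  pC_jC t := Subtype.ext (DirectSum.decompose_of_mem_same 𝒜 (D.T_le t.2))
  T_deg i hi := subGrading_eq_bot fun a ha =>
    DirectSum.decompose_of_mem_ne 𝒜 (D.T_le ha) hi.symm
  B_deg i hi := subGrading_eq_bot fun _ hb =>
    borel_decompose_eq_zero D.isHalf_pos (fun a ha => (Submodule.mem_bot K).1
      (D.pos_supp i hi ▸ ⟨D.pos_homogeneous a ha i, Submodule.coe_mem _⟩)) hb
  C_deg i hi := subGrading_eq_bot fun _ hb =>
    borel_decompose_eq_zero D.isHalf_neg (fun a ha => (Submodule.mem_bot K).1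
      (D.neg_supp i hi ▸ ⟨D.neg_homogeneous a ha i, Submodule.coe_mem _⟩)) hb
  B_zero _ hb := Subtype.ext (DirectSum.decompose_of_mem_same 𝒜 hb)
  C_zero _ hb := Subtype.ext (DirectSum.decompose_of_mem_same 𝒜 hb)
  X := D.neg
  Y := D.pos
  x := (Subalgebra.inclusion (half_le_borel D.isHalf_neg)).toLinearMap
  y := (Subalgebra.inclusion (half_le_borel D.isHalf_pos)).toLinearMap
  x_one := ⟨1, rfl⟩
  y_one := ⟨1, rfl⟩
  bijective_left := by
    -- After reassociation, A⁻ ⊗ T ⊗ A⁺ maps onto A⁻ ⊗ B⁺ because B⁺ = TA⁺, and the composite to A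
    -- is the bijective multiplication map.
    refine bijective_of_comp_of_surjective
      (LinearMap.lTensor D.neg (borelMul' D.isHalf_pos) ∘ₗ
        (TensorProduct.assoc K D.neg D.T D.pos).toLinearMap)
      ((LinearMap.lTensor_surjective _ (borelMul'_surjective D.isHalf_pos)).comp
        (TensorProduct.assoc K D.neg D.T D.pos).surjective) D.bijective fun w => ?_
    rw [← LinearMap.comp_apply]
    refine LinearMap.congr_fun (TensorProduct.ext_threefold fun a t p => ?_) w
    exact (mul_assoc (a : A) t p).symm
  bijective_right := by
    refine bijective_of_comp_of_surjective
      (LinearMap.rTensor D.pos (borelMul D.isHalf_neg))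
      (LinearMap.rTensor_surjective _ (borelMul_surjective D.isHalf_neg)) D.bijective
      fun w => ?_
    rw [← LinearMap.comp_apply]
    refine LinearMap.congr_fun (TensorProduct.ext_threefold fun a t p => ?_) w
    rfl

variable [FiniteDimensional K A]

theorem conc_of_simple (X : D.GrT) [Simple X] :
    conc (subGrading 𝒜 D.T) (D.exists_degree X).choose X := by
  intro i hi
  by_contra h
  exact hi ((D.exists_degree X).choose_spec.2 i h)

theorem exists_smul_id (X : D.GrT) [Simple X] (f : X ⟶ X) : ∃ c : K, f = c • 𝟙 X := by
  have := isSimpleModule_of_simple X (D.conc_of_simple X)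
  obtain ⟨c, hc⟩ := D.split X (toLin f)
  exact ⟨c, hom_ext hc⟩

/-- The simple graded modules, labelled by the simple graded `T`-modules. -/
noncomputable def labelling : D.borelData.Labelling (Irr D.GrT) :=
  -- Any simple quotient will do: a nonzero morphism from the proper standard module to a simple
  -- module is automatically essential, so the chosen quotient is the head.
  have h (l : Irr D.GrT) := exists_epi_of_not_isZero
    (D.borelData.not_isZero_std (D.conc_of_simple l.rep))
  { rep := Irr.rep
    deg := D.deg
    L := fun l => (h l).choose
    q := fun l => (h l).choose_spec.choose
    simple_rep := fun _ => inferInstance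
    simple_L := fun l => (h l).choose_spec.choose_spec.1
    conc_rep := fun l => D.conc_of_simple l.rep
    q_ne_zero := fun l =>
      have := (h l).choose_spec.choose_spec.1
      have := (h l).choose_spec.choose_spec.2
      ne_zero_of_epi _
    exists_iso := fun X _ => exists_irr_iso X
    eq_of_iso := fun _ _ => irr_eq_of_iso }

end TriangularDecomposition

/-- The dual of a projective cover of the dual module over the opposite algebra, composed with
evaluation into the bidual. -/
theorem GrMod.exists_injectiveHull {K : Type u} [Field K] {R : Type u} [Ring R] [Algebra K R]
    {ℛ : ℤ → Submodule K R} [FiniteDimensional K R] (h : IsGrading ℛ) (X : GrMod ℛ) :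
    ∃ (I : GrMod ℛ) (i : X ⟶ I), IsInjectiveHull i := by
  have := enoughProjectives h.op
  obtain ⟨P, p, hp⟩ := exists_projectiveCover X.dual
  exact ⟨P.undual, _, (hp.op.map (undualF ℛ)).iso_comp (evalIso X)⟩

end GradedAlg

theorem theorem4 {K A : Type u} [Field K] [Ring A] [Algebra K A] [FiniteDimensional K A]
    (𝒜 : ℤ → Submodule K A) [GradedAlgebra 𝒜] (D : TriangularDecomposition 𝒜) :
    ∃ (L : Irr D.GrT → GrMod 𝒜) (PT IT : Irr D.GrT → D.GrT),
      -- `L(λ)` is the head of the proper standard module of `λ`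
      (∀ l, ∃ q : D.properStandard l.rep ⟶ L l, IsEssentialEpi q) ∧
      -- `PT(λ)`, resp. `IT(λ)`, is the projective cover, resp. injective hull, of `λ` in `G(T)`
      (∀ l, ∃ p : PT l ⟶ l.rep, IsProjectiveCover p) ∧
      (∀ l, ∃ i : l.rep ⟶ IT l, IsInjectiveHull i) ∧
      IsStandardlyStratified K L D.deg (fun l => D.properStandard (PT l)) ∧
      IsCostandard L D.deg (fun l => D.properCostandard (IT l)) := by
  have := GrMod.enoughProjectives D.borelData.gradingT
  choose PT p hp using fun l : Irr D.GrT => GrMod.exists_projectiveCover l.rep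
  choose IT i hi using fun l : Irr D.GrT =>
    GrMod.exists_injectiveHull D.borelData.gradingT l.rep
  -- The modules `D.properStandard` and `D.properCostandard` agree by definition with `std` and
  -- `costd` of `D.borelData`, so the general results apply directly.
  exact ⟨D.labelling.L, PT, IT, fun l => ⟨_, D.labelling.isEssentialEpi_q l⟩,
    fun l => ⟨p l, hp l⟩, fun l => ⟨i l, hi l⟩,
    D.labelling.isStandardlyStratified D.exists_smul_id hp, D.labelling.isCostandard hi⟩
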